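/- Let $(M,\lambda)$ be a $2$-dimensional Liouville domain: $M$ is a compact smooth surface with boundary and $\lambda$ is a smooth $1$-form on $M$ such that $d\lambda$ is symplectic and the vector field $X$ defined by $d\lambda(X,\cdot)=\lambda$ points strictly outwards along $\partial M$. Let $\mathrm{Diff}_{+,c}(M)$ be the space of orientation-preserving (for the orientation given by $d\lambda$) compactly supported diffeomorphisms of $M$, that is, those whose support $\overline{\{x : \varphi(x)\neq x\}}$ is contained in the interior of $M$, with the $C^\infty$ topology (uniform convergence of all derivatives in charts). Let $\mathrm{Exact}_c(M,\lambda)$ be the set of compactly supported exact symplectomorphisms, that is, the compactly supported diffeomorphisms $\varphi$ of $M$ such that $\varphi^*\lambda-\lambda=dF$ for some smooth function $F: M\to\mathbb{R}$. Then $\mathrm{Exact}_c(M,\lambda)\subseteq \mathrm{Diff}_{+,c}(M)$, and $\mathrm{Exact}_c(M,\lambda)$ is a deformation retract of $\mathrm{Diff}_{+,c}(M)$: there is a continuous map $H:[0,1]\times \mathrm{Diff}_{+,c}(M)\to \mathrm{Diff}_{+,c}(M)$ with $H(0,\varphi)=\varphi$ and $H(1,\varphi)\in \mathrm{Exact}_c(M,\lambda)$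 for all $\varphi$, and $H(t,\varphi)=\varphi$ for all $t\in[0,1]$ and all $\varphi\in\mathrm{Exact}_c(M,\lambda)$. -/

import Mathlib

open Set Topology
open scoped Manifold ContDiff

noncomputable section

namespace LiouvilleSurface

/-- The model vector space `ℝ²` of a surface. -/
abbrev Plane : Type := EuclideanSpace ℝ (Fin 2)

/-- The model with corners of a surface with boundary: the closed half plane `{x | 0 ≤ x 0}`. -/
abbrev HalfPlaneModel : ModelWithCorners ℝ Plane (EuclideanHalfSpace 2) := 𝓡∂ 2

variable (M : Type*) [TopologicalSpace M] [ChartedSpace (EuclideanHalfSpace 2) M]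

/-- (Not necessarily smooth) differential 1-forms on the surface `M`. -/
abbrev OneForm : Type _ := ∀ x : M, TangentSpace HalfPlaneModel x →L[ℝ] ℝ

/-- Smooth diffeomorphisms of the surface `M` (up to the boundary). -/
abbrev Diffeo : Type _ := Diffeomorph HalfPlaneModel HalfPlaneModel M M ∞

variable {M}

/-! ### Differential forms -/

/-- Smoothness (up to the boundary) of a 1-form, as a section of the cotangent bundle. -/
def IsSmoothForm [IsManifold HalfPlaneModel ∞ M] (α : OneForm M) : Prop :=
  ContMDiff HalfPlaneModel (HalfPlaneModel.prod 𝓘(ℝ, Plane →L[ℝ] ℝ)) ∞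
    (fun x ↦ Bundle.TotalSpace.mk' (Plane →L[ℝ] ℝ)
      (E := fun x : M ↦ TangentSpace HalfPlaneModel x →L[ℝ] Bundle.Trivial M ℝ x) x (α x))

/-- The pullback `f^* α`. -/
def pullback (f : M → M) (α : OneForm M) : OneForm M :=
  fun x ↦ (α (f x)).comp (mfderiv HalfPlaneModel HalfPlaneModel f x)

/-- The coordinate expression of the 1-form `α` in the preferred chart at `x₀`: its pullback by the
inverse of the chart. Only the values near the image of `x₀` in the half plane matter. -/
def coordForm (α : OneForm M) (x₀ : M) (y : Plane) : Plane →L[ℝ] ℝ :=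
  (α ((extChartAt HalfPlaneModel x₀).symm y)).comp
    (mfderivWithin 𝓘(ℝ, Plane) HalfPlaneModel (extChartAt HalfPlaneModel x₀).symm
      (range HalfPlaneModel) y)

/-- The exterior derivative `dα`, as a bilinear function on tangent vectors: computed at `x` in the
preferred chart at `x`, with `(dα)(v, w) = D_v α(w) - D_w α(v)`. -/
def extD (α : OneForm M) (x : M) (v w : TangentSpace HalfPlaneModel x) : ℝ :=
  extDerivWithin
    (fun y ↦ ContinuousAlternatingMap.ofSubsingleton ℝ Plane ℝ (0 : Fin 1) (coordForm α x y))
    (range HalfPlaneModel) (extChartAt HalfPlaneModel x x)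
    ![mfderiv HalfPlaneModel 𝓘(ℝ, Plane) (extChartAt HalfPlaneModel x) x v,
      mfderiv HalfPlaneModel 𝓘(ℝ, Plane) (extChartAt HalfPlaneModel x) x w]

/-- A 1-form is exact if it is the differential of a smooth function (on all of `M`, up to the
boundary). -/
def IsExactForm (α : OneForm M) : Prop :=
  ∃ F : M → ℝ, ContMDiff HalfPlaneModel 𝓘(ℝ, ℝ) ∞ F ∧
    ∀ (x : M) (v : TangentSpace HalfPlaneModel x),
      α x v = (mfderiv HalfPlaneModel 𝓘(ℝ, ℝ) F x v : ℝ)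

/-! ### Liouville domains -/

/-- A tangent vector at a boundary point is outward pointing if its component in the direction of
the inner normal of the half plane is negative. -/
def IsOutward (x : M) (v : TangentSpace HalfPlaneModel x) : Prop :=
  let u : Plane := mfderiv HalfPlaneModel 𝓘(ℝ, Plane) (extChartAt HalfPlaneModel x) x v
  u 0 < 0

/-- `α` is a Liouville form on the compact surface `M`, that is, `(M, α)` is a Liouville domain:
`α` is smooth, `dα` is a symplectic form, and the Liouville vector field `X`, defined by
`dα(X, ·) = α`, points outwards along the boundary. -/
structure IsLiouville [IsManifold HalfPlaneModel ∞ M] (α : OneForm M) : Prop where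
  smooth : IsSmoothForm α
  nondegenerate : ∀ (x : M) (v : TangentSpace HalfPlaneModel x), v ≠ 0 → ∃ w, extD α x v w ≠ 0
  outward : ∀ x ∈ HalfPlaneModel.boundary M, ∃ X : TangentSpace HalfPlaneModel x,
    (∀ w, extD α x X w = α x w) ∧ IsOutward x X

/-! ### Spaces of diffeomorphisms -/

/-- The diffeomorphism `φ` is compactly supported: its support, the closure of
`{x | φ x ≠ x}`, lies in the interior of the compact surface `M`. -/
def IsCompactlySupported (φ : Diffeo M) : Prop :=
  closure {x | φ x ≠ x} ⊆ HalfPlaneModel.interior M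

/-- `φ` preserves the orientation given by the area form `dα`: it sends positive bases to
positive bases. -/
def IsOrientationPreserving (α : OneForm M) (φ : Diffeo M) : Prop :=
  ∀ (x : M) (v w : TangentSpace HalfPlaneModel x), 0 < extD α x v w →
    0 < extD α (φ x) (mfderiv HalfPlaneModel HalfPlaneModel φ x v)
      (mfderiv HalfPlaneModel HalfPlaneModel φ x w)

/-- `φ` is an exact symplectomorphism: `φ^* α - α` is exact. -/
def IsExactSymplectomorphism (α : OneForm M) (φ : Diffeo M) : Prop :=
  IsExactForm (fun x ↦ pullback φ α x - α x)

/-- The set of compactly supported orientation-preserving diffeomorphisms. -/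
def diffPlusC (α : OneForm M) : Set (Diffeo M) :=
  {φ | IsCompactlySupported φ ∧ IsOrientationPreserving α φ}

/-- The set of compactly supported exact symplectomorphisms. -/
def exactC (α : OneForm M) : Set (Diffeo M) :=
  {φ | IsCompactlySupported φ ∧ IsExactSymplectomorphism α φ}

/-! ### The `C^∞` topology -/

/-- The expression of the map `f` in the charts `c` and `c'`. -/
def chartExpr (c c' : OpenPartialHomeomorph M (EuclideanHalfSpace 2)) (f : M → M) :
    Plane → Plane :=
  c'.extend HalfPlaneModel ∘ f ∘ (c.extend HalfPlaneModel).symm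

/-- The basic neighbourhood of `f` given by charts `c`, `c'`, a compact set `K`, an order `k` and
`ε`: the `g` that map `K` into the domain of `c'` and whose coordinate expression is `ε`-close to
that of `f` on `K`, together with all derivatives up to order `k`. -/
def cInftyNhd (c c' : OpenPartialHomeomorph M (EuclideanHalfSpace 2)) (K : Set M) (k : ℕ) (ε : ℝ)
    (f : Diffeo M) : Set (Diffeo M) :=
  {g | MapsTo g K c'.source ∧ ∀ j ≤ k, ∀ x ∈ K,
    ‖iteratedFDerivWithin ℝ j (chartExpr c c' g) (range HalfPlaneModel)
        (c.extend HalfPlaneModel x) -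
      iteratedFDerivWithin ℝ j (chartExpr c c' f) (range HalfPlaneModel)
        (c.extend HalfPlaneModel x)‖ < ε}

/-- The `C^∞` (Whitney) topology on the diffeomorphisms of the compact surface `M`: uniform
convergence of all derivatives in charts on compact sets. -/
instance cInftyTopology : TopologicalSpace (Diffeo M) :=
  TopologicalSpace.generateFrom
    {U | ∃ c ∈ IsManifold.maximalAtlas HalfPlaneModel ∞ M,
      ∃ c' ∈ IsManifold.maximalAtlas HalfPlaneModel ∞ M,
      ∃ (K : Set M) (k : ℕ) (ε : ℝ) (f : Diffeo M), IsCompact K ∧ K ⊆ c.source ∧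
        MapsTo f K c'.source ∧ 0 < ε ∧ U = cInftyNhd c c' K k ε f}

/-- `A` is a (strong) deformation retract of the space `X`: the identity of `X` is homotopic,
through maps that fix every point of `A`, to a map with values in `A`. -/
def IsDeformationRetract {X : Type*} [TopologicalSpace X] (A : Set X) : Prop :=
  ∃ r : C(X, A), (ContinuousMap.id X).HomotopicRel
    ((⟨Subtype.val, continuous_subtype_val⟩ : C(A, X)).comp r) A

end LiouvilleSurface

end

/-!
The retraction is Moser's argument, carried out for all `φ` at once. For `φ` compactly supported and
orientation-preserving the 1-forms `λ_t = (1 - t) α + t φ^* α`, `0 ≤ t ≤ 1`, have nondegenerate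
differentials, because `d(φ^* α)` is a positive multiple of `dα`. They are constant in `t` near the
boundary. Let `γ = φ^* α - α - dG` with a function `G` that is locally constant near the boundary,
and let `Ψ_t` be the flow of the field `X_t` with `dλ_t(X_t, ·) = -γ`. By Cartan's formula the
derivative of `Ψ_t^* λ_t` is the differential of `(G + λ_t(X_t)) ∘ Ψ_t`, so `Ψ_1^* φ^* α - α` is
exact, and `φ ∘ Ψ_t` is a path from `φ` to an exact symplectomorphism (`exists_moser_flow`). The
correction `dG` makes the path constant where it has to be: if `φ^* α - α` is exact, `G` is a
primitive of it and `γ = 0`.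

What needs care is the dependence on `φ`. Continuity in the `C^∞` topology is expressed by families
of maps, parametrized by a topological space, all of whose derivatives are jointly continuous
in the parameter and the point (`FamOn` on a vector space, `FamM` and `FamMap` on the surface). The
identity of the diffeomorphism group is such a family (`famMap_diffeo`), and such a family of
diffeomorphisms is a continuous map to the group (`FamMap.continuous_diffeo`).

* Flows of families are families (`IsFieldFamily.exists_flow_diffeo`). The surface is embedded in
  a vector space, and a field that vanishes near the boundary is extended by zero across the
  boundary in each chart; the neighbourhood of the boundary may depend on the parameter, since all
  derivatives vanish on the boundary itself. On the vector space the derivatives of the flow are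
  obtained by induction from the tangent field (`famOn_flow`), and the image of the surface is
  invariant.
* The functions `G` form a family (`exists_primitive_family`). They are radial integrals over discs
  glued by a partition of unity. The constants of integration must be continuous in `φ`, also at
  those `φ` for which there is no primitive. They are integrals along chains of radii, fixed once
  for all `φ`; between boundary points that are close to each other the chains are chosen
  such that `G` is locally constant near the boundary.

All 1-forms are finite sums `∑ a i • d(h i)` with smooth functions on the whole surface
(`IsSmoothForm.exists_formSum`), whose pullbacks and exterior derivatives are given by composition
and by the areas `d(a i) ∧ d(h i)`; this replaces the calculus of differential forms.
-/

open Set Topology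
open scoped Manifold ContDiff

noncomputable section

namespace LiouvilleSurface

open Filter Function

set_option linter.unusedSectionVars false

/-! ### Families of maps with jointly continuous derivatives -/

section Families

variable {P Q : Type*} [TopologicalSpace P] [TopologicalSpace Q]
  {E F G H : Type} [NormedAddCommGroup E] [NormedSpace ℝ E] [NormedAddCommGroup F]
  [NormedSpace ℝ F] [NormedAddCommGroup G] [NormedSpace ℝ G] [NormedAddCommGroup H]
  [NormedSpace ℝ H]

/-- The family of maps `f p : E → F`, with `p` in a topological space `P`, is differentiable `n`
times within `S` at the points of `Ω ⊆ P × E`, with all derivatives up to order `n` jointly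
continuous on `Ω`. Nothing is differentiated in the parameter. -/
def FamOn (S : Set E) (Ω : Set (P × E)) :
    ℕ → ∀ {F : Type} [NormedAddCommGroup F] [NormedSpace ℝ F], (P → E → F) → Prop
  | 0, _, _, _, f => ContinuousOn (uncurry f) Ω
  | n + 1, _, _, _, f => ContinuousOn (uncurry f) Ω ∧
      (∀ z ∈ Ω, DifferentiableWithinAt ℝ (f z.1) S z.2) ∧
      FamOn S Ω n (fun p y ↦ fderivWithin ℝ (f p) S y)

/-- The admissible domains for `FamOn`: derivatives within `S` are unique, and the slices of `Ω`
are relatively open subsets of `S`. -/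
structure FamDomain (S : Set E) (Ω : Set (P × E)) : Prop where
  uniq : UniqueDiffOn ℝ S
  mem : ∀ z ∈ Ω, z.2 ∈ S
  nhds : ∀ z ∈ Ω, ∀ᶠ y in 𝓝[S] z.2, (z.1, y) ∈ Ω

variable {S : Set E} {Ω Ω' : Set (P × E)} {n : ℕ} {f g : P → E → F}

theorem FamDomain.inter_open (h : FamDomain S Ω) {W : Set (P × E)} (hW : IsOpen W) :
    FamDomain S (W ∩ Ω) where
  uniq := h.uniq
  mem z hz := h.mem z hz.2
  nhds z hz := by
    have h1 : ∀ᶠ y in 𝓝 z.2, (z.1, y) ∈ W :=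
      (Continuous.prodMk_right z.1).continuousAt.eventually (hW.mem_nhds hz.1)
    filter_upwards [h.nhds z hz.2, mem_nhdsWithin_of_mem_nhds h1] with y h2 h3 using ⟨h3, h2⟩

theorem FamDomain.univ_univ : FamDomain (univ : Set E) (univ : Set (P × E)) :=
  ⟨uniqueDiffOn_univ, by simp, by simp⟩

theorem FamDomain.prod {T : Set P} {U : Set E} (hS : UniqueDiffOn ℝ S) (hU : U ⊆ S)
    (hU' : ∀ y ∈ U, U ∈ 𝓝[S] y) : FamDomain S (T ×ˢ U) :=
  ⟨hS, fun z hz ↦ hU hz.2, fun z hz ↦ by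
    filter_upwards [hU' z.2 hz.2] with y hy using ⟨hz.1, hy⟩⟩

theorem FamOn.continuousOn (hf : FamOn S Ω n f) : ContinuousOn (uncurry f) Ω := by
  cases n with
  | zero => exact hf
  | succ n => exact hf.1

theorem FamOn.of_succ (hf : FamOn S Ω (n + 1) f) : FamOn S Ω n f := by
  induction n generalizing F with
  | zero => exact hf.1
  | succ n ih => exact ⟨hf.1, hf.2.1, ih hf.2.2⟩

theorem FamOn.of_le {m : ℕ} (hf : FamOn S Ω n f) (h : m ≤ n) : FamOn S Ω m f := by
  induction n, h using Nat.le_induction with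
  | base => exact hf
  | succ n _ ih => exact ih hf.of_succ

theorem FamOn.mono (hf : FamOn S Ω n f) (h : Ω' ⊆ Ω) : FamOn S Ω' n f := by
  induction n generalizing F with
  | zero => exact ContinuousOn.mono hf h
  | succ n ih => exact ⟨hf.1.mono h, fun z hz ↦ hf.2.1 z (h hz), ih hf.2.2⟩

theorem FamOn.congr (hf : FamOn S Ω n f) (hΩ : FamDomain S Ω)
    (h : ∀ z ∈ Ω, g z.1 z.2 = f z.1 z.2) : FamOn S Ω n g := by
  have h0 : ContinuousOn (uncurry g) Ω := hf.continuousOn.congr fun z hz ↦ h z hz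
  induction n generalizing F with
  | zero => exact h0
  | succ n ih =>
    have h1 : ∀ z ∈ Ω, g z.1 =ᶠ[𝓝[S] z.2] f z.1 := fun z hz ↦ by
      filter_upwards [hΩ.nhds z hz] with y hy using h (z.1, y) hy
    have h2 : ∀ z ∈ Ω, fderivWithin ℝ (g z.1) S z.2 = fderivWithin ℝ (f z.1) S z.2 :=
      fun z hz ↦ (h1 z hz).fderivWithin_eq (h z hz)
    exact ⟨h0, fun z hz ↦ (hf.2.1 z hz).congr_of_eventuallyEq (h1 z hz) (h z hz),
      ih hf.2.2 h2 (hf.2.2.continuousOn.congr fun z hz ↦ h2 z hz)⟩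

theorem FamOn.of_local (h : ∀ z ∈ Ω, ∃ W ∈ 𝓝 z, FamOn S (W ∩ Ω) n f) : FamOn S Ω n f := by
  have h0 : ContinuousOn (uncurry f) Ω := fun z hz ↦ by
    obtain ⟨W, hW, hf⟩ := h z hz
    have := hf.continuousOn z ⟨mem_of_mem_nhds hW, hz⟩
    exact (continuousWithinAt_inter' (mem_nhdsWithin_of_mem_nhds hW)).1 (by rwa [inter_comm])
  induction n generalizing F with
  | zero => exact h0
  | succ n ih =>
    have h1 : ∀ z ∈ Ω, ∃ W ∈ 𝓝 z, FamOn S (W ∩ Ω) n (fun p y ↦ fderivWithin ℝ (f p) S y) :=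
      fun z hz ↦ by
        obtain ⟨W, hW, hf⟩ := h z hz
        exact ⟨W, hW, hf.2.2⟩
    refine ⟨h0, fun z hz ↦ ?_, ih h1 ?_⟩
    · obtain ⟨W, hW, hf⟩ := h z hz
      exact hf.2.1 z ⟨mem_of_mem_nhds hW, hz⟩
    · intro z hz
      obtain ⟨W, hW, hf⟩ := h1 z hz
      have := hf.continuousOn z ⟨mem_of_mem_nhds hW, hz⟩
      exact (continuousWithinAt_inter' (mem_nhdsWithin_of_mem_nhds hW)).1 (by rwa [inter_comm])

theorem FamOn.clm (hΩ : FamDomain S Ω) (L : F →L[ℝ] G)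
    (hf : FamOn S Ω n f) : FamOn S Ω n (fun p y ↦ L (f p y)) := by
  induction n generalizing F G with
  | zero => exact L.continuous.comp_continuousOn hf
  | succ n ih =>
    refine ⟨L.continuous.comp_continuousOn hf.1,
      fun z hz ↦ L.differentiableAt.comp_differentiableWithinAt z.2 (hf.2.1 z hz), ?_⟩
    refine (ih (ContinuousLinearMap.compL ℝ E F G L) hf.2.2).congr hΩ fun z hz ↦ ?_
    exact (L.hasFDerivAt.comp_hasFDerivWithinAt z.2
        (hf.2.1 z hz).hasFDerivWithinAt).fderivWithin (hΩ.uniq _ (hΩ.mem z hz))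

theorem FamOn.add (hΩ : FamDomain S Ω) (hf : FamOn S Ω n f) (hg : FamOn S Ω n g) :
    FamOn S Ω n (fun p y ↦ f p y + g p y) := by
  induction n generalizing F with
  | zero => exact ContinuousOn.add hf hg
  | succ n ih =>
    refine ⟨hf.1.add hg.1, fun z hz ↦ (hf.2.1 z hz).add (hg.2.1 z hz), ?_⟩
    refine (ih hf.2.2 hg.2.2).congr hΩ fun z hz ↦ ?_
    exact fderivWithin_fun_add (hΩ.uniq _ (hΩ.mem z hz)) (hf.2.1 z hz) (hg.2.1 z hz)

theorem FamOn.prodMk (hΩ : FamDomain S Ω) {g : P → E → G} (hf : FamOn S Ω n f)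
    (hg : FamOn S Ω n g) : FamOn S Ω n (fun p y ↦ (f p y, g p y)) := by
  refine ((hf.clm hΩ (ContinuousLinearMap.inl ℝ F G)).add hΩ
    (hg.clm hΩ (ContinuousLinearMap.inr ℝ F G))).congr hΩ fun z _ ↦ by simp

theorem FamOn.bilin (hΩ : FamDomain S Ω) {g : P → E → G} (B : F →L[ℝ] G →L[ℝ] H)
    (hf : FamOn S Ω n f) (hg : FamOn S Ω n g) : FamOn S Ω n (fun p y ↦ B (f p y) (g p y)) := by
  induction n generalizing F G H with
  | zero => exact B.isBoundedBilinearMap.continuous.comp_continuousOn (ContinuousOn.prodMk hf hg)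
  | succ n ih =>
    refine ⟨B.isBoundedBilinearMap.continuous.comp_continuousOn (hf.1.prodMk hg.1),
      fun z hz ↦ (B.hasFDerivWithinAt_of_bilinear (hf.2.1 z hz).hasFDerivWithinAt
        (hg.2.1 z hz).hasFDerivWithinAt).differentiableWithinAt, ?_⟩
    refine ((ih (B.precompR E) hf.of_succ hg.2.2).add hΩ
      (ih (B.precompL E) hf.2.2 hg.of_succ)).congr hΩ fun z hz ↦ ?_
    exact B.fderivWithin_of_bilinear (hf.2.1 z hz) (hg.2.1 z hz) (hΩ.uniq _ (hΩ.mem z hz))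

theorem FamOn.mul (hΩ : FamDomain S Ω) {f g : P → E → ℝ}
    (hf : FamOn S Ω n f) (hg : FamOn S Ω n g) : FamOn S Ω n (fun p y ↦ f p y * g p y) :=
  hf.bilin hΩ (ContinuousLinearMap.mul ℝ ℝ) hg

theorem FamOn.smul (hΩ : FamDomain S Ω) {f : P → E → ℝ}
    (hf : FamOn S Ω n f) (hg : FamOn S Ω n g) : FamOn S Ω n (fun p y ↦ f p y • g p y) :=
  hf.bilin hΩ (ContinuousLinearMap.lsmul ℝ ℝ) hg

/-- Composition of families; it is differentiated by the chain rule, so that induction on the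
order of differentiation applies. -/
theorem FamOn.comp (hΩ : FamDomain S Ω) {S' : Set F} {Ω' : Set (P × F)}
    {g : P → F → G} (hg : FamOn S' Ω' n g) (hf : FamOn S Ω n f)
    (hmap : ∀ z ∈ Ω, (z.1, f z.1 z.2) ∈ Ω') (hmap' : ∀ z ∈ Ω, ∀ᶠ y in 𝓝[S] z.2, f z.1 y ∈ S') :
    FamOn S Ω n (fun p y ↦ g p (f p y)) := by
  have h0 : ContinuousOn (uncurry fun p y ↦ g p (f p y)) Ω :=
    hg.continuousOn.comp (continuous_fst.continuousOn.prodMk hf.continuousOn) hmap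
  induction n generalizing G with
  | zero => exact h0
  | succ n ih =>
    have hd : ∀ z ∈ Ω, HasFDerivWithinAt (fun y ↦ g z.1 (f z.1 y))
        ((fderivWithin ℝ (g z.1) S' (f z.1 z.2)).comp (fderivWithin ℝ (f z.1) S z.2)) S z.2 := by
      intro z hz
      have hf1 := (hf.2.1 z hz).hasFDerivWithinAt
      have hg1 := (hg.2.1 _ (hmap z hz)).hasFDerivWithinAt
      refine (HasFDerivWithinAt.comp (t := S') z.2 (s := {y | f z.1 y ∈ S'} ∩ S) hg1
        (hf1.mono inter_subset_right) (fun y hy ↦ hy.1)).mono_of_mem_nhdsWithin ?_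
      exact inter_mem (hmap' z hz) self_mem_nhdsWithin
    refine ⟨h0, fun z hz ↦ (hd z hz).differentiableWithinAt, ?_⟩
    have hg2 := ih hg.2.2 hf.of_succ (hg.2.2.continuousOn.comp
      (continuous_fst.continuousOn.prodMk hf.continuousOn) hmap)
    refine (hg2.bilin hΩ (ContinuousLinearMap.compL ℝ E F G) hf.2.2).congr hΩ fun z hz ↦ ?_
    exact (hd z hz).fderivWithin (hΩ.uniq _ (hΩ.mem z hz))

theorem FamOn.of_contDiffWithinAt (hΩ : FamDomain S Ω) {g : E → F}
    (hg : ∀ z ∈ Ω, ContDiffWithinAt ℝ ∞ g S z.2) : FamOn S Ω n (fun _ y ↦ g y) := by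
  have hc : ContinuousOn (uncurry fun (_ : P) y ↦ g y) Ω := fun z hz ↦
    (hg z hz).continuousWithinAt.comp continuous_snd.continuousWithinAt hΩ.mem
  induction n generalizing F with
  | zero => exact hc
  | succ n ih =>
    have h1 : ∀ z ∈ Ω, ContDiffWithinAt ℝ ∞ (fderivWithin ℝ g S) S z.2 := fun z hz ↦
      (hg z hz).fderivWithin_right hΩ.uniq (by simp) (hΩ.mem z hz)
    exact ⟨hc, fun z hz ↦ (hg z hz).differentiableWithinAt (by simp), ih h1 fun z hz ↦
      (h1 z hz).continuousWithinAt.comp continuous_snd.continuousWithinAt hΩ.mem⟩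

theorem FamOn.of_contDiff (hΩ : FamDomain S Ω) {g : E → F} (hg : ContDiff ℝ ∞ g) :
    FamOn S Ω n (fun _ y ↦ g y) :=
  .of_contDiffWithinAt hΩ fun _ _ ↦ hg.contDiffAt.contDiffWithinAt

theorem FamOn.comp_contDiffOn (hΩ : FamDomain S Ω) {g : F → G} {U : Set F} (hU : IsOpen U)
    (hg : ContDiffOn ℝ ∞ g U) (hf : FamOn S Ω n f) (hmap : ∀ z ∈ Ω, f z.1 z.2 ∈ U) :
    FamOn S Ω n (fun p y ↦ g (f p y)) := by
  have h1 : FamOn univ (univ ×ˢ U : Set (P × F)) n (fun _ y ↦ g y) :=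
    .of_contDiffWithinAt (.prod uniqueDiffOn_univ (subset_univ _)
      fun y hy ↦ by simpa using hU.mem_nhds hy)
      fun z hz ↦ (hg.contDiffAt (hU.mem_nhds hz.2)).contDiffWithinAt
  exact h1.comp hΩ hf (fun z hz ↦ ⟨mem_univ _, hmap z hz⟩) (by simp)

/-- A family depending continuously on the parameter alone. -/
theorem FamOn.of_param (hΩ : FamDomain S Ω) {c : P → F} (hc : ContinuousOn (fun z : P × E ↦ c z.1) Ω) :
    FamOn S Ω n (fun p _ ↦ c p) := by
  cases n with
  | zero => exact hc
  | succ n =>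
    refine ⟨hc, fun z _ ↦ differentiableWithinAt_const _, ?_⟩
    refine (FamOn.of_contDiff hΩ (g := fun _ ↦ (0 : E →L[ℝ] F)) contDiff_const).congr hΩ ?_
    intro z _
    simp

theorem FamOn.param (hf : FamOn S Ω n f) {θ : Q → P} {Ω' : Set (Q × E)}
    (hθ : ContinuousOn (fun z : Q × E ↦ θ z.1) Ω') (hmap : ∀ z ∈ Ω', (θ z.1, z.2) ∈ Ω) :
    FamOn S Ω' n (fun q y ↦ f (θ q) y) := by
  induction n generalizing F with
  | zero =>
    have h : ContinuousOn (uncurry f) Ω := hf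
    exact h.comp (f := fun z : Q × E ↦ (θ z.1, z.2)) (hθ.prodMk continuous_snd.continuousOn) hmap
  | succ n ih =>
    exact ⟨hf.1.comp (f := fun z : Q × E ↦ (θ z.1, z.2)) (hθ.prodMk continuous_snd.continuousOn)
      hmap, fun z hz ↦ hf.2.1 _ (hmap z hz), ih hf.2.2⟩

theorem FamOn.sum (hΩ : FamDomain S Ω) {ι : Type*} {s : Finset ι} {f : ι → P → E → F}
    (hf : ∀ i ∈ s, FamOn S Ω n (f i)) : FamOn S Ω n (fun p y ↦ ∑ i ∈ s, f i p y) := by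
  classical
  induction s using Finset.induction_on with
  | empty => simpa using FamOn.of_contDiff hΩ (g := fun _ ↦ (0 : F)) contDiff_const
  | insert a s ha ih =>
    simp only [Finset.sum_insert ha]
    exact (hf a (by simp)).add hΩ (ih fun i hi ↦ hf i (by simp [hi]))

theorem FamOn.pi (hΩ : FamDomain S Ω) {ι : Type} [Fintype ι] {f : P → E → ι → ℝ}
    (hf : ∀ i, FamOn S Ω n (fun p y ↦ f p y i)) : FamOn S Ω n f := by
  classical
  refine (FamOn.sum hΩ (s := Finset.univ) fun i _ ↦
    (hf i).clm hΩ (ContinuousLinearMap.single ℝ (fun _ : ι ↦ ℝ) i)).congr hΩ fun z _ ↦ ?_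
  ext j
  simp [Finset.sum_apply, Pi.single_apply]

theorem FamOn.contDiffWithinAt (hΩ : FamDomain S Ω) (hf : FamOn S Ω n f) {z : P × E} (hz : z ∈ Ω) :
    ContDiffWithinAt ℝ n (f z.1) S z.2 := by
  have hzS := hΩ.mem z hz
  induction n generalizing F z with
  | zero =>
    simp only [CharP.cast_eq_zero, contDiffWithinAt_zero hzS]
    refine ⟨{y | (z.1, y) ∈ Ω}, hΩ.nhds z hz, ?_⟩
    exact ContinuousOn.comp (f := fun y : E ↦ (z.1, y)) hf.continuousOn
      (Continuous.prodMk_right z.1).continuousOn fun y hy ↦ hy.2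
  | succ n ih =>
    rw [Nat.cast_add, Nat.cast_one, contDiffWithinAt_succ_iff_hasFDerivWithinAt (by simp)]
    refine ⟨{y | (z.1, y) ∈ Ω}, by rw [insert_eq_of_mem hzS]; exact hΩ.nhds z hz, by simp,
      fderivWithin ℝ (f z.1) S, fun y hy ↦ ?_, ?_⟩
    · exact ((hf.2.1 (z.1, y) hy).hasFDerivWithinAt).mono fun y hy ↦ hΩ.mem _ hy
    · exact (ih hf.2.2 hz hzS).mono fun y hy ↦ hΩ.mem _ hy

theorem famOn_iff_iterated (hΩ : FamDomain S Ω) : FamOn S Ω n f ↔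
    (∀ z ∈ Ω, ContDiffWithinAt ℝ n (f z.1) S z.2) ∧
    ∀ j ≤ n, ContinuousOn (fun z : P × E ↦ iteratedFDerivWithin ℝ j (f z.1) S z.2) Ω := by
  induction n generalizing F with
  | zero =>
    constructor
    · intro h
      refine ⟨fun z hz ↦ h.contDiffWithinAt hΩ hz, fun j hj ↦ ?_⟩
      obtain rfl : j = 0 := by lia
      exact (continuousMultilinearCurryFin0 ℝ E F).symm.continuous.comp_continuousOn h
    · intro h
      exact ((continuousMultilinearCurryFin0 ℝ E F).continuous.comp_continuousOn
        (h.2 0 le_rfl)).congr fun z hz ↦ by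
          simp [iteratedFDerivWithin_zero_eq_comp, uncurry]
  | succ n ih =>
    have key : ∀ j, ContinuousOn (fun z : P × E ↦ iteratedFDerivWithin ℝ (j + 1) (f z.1) S z.2) Ω ↔
        ContinuousOn (fun z : P × E ↦
          iteratedFDerivWithin ℝ j (fun y ↦ fderivWithin ℝ (f z.1) S y) S z.2) Ω := by
      intro j
      have h1 : EqOn (fun z : P × E ↦ iteratedFDerivWithin ℝ (j + 1) (f z.1) S z.2)
          (fun z ↦ (continuousMultilinearCurryRightEquiv' ℝ j E F).symm
            (iteratedFDerivWithin ℝ j (fun y ↦ fderivWithin ℝ (f z.1) S y) S z.2)) Ω :=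
        fun z hz ↦ iteratedFDerivWithin_succ_eq_comp_right hΩ.uniq (hΩ.mem z hz)
      rw [continuousOn_congr h1]
      exact (continuousMultilinearCurryRightEquiv' ℝ j E F).symm.comp_continuousOn_iff
    constructor
    · intro h
      refine ⟨fun z hz ↦ h.contDiffWithinAt hΩ hz, fun j hj ↦ ?_⟩
      cases j with
      | zero => exact (continuousMultilinearCurryFin0 ℝ E F).symm.continuous.comp_continuousOn h.1
      | succ j => exact (key j).2 (((ih.1 h.2.2).2) j (by lia))
    · intro h
      refine ⟨?_, fun z hz ↦ (h.1 z hz).differentiableWithinAt (by simp), ih.2 ⟨fun z hz ↦ ?_,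
        fun j hj ↦ (key j).1 (h.2 (j + 1) (by lia))⟩⟩
      · exact ((continuousMultilinearCurryFin0 ℝ E F).continuous.comp_continuousOn
          (h.2 0 (by simp))).congr fun z hz ↦ by
            simp [iteratedFDerivWithin_zero_eq_comp, uncurry]
      · exact (h.1 z hz).fderivWithin_right hΩ.uniq (by simp) (hΩ.mem z hz)

/-- Joint continuity is uniform along a compact set. -/
theorem eventually_forall_norm_sub_lt {Z T : Type*} [TopologicalSpace Z] [TopologicalSpace T]
    {A : Set Z} {K : Set T} (hK : IsCompact K) {g : Z → T → F}
    (hg : ContinuousOn (uncurry g) (A ×ˢ K)) {z₀ : Z} (hz : z₀ ∈ A) {ε : ℝ} (hε : 0 < ε) :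
    ∀ᶠ z in 𝓝[A] z₀, ∀ s ∈ K, ‖g z s - g z₀ s‖ < ε := by
  have : CompactSpace K := isCompact_iff_compactSpace.1 hK
  have hc : Continuous fun w : A × K ↦ g w.1 w.2 := by
    have := hg.comp_continuous (f := fun w : A × K ↦ ((w.1 : Z), (w.2 : T)))
      (by fun_prop) fun w ↦ ⟨w.1.2, w.2.2⟩
    exact this
  have hc' : Continuous fun w : A × K ↦ ‖g w.1 w.2 - g z₀ w.2‖ :=
    (hc.sub (hc.comp (f := fun w : A × K ↦ ((⟨z₀, hz⟩ : A), w.2)) (by fun_prop))).norm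
  have h1 : ∀ᶠ z : A in 𝓝 ⟨z₀, hz⟩, ∀ s ∈ (univ : Set K), ‖g z s - g z₀ s‖ < ε :=
    isCompact_univ.eventually_forall_of_forall_eventually fun s _ ↦
      hc'.continuousAt.eventually (gt_mem_nhds (by simpa using hε))
  rw [nhdsWithin_eq_map_subtype_coe hz, eventually_map]
  filter_upwards [h1] with z hz s hs using hz ⟨s, hs⟩ (mem_univ _)

/-- The part of the domain of a time dependent family that lies over the interval `[a, b]`. -/
def timeDomain (Ω : Set (P × E)) (a b : ℝ) : Set ((P × ℝ) × E) :=
  {z | (z.1.1, z.2) ∈ Ω ∧ z.1.2 ∈ Icc a b}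

theorem FamDomain.timeDomain (h : FamDomain S Ω) (a b : ℝ) : FamDomain S (timeDomain Ω a b) where
  uniq := h.uniq
  mem z hz := h.mem _ hz.1
  nhds z hz := by
    filter_upwards [h.nhds _ hz.1] with y hy using ⟨hy, hz.2⟩

theorem continuousOn_timeDomain {f : P × ℝ → E → F} {a b : ℝ}
    (hf : ContinuousOn (uncurry f) (timeDomain Ω a b)) :
    ContinuousOn (uncurry fun (z : P × E) s ↦ f (z.1, s) z.2) (Ω ×ˢ Icc a b) :=
  hf.comp (f := fun w : (P × E) × ℝ ↦ ((w.1.1, w.2), w.1.2)) (by fun_prop) fun _ hw ↦ hw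

theorem intervalIntegrable_timeDomain {f : P × ℝ → E → F} {a b : ℝ} (hab : a ≤ b)
    (hf : ContinuousOn (uncurry f) (timeDomain Ω a b)) {z : P × E} (hz : z ∈ Ω) :
    IntervalIntegrable (fun s ↦ f (z.1, s) z.2) MeasureTheory.volume a b := by
  refine ContinuousOn.intervalIntegrable ?_
  rw [uIcc_of_le hab]
  exact (continuousOn_timeDomain hf).comp (f := fun s : ℝ ↦ (z, s)) (by fun_prop) fun _ hs ↦ ⟨hz, hs⟩

theorem norm_integral_le_of_forall_le {f : ℝ → F} {a b C : ℝ} (hab : a ≤ b)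
    (h : ∀ s ∈ Icc a b, ‖f s‖ ≤ C) : ‖∫ s in a..b, f s‖ ≤ C * (b - a) := by
  have := intervalIntegral.norm_integral_le_of_norm_le_const (f := f) (a := a) (b := b) (C := C)
    fun s hs ↦ h s (by rw [uIoc_of_le hab] at hs; exact Ioc_subset_Icc_self hs)
  rwa [abs_of_nonneg (by linarith)] at this

theorem hasFDerivWithinAt_integral [CompleteSpace F] (hS : Convex ℝ S) (hΩ : FamDomain S Ω)
    {f : P × ℝ → E → F} {a b : ℝ} (hab : a ≤ b) (hf : FamOn S (timeDomain Ω a b) 1 f)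
    {z : P × E} (hz : z ∈ Ω) :
    HasFDerivWithinAt (fun y ↦ ∫ s in a..b, f (z.1, s) y)
      (∫ s in a..b, fderivWithin ℝ (f (z.1, s)) S z.2) S z.2 := by
  rw [hasFDerivWithinAt_iff_isLittleO, Asymptotics.isLittleO_iff]
  intro c hc
  have hab' : 0 < b - a + 1 := by linarith
  have hD : ContinuousOn (uncurry fun (p : P × ℝ) y ↦ fderivWithin ℝ (f p) S y)
    (LiouvilleSurface.timeDomain Ω a b) := hf.2.2
  have h1 := eventually_forall_norm_sub_lt isCompact_Icc (continuousOn_timeDomain hD) hz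
    (div_pos hc hab')
  have h2 : ∀ᶠ y in 𝓝[S] z.2, ∀ s ∈ Icc a b, ‖fderivWithin ℝ (f (z.1, s)) S y -
      fderivWithin ℝ (f (z.1, s)) S z.2‖ < c / (b - a + 1) := by
    refine Tendsto.eventually (f := fun y ↦ (z.1, y)) ?_ h1
    exact tendsto_nhdsWithin_iff.2 ⟨((Continuous.prodMk_right z.1).tendsto z.2).mono_left
      nhdsWithin_le_nhds, hΩ.nhds z hz⟩
  obtain ⟨r, hr, hball⟩ := Metric.mem_nhdsWithin_iff.1 (h2.and (hΩ.nhds z hz))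
  have hzS := hΩ.mem z hz
  filter_upwards [inter_mem self_mem_nhdsWithin
    (mem_nhdsWithin_of_mem_nhds (Metric.ball_mem_nhds z.2 hr))] with y hy
  have hyΩ : (z.1, y) ∈ Ω := (hball ⟨hy.2, hy.1⟩).2
  have h3 : ∀ s ∈ Icc a b, ‖f (z.1, s) y - f (z.1, s) z.2 -
      fderivWithin ℝ (f (z.1, s)) S z.2 (y - z.2)‖ ≤ c / (b - a + 1) * ‖y - z.2‖ := by
    intro s hs
    refine Convex.norm_image_sub_le_of_norm_hasFDerivWithin_le' (s := Metric.ball z.2 r ∩ S)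
      (f' := fun y ↦ fderivWithin ℝ (f (z.1, s)) S y) (fun x hx ↦ ?_) (fun x hx ↦ ?_)
      ((convex_ball _ _).inter hS) ⟨Metric.mem_ball_self hr, hzS⟩ ⟨hy.2, hy.1⟩
    · exact (hf.2.1 ((z.1, s), x) ⟨(hball hx).2, hs⟩).hasFDerivWithinAt.mono inter_subset_right
    · exact ((hball hx).1 s hs).le
  have hi := fun {z} (hz : z ∈ Ω) ↦ intervalIntegrable_timeDomain hab hf.continuousOn hz
  have hi' := intervalIntegrable_timeDomain hab hD hz
  have h4 : (∫ s in a..b, f (z.1, s) y) - (∫ s in a..b, f (z.1, s) z.2) -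
      (∫ s in a..b, fderivWithin ℝ (f (z.1, s)) S z.2) (y - z.2) =
      ∫ s in a..b, (f (z.1, s) y - f (z.1, s) z.2 -
        fderivWithin ℝ (f (z.1, s)) S z.2 (y - z.2)) := by
    rw [intervalIntegral.integral_sub ((hi hyΩ).sub (hi hz)), intervalIntegral.integral_sub
      (hi hyΩ) (hi hz), ContinuousLinearMap.intervalIntegral_apply hi']
    exact ⟨hi'.1.apply_continuousLinearMap _, hi'.2.apply_continuousLinearMap _⟩
  rw [h4]
  refine (norm_integral_le_of_forall_le hab h3).trans ?_
  have : c / (b - a + 1) * (b - a) ≤ c := by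
    rw [div_mul_eq_mul_div, div_le_iff₀ hab']
    nlinarith
  nlinarith [norm_nonneg (y - z.2)]

theorem continuousOn_integral {f : P × ℝ → E → F} {a b : ℝ} (hab : a ≤ b)
    (hf : ContinuousOn (uncurry f) (timeDomain Ω a b)) :
    ContinuousOn (uncurry fun p y ↦ ∫ s in a..b, f (p, s) y) Ω := by
  intro z hz
  rw [ContinuousWithinAt, Metric.tendsto_nhds]
  intro ε hε
  have hab' : 0 < b - a + 1 := by linarith
  have h1 := eventually_forall_norm_sub_lt isCompact_Icc
    (continuousOn_timeDomain hf) hz (div_pos hε hab')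
  filter_upwards [h1, self_mem_nhdsWithin] with w hw hwΩ
  have hi := fun {z} (hz : z ∈ Ω) ↦ intervalIntegrable_timeDomain hab hf hz
  rw [dist_eq_norm, uncurry, uncurry, ← intervalIntegral.integral_sub (hi hwΩ) (hi hz)]
  refine (norm_integral_le_of_forall_le hab fun s hs ↦ (hw s hs).le).trans_lt ?_
  rw [div_mul_eq_mul_div, div_lt_iff₀ hab']
  nlinarith

theorem FamOn.integral [CompleteSpace F] (hS : Convex ℝ S) (hΩ : FamDomain S Ω)
    {f : P × ℝ → E → F} {a b : ℝ} (hab : a ≤ b) (hf : FamOn S (timeDomain Ω a b) n f) :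
    FamOn S Ω n (fun p y ↦ ∫ s in a..b, f (p, s) y) := by
  have h0 := continuousOn_integral hab hf.continuousOn
  induction n generalizing F with
  | zero => exact h0
  | succ n ih =>
    have hf1 : FamOn S (LiouvilleSurface.timeDomain Ω a b) 1 f :=
      hf.of_le (by lia)
    have hd : ∀ z ∈ Ω, HasFDerivWithinAt (fun y ↦ ∫ s in a..b, f (z.1, s) y)
        (∫ s in a..b, fderivWithin ℝ (f (z.1, s)) S z.2) S z.2 := fun z hz ↦
      hasFDerivWithinAt_integral hS hΩ hab hf1 hz
    refine ⟨h0, fun z hz ↦ (hd z hz).differentiableWithinAt, ?_⟩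
    have hD : FamOn S (LiouvilleSurface.timeDomain Ω a b) n
      (fun q y ↦ fderivWithin ℝ (f q) S y) := hf.2.2
    have h1 := continuousOn_integral hab hD.continuousOn
    have h2 := ih hD h1
    refine FamOn.congr h2 hΩ fun z hz ↦ ?_
    exact (hd z hz).fderivWithin (hΩ.uniq _ (hΩ.mem z hz))

/-- Extension by zero from a relatively open subset `T` of `S`, for a family that vanishes outside a
closed subset `K` of `T`. -/
theorem FamOn.indicator {T K : Set E} (hS : UniqueDiffOn ℝ S)
    (hT' : ∀ y ∈ T, T ∈ 𝓝[S] y) (hK : IsClosed K)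
    (hf : FamOn S (univ ×ˢ T) n f) (h0 : ∀ p, ∀ y ∈ T, y ∉ K → f p y = 0) (hKT : K ∩ S ⊆ T) :
    FamOn S (univ ×ˢ S) n (fun p ↦ T.indicator (f p)) := by
  have hd : FamDomain S (univ ×ˢ S : Set (P × E)) :=
    .prod hS subset_rfl fun y _ ↦ self_mem_nhdsWithin
  refine FamOn.of_local fun z hz ↦ ?_
  by_cases hzT : z.2 ∈ T
  · obtain ⟨V, hV, hzV, hVT⟩ := mem_nhdsWithin.1 (hT' _ hzT)
    refine ⟨univ ×ˢ V, (isOpen_univ.prod hV).mem_nhds ⟨mem_univ _, hzV⟩, ?_⟩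
    refine (hf.mono fun w hw ↦ ⟨mem_univ _, hVT ⟨hw.1.2, hw.2.2⟩⟩).congr
      (hd.inter_open (isOpen_univ.prod hV)) fun w hw ↦ ?_
    exact indicator_of_mem (hVT ⟨hw.1.2, hw.2.2⟩) _
  · have hzK : z.2 ∉ K := fun h ↦ hzT (hKT ⟨h, hz.2⟩)
    have hV : IsOpen (univ ×ˢ Kᶜ : Set (P × E)) := isOpen_univ.prod hK.isOpen_compl
    refine ⟨univ ×ˢ Kᶜ, hV.mem_nhds ⟨mem_univ _, hzK⟩, ?_⟩
    refine (FamOn.of_contDiff (hd.inter_open hV) (g := fun _ ↦ (0 : F)) contDiff_const).congr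
      (hd.inter_open hV) fun w hw ↦ ?_
    by_cases hwT : w.2 ∈ T
    · rw [indicator_of_mem hwT]
      exact h0 _ _ hwT hw.1.2
    · exact indicator_of_notMem hwT _

theorem continuousOn_indicator_univ (hSc : IsClosed S)
    (hf : ContinuousOn (uncurry f) (univ ×ˢ S)) (h0 : ∀ p, ∀ y ∈ frontier S, f p =ᶠ[𝓝[S] y] 0) :
    ContinuousOn (uncurry fun p ↦ S.indicator (f p)) (univ ×ˢ univ) := by
  classical
  rw [univ_prod_univ, continuousOn_univ]
  have e : (uncurry fun p ↦ S.indicator (f p)) =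
      fun z : P × E ↦ if z ∈ (univ ×ˢ S : Set (P × E)) then uncurry f z else 0 := by
    ext z
    simp [indicator_apply, uncurry]
  rw [e]
  refine continuous_if (fun z hz ↦ ?_) ?_ continuousOn_const
  · rw [show {a : P × E | a ∈ (univ ×ˢ S : Set (P × E))} = univ ×ˢ S from rfl,
      frontier_univ_prod_eq] at hz
    exact (h0 z.1 z.2 hz.2).self_of_nhdsWithin (hSc.frontier_subset hz.2)
  · rw [show {a : P × E | a ∈ (univ ×ˢ S : Set (P × E))} = univ ×ˢ S from rfl,
      (isClosed_univ.prod hSc).closure_eq]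
    exact hf

/-- Extension by zero from a closed set `S` to the whole space, for a family each member of which
vanishes near the frontier of `S`. The neighbourhood of the frontier may depend on the parameter:
at the frontier itself all derivatives vanish, which is what joint continuity needs. -/
theorem FamOn.indicator_univ (hSc : IsClosed S)
    (hf : FamOn S (univ ×ˢ S) n f) (h0 : ∀ p, ∀ y ∈ frontier S, f p =ᶠ[𝓝[S] y] 0) :
    FamOn univ (univ ×ˢ univ) n (fun p ↦ S.indicator (f p)) := by
  have hc := continuousOn_indicator_univ hSc hf.continuousOn h0
  induction n generalizing F with
  | zero => exact hc
  | succ n ih =>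
    have hd : ∀ z : P × E, HasFDerivAt (S.indicator (f z.1))
        (S.indicator (fderivWithin ℝ (f z.1) S) z.2) z.2 := by
      intro z
      by_cases hz : z.2 ∈ S
      · by_cases hzi : z.2 ∈ interior S
        · have hn : S ∈ 𝓝 z.2 := mem_interior_iff_mem_nhds.1 hzi
          rw [indicator_of_mem hz]
          refine ((hf.2.1 z ⟨mem_univ _, hz⟩).hasFDerivWithinAt.hasFDerivAt hn).congr_of_eventuallyEq ?_
          filter_upwards [hn] with y hy using indicator_of_mem hy _
        · have hzf : z.2 ∈ frontier S := ⟨subset_closure hz, hzi⟩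
          have h1 := h0 z.1 z.2 hzf
          rw [indicator_of_mem hz, h1.fderivWithin_eq (h1.self_of_nhdsWithin hz)]
          have h2 : S.indicator (f z.1) =ᶠ[𝓝 z.2] fun _ ↦ 0 := by
            filter_upwards [eventually_nhdsWithin_iff.1 h1] with y hy
            by_cases hyS : y ∈ S
            · rw [indicator_of_mem hyS, hy hyS]; rfl
            · exact indicator_of_notMem hyS _
          simpa using (hasFDerivAt_const (0 : F) z.2).congr_of_eventuallyEq h2
      · rw [indicator_of_notMem hz]
        refine (hasFDerivAt_const (0 : F) z.2).congr_of_eventuallyEq ?_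
        filter_upwards [hSc.isOpen_compl.mem_nhds hz] with y hy using indicator_of_notMem hy _
    refine ⟨hc, fun z _ ↦ (hd z).differentiableAt.differentiableWithinAt, ?_⟩
    have h1 : ∀ p, ∀ y ∈ frontier S, (fun y ↦ fderivWithin ℝ (f p) S y) =ᶠ[𝓝[S] y] 0 := by
      intro p y hy
      have := (h0 p y hy).fderivWithin (𝕜 := ℝ)
      filter_upwards [this] with w hw
      simpa using hw
    have e : (fun (p : P) y ↦ fderivWithin ℝ (S.indicator (f p)) univ y) =
        fun p ↦ S.indicator (fun y ↦ fderivWithin ℝ (f p) S y) := by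
      ext1 p
      ext1 y
      rw [fderivWithin_univ, (hd (p, y)).fderiv]
    rw [e]
    exact ih hf.2.2 h1 (continuousOn_indicator_univ hSc hf.2.2.continuousOn h1)

end Families

/-! ### Flows of families of vector fields on a vector space -/

section FlatFlow

variable {P : Type*} [TopologicalSpace P] {E F : Type} [NormedAddCommGroup E] [NormedSpace ℝ E]
  [NormedAddCommGroup F] [NormedSpace ℝ F]

/-- The curve `z` solves the differential equation `z' = Y t z` on the time interval `[0, 1]`. -/
def IsSolution (Y : ℝ → E → E) (z : ℝ → E) : Prop :=
  ∀ t ∈ Icc (0 : ℝ) 1, HasDerivWithinAt z (Y t (z t)) (Icc 0 1) t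

theorem IsSolution.continuousOn {Y : ℝ → E → E} {z : ℝ → E} (h : IsSolution Y z) :
    ContinuousOn z (Icc 0 1) := fun t ht ↦ (h t ht).continuousWithinAt

theorem IsSolution.hasDerivWithinAt_Ici {Y : ℝ → E → E} {z : ℝ → E} (h : IsSolution Y z) {t : ℝ}
    (ht : t ∈ Ico (0 : ℝ) 1) : HasDerivWithinAt z (Y t (z t)) (Ici t) t :=
  (h t (Ico_subset_Icc_self ht)).mono_of_mem_nhdsWithin (Icc_mem_nhdsGE_of_mem ht)

theorem exists_isSolution_of_lipschitz [CompleteSpace E] {Y : ℝ → E → E} {K : NNReal} {C : ℝ}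
    (hY : ∀ t ∈ Icc (0 : ℝ) 1, LipschitzWith K (Y t))
    (hC : ∀ t ∈ Icc (0 : ℝ) 1, ∀ x, ‖Y t x‖ ≤ C)
    (hcont : ∀ x, ContinuousOn (fun t ↦ Y t x) (Icc 0 1)) (x : E) :
    ∃ z : ℝ → E, z 0 = x ∧ IsSolution Y z := by
  have h0 : (0 : ℝ) ∈ Icc (0 : ℝ) 1 := by simp
  have hC0 : 0 ≤ C := (norm_nonneg _).trans (hC 0 h0 x)
  have h : IsPicardLindelof Y (tmin := 0) (tmax := 1) ⟨0, h0⟩ x C.toNNReal 0 C.toNNReal K :=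
    { lipschitzOnWith := fun t ht ↦ (hY t ht).lipschitzOnWith
      continuousOn := fun y _ ↦ hcont y
      norm_le := fun t ht y _ ↦ by simpa [hC0] using hC t ht y
      mul_max_le := by simp }
  exact h.exists_eq_forall_mem_Icc_hasDerivWithinAt₀

/-- Global solvability of linear equations. The right hand side is cut off outside a large ball,
where Grönwall's inequality shows that no solution arrives. -/
theorem exists_isSolution_linear [FiniteDimensional ℝ F] {A : ℝ → F →L[ℝ] F}
    (hA : ContinuousOn A (Icc 0 1)) (w₀ : F) :
    ∃ w : ℝ → F, w 0 = w₀ ∧ IsSolution (fun t w ↦ A t w) w := by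
  have : CompleteSpace F := FiniteDimensional.complete ℝ F
  obtain ⟨K₀, hK₀⟩ := isCompact_Icc.exists_bound_of_continuousOn hA
  obtain ⟨K, hK, hK1⟩ : ∃ K : ℝ, (∀ t ∈ Icc (0 : ℝ) 1, ‖A t‖ ≤ K) ∧ 1 ≤ K :=
    ⟨max K₀ 1, fun t ht ↦ (hK₀ t ht).trans (le_max_left _ _), le_max_right _ _⟩
  set R : ℝ := ‖w₀‖ * Real.exp K + 1 with hR
  have hR0 : 0 < R := by positivity
  let χ : ContDiffBump (0 : F) := ⟨R, R + 1, hR0, by linarith⟩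
  have hχs : ContDiff ℝ 1 fun w : F ↦ χ w • w := χ.contDiff.smul contDiff_id
  have hχc : HasCompactSupport fun w : F ↦ χ w • w := χ.hasCompactSupport.smul_right
  obtain ⟨C, hC⟩ := hχs.lipschitzWith_of_hasCompactSupport hχc (by simp)
  obtain ⟨B, hB⟩ := hχs.continuous.bounded_above_of_compact_support hχc
  have hlip : ∀ t ∈ Icc (0 : ℝ) 1, LipschitzWith (K.toNNReal * C) fun w ↦ A t (χ w • w) := by
    refine fun t ht ↦ LipschitzWith.of_dist_le_mul fun x y ↦ ?_
    rw [dist_eq_norm, ← map_sub]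
    refine ((A t).le_opNorm _).trans ?_
    rw [← dist_eq_norm, NNReal.coe_mul, Real.coe_toNNReal K (by linarith), mul_assoc]
    exact mul_le_mul (hK t ht) (hC.dist_le_mul x y) dist_nonneg (by linarith)
  have hbd : ∀ t ∈ Icc (0 : ℝ) 1, ∀ x, ‖A t (χ x • x)‖ ≤ K * B := fun t ht x ↦
    ((A t).le_opNorm _).trans (mul_le_mul (hK t ht) (hB x) (norm_nonneg _) (by linarith))
  obtain ⟨w, hw0, hw⟩ := exists_isSolution_of_lipschitz (Y := fun t w ↦ A t (χ w • w))
    hlip hbd (fun x ↦ hA.clm_apply continuousOn_const) w₀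
  have hb : ∀ t ∈ Icc (0 : ℝ) 1, ‖w t‖ ≤ gronwallBound ‖w₀‖ K 0 (t - 0) := by
    refine norm_le_gronwallBound_of_norm_deriv_right_le hw.continuousOn
      (fun t ht ↦ hw.hasDerivWithinAt_Ici ht) (by rw [hw0]) fun t ht ↦ ?_
    rw [add_zero]
    refine ((A t).le_opNorm _).trans
      (mul_le_mul (hK t (Ico_subset_Icc_self ht)) ?_ (norm_nonneg _) (by linarith))
    rw [norm_smul, Real.norm_of_nonneg χ.nonneg]
    exact mul_le_of_le_one_left (norm_nonneg _) χ.le_one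
  refine ⟨w, hw0, fun t ht ↦ ?_⟩
  have h1 : ‖w t‖ ≤ R := by
    refine (hb t ht).trans ?_
    rw [gronwallBound_ε0, sub_zero, hR]
    have : Real.exp (K * t) ≤ Real.exp K := Real.exp_le_exp.2 (by nlinarith [ht.1, ht.2])
    nlinarith [norm_nonneg w₀]
  have h2 : HasDerivWithinAt w (A t (χ (w t) • w t)) (Icc 0 1) t := hw t ht
  rwa [χ.one_of_mem_closedBall (by simpa using h1), one_smul] at h2

variable {Y : P × ℝ → E → E} {Ψ : P × ℝ → E → E}

/-- A family of maps that vary differentiably in space is Lipschitz with a uniform constant in a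
tube around a curve. -/
theorem exists_lipschitz_tube (hY : FamOn univ univ 1 Y) (p₀ : P) {z : ℝ → E}
    (hz : ContinuousOn z (Icc 0 1)) : ∃ K : ℝ, 1 ≤ K ∧ ∃ δ > 0, ∀ᶠ p in 𝓝 p₀, ∀ t ∈ Icc (0 : ℝ) 1,
      LipschitzOnWith K.toNNReal (Y (p, t)) (Metric.ball (z t) δ) := by
  have hD : ContinuousOn (uncurry fun (q : P × ℝ) y ↦ fderivWithin ℝ (Y q) univ y) univ := hY.2.2
  rw [continuousOn_univ] at hD
  have hc : ContinuousOn (uncurry fun (q : P × E) (t : ℝ) ↦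
      fderivWithin ℝ (Y (q.1, t)) univ (z t + q.2)) (univ ×ˢ Icc 0 1) := by
    refine hD.comp_continuousOn (f := fun w : (P × E) × ℝ ↦ ((w.1.1, w.2), z w.2 + w.1.2)) ?_
    have : ContinuousOn (fun w : (P × E) × ℝ ↦ z w.2) (univ ×ˢ Icc 0 1) :=
      hz.comp continuous_snd.continuousOn fun w hw ↦ hw.2
    exact ContinuousOn.prodMk (by fun_prop) (this.add (by fun_prop))
  have hc0 : ContinuousOn (fun t : ℝ ↦ fderivWithin ℝ (Y (p₀, t)) univ (z t + 0)) (Icc 0 1) :=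
    hc.comp (f := fun t : ℝ ↦ ((p₀, (0 : E)), t)) (by fun_prop) fun t ht ↦ ⟨mem_univ _, ht⟩
  obtain ⟨C, hC⟩ := isCompact_Icc.exists_bound_of_continuousOn hc0
  have hC0 : 0 ≤ C := (norm_nonneg _).trans (hC 0 (by simp))
  have h1 := eventually_forall_norm_sub_lt isCompact_Icc hc (z₀ := (p₀, 0)) (mem_univ _) one_pos
  rw [nhdsWithin_univ, nhds_prod_eq, eventually_prod_iff] at h1
  obtain ⟨pa, hpa, pb, hpb, h⟩ := h1
  obtain ⟨δ, hδ, hball⟩ := Metric.eventually_nhds_iff_ball.1 hpb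
  refine ⟨C + 1, by linarith, δ, hδ, ?_⟩
  filter_upwards [hpa] with p hp t ht
  have hd : ∀ y, DifferentiableAt ℝ (Y (p, t)) y := fun y ↦
    differentiableWithinAt_univ.1 (hY.2.1 ((p, t), y) (mem_univ _))
  refine (convex_ball (z t) δ).lipschitzOnWith_of_nnnorm_fderiv_le (𝕜 := ℝ) (fun y _ ↦ hd y)
    fun y hy ↦ ?_
  have h2 := h hp (hball (y - z t) (by simpa [dist_eq_norm] using hy)) t ht
  simp only [fderivWithin_univ, add_sub_cancel] at h2 hC
  rw [← NNReal.coe_le_coe, coe_nnnorm, Real.coe_toNNReal _ (by linarith)]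
  have h3 := hC t ht
  have h4 := norm_le_norm_add_norm_sub' (fderiv ℝ (Y (p, t)) y) (fderiv ℝ (Y (p₀, t)) (z t + 0))
  linarith

/-- Solutions depend continuously on the parameter and on the initial value, uniformly in time. -/
theorem eventually_norm_flow_sub_lt (hY : FamOn univ univ 1 Y) (h0 : ∀ p x, Ψ (p, 0) x = x)
    (hΨ : ∀ p x, IsSolution (fun t ↦ Y (p, t)) (fun t ↦ Ψ (p, t) x)) (p₀ : P) (x₀ : E)
    {ε : ℝ} (hε : 0 < ε) : ∀ᶠ q : P × E in 𝓝 (p₀, x₀), ∀ t ∈ Icc (0 : ℝ) 1,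
      ‖Ψ (q.1, t) q.2 - Ψ (p₀, t) x₀‖ < ε := by
  have hz := (hΨ p₀ x₀).continuousOn
  obtain ⟨K, hK1, δ, hδ, hL⟩ := exists_lipschitz_tube hY p₀ hz
  set η : ℝ := min ε δ / 2 * Real.exp (-(K + 1)) with hη
  have hm : 0 < min ε δ := lt_min hε hδ
  have hη0 : 0 < η := by positivity
  have hYc : Continuous (uncurry Y) := continuousOn_univ.1 hY.1
  have hc : ContinuousOn (uncurry fun (p : P) (t : ℝ) ↦ Y (p, t) (Ψ (p₀, t) x₀))
      (univ ×ˢ Icc 0 1) := by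
    refine hYc.comp_continuousOn (f := fun w : P × ℝ ↦ ((w.1, w.2), Ψ (p₀, w.2) x₀)) ?_
    have : ContinuousOn (fun w : P × ℝ ↦ Ψ (p₀, w.2) x₀) (univ ×ˢ Icc 0 1) :=
      hz.comp continuous_snd.continuousOn fun w hw ↦ hw.2
    exact ContinuousOn.prodMk (by fun_prop) this
  have h1 := eventually_forall_norm_sub_lt isCompact_Icc hc (mem_univ p₀) hη0
  rw [nhdsWithin_univ] at h1
  rw [nhds_prod_eq]
  filter_upwards [(hL.and h1).prod_mk (Metric.ball_mem_nhds x₀ hη0)] with ⟨p, x⟩ ⟨⟨hp1, hp2⟩, hx⟩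
  have hB : ∀ t ∈ Icc (0 : ℝ) 1, η * Real.exp ((K + 1) * t) ≤ min ε δ / 2 := by
    intro t ht
    rw [hη, mul_assoc, ← Real.exp_add]
    have : Real.exp (-(K + 1) + (K + 1) * t) ≤ 1 := Real.exp_le_one_iff.2 (by nlinarith [ht.2])
    nlinarith
  have hx' : ‖x - x₀‖ < η := by simpa [dist_eq_norm] using hx
  have key := image_norm_le_of_norm_deriv_right_lt_deriv_boundary (a := 0) (b := 1)
    (f := fun t ↦ Ψ (p, t) x - Ψ (p₀, t) x₀)
    (f' := fun t ↦ Y (p, t) (Ψ (p, t) x) - Y (p₀, t) (Ψ (p₀, t) x₀))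
    (B := fun t ↦ η * Real.exp ((K + 1) * t))
    (B' := fun t ↦ η * (Real.exp ((K + 1) * t) * (K + 1)))
    ((hΨ p x).continuousOn.sub hz)
    (fun t ht ↦ ((hΨ p x).hasDerivWithinAt_Ici ht).sub ((hΨ p₀ x₀).hasDerivWithinAt_Ici ht))
    (by simpa [h0] using hx'.le)
    (fun t ↦ by
      have : HasDerivAt (fun t : ℝ ↦ (K + 1) * t) (K + 1) t := by
        simpa using (hasDerivAt_id t).const_mul (K + 1)
      exact this.exp.const_mul η)
    (fun t ht hBt ↦ by
      have ht' := Ico_subset_Icc_self ht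
      have hb := hB t ht'
      have h2 : ‖Y (p, t) (Ψ (p, t) x) - Y (p, t) (Ψ (p₀, t) x₀)‖ ≤
          K * ‖Ψ (p, t) x - Ψ (p₀, t) x₀‖ := by
        have := (hp1 t ht').dist_le_mul (Ψ (p, t) x) ?_ (Ψ (p₀, t) x₀) (Metric.mem_ball_self hδ)
        · rwa [Real.coe_toNNReal _ (by linarith), dist_eq_norm, dist_eq_norm] at this
        · rw [Metric.mem_ball, dist_eq_norm, hBt]
          have := min_le_right ε δ
          linarith
      have h3 := hp2 t ht'
      rw [hBt] at h2
      have h4 : (1 : ℝ) ≤ Real.exp ((K + 1) * t) := Real.one_le_exp (by nlinarith [ht.1])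
      have h5 := norm_sub_le_norm_sub_add_norm_sub (Y (p, t) (Ψ (p, t) x))
        (Y (p, t) (Ψ (p₀, t) x₀)) (Y (p₀, t) (Ψ (p₀, t) x₀))
      nlinarith)
  intro t ht
  have h6 := (key ht).trans (hB t ht)
  have := min_le_left ε δ
  show ‖Ψ (p, t) x - Ψ (p₀, t) x₀‖ < ε
  linarith

theorem continuousOn_flow (hY : FamOn univ univ 1 Y) (h0 : ∀ p x, Ψ (p, 0) x = x)
    (hΨ : ∀ p x, IsSolution (fun t ↦ Y (p, t)) (fun t ↦ Ψ (p, t) x)) :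
    ContinuousOn (uncurry Ψ) (timeDomain univ 0 1) := by
  rintro ⟨⟨p₀, t₀⟩, x₀⟩ ⟨-, ht₀⟩
  rw [ContinuousWithinAt, Metric.tendsto_nhds]
  intro ε hε
  have h1 := eventually_norm_flow_sub_lt hY h0 hΨ p₀ x₀ (half_pos hε)
  have h2 : ∀ᶠ t in 𝓝[Icc 0 1] t₀, ‖Ψ (p₀, t) x₀ - Ψ (p₀, t₀) x₀‖ < ε / 2 := by
    have := (hΨ p₀ x₀).continuousOn t₀ ht₀
    rw [ContinuousWithinAt, Metric.tendsto_nhds] at this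
    simpa [dist_eq_norm] using this _ (half_pos hε)
  have e1 : Tendsto (fun w : (P × ℝ) × E ↦ (w.1.1, w.2))
      (𝓝[timeDomain univ 0 1] ((p₀, t₀), x₀)) (𝓝 (p₀, x₀)) :=
    tendsto_nhdsWithin_of_tendsto_nhds (Continuous.tendsto (by fun_prop) _)
  have e2 : Tendsto (fun w : (P × ℝ) × E ↦ w.1.2)
      (𝓝[timeDomain univ 0 1] ((p₀, t₀), x₀)) (𝓝[Icc 0 1] t₀) :=
    tendsto_nhdsWithin_iff.2 ⟨tendsto_nhdsWithin_of_tendsto_nhds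
      (Continuous.tendsto (f := fun w : (P × ℝ) × E ↦ w.1.2) (by fun_prop) ((p₀, t₀), x₀)),
      eventually_mem_nhdsWithin.mono fun w hw ↦ hw.2⟩
  filter_upwards [e1.eventually h1, e2.eventually h2, self_mem_nhdsWithin] with w hw1 hw2 hw
  rw [dist_eq_norm]
  have h3 := norm_sub_le_norm_sub_add_norm_sub (Ψ w.1 w.2) (Ψ (p₀, w.1.2) x₀) (Ψ (p₀, t₀) x₀)
  have h4 := hw1 w.1.2 hw.2
  exact h3.trans_lt (by simpa using add_lt_add h4 hw2)

/-- The derivative of a flow in the initial value exists, and solves the linearized equation. -/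
theorem exists_hasFDerivAt_flow [FiniteDimensional ℝ E] (hY : FamOn univ univ 1 Y)
    (h0 : ∀ p x, Ψ (p, 0) x = x)
    (hΨ : ∀ p x, IsSolution (fun t ↦ Y (p, t)) (fun t ↦ Ψ (p, t) x)) (p : P) (x : E) :
    ∃ D : ℝ → E →L[ℝ] E, D 0 = ContinuousLinearMap.id ℝ E ∧
      IsSolution (fun t T ↦ (fderiv ℝ (Y (p, t)) (Ψ (p, t) x)).comp T) D ∧
      ∀ t ∈ Icc (0 : ℝ) 1, HasFDerivAt (Ψ (p, t)) (D t) x := by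
  have hz := (hΨ p x).continuousOn
  have hDY : Continuous (uncurry fun (q : P × ℝ) y ↦ fderiv ℝ (Y q) y) := by
    have : ContinuousOn (uncurry fun (q : P × ℝ) y ↦ fderivWithin ℝ (Y q) univ y) univ := hY.2.2
    simpa only [fderivWithin_univ, continuousOn_univ] using this
  have hd : ∀ t y, DifferentiableAt ℝ (Y (p, t)) y := fun t y ↦
    differentiableWithinAt_univ.1 (hY.2.1 ((p, t), y) (mem_univ _))
  have hA : ContinuousOn (fun t : ℝ ↦ fderiv ℝ (Y (p, t)) (Ψ (p, t) x)) (Icc 0 1) :=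
    hDY.comp_continuousOn (f := fun t : ℝ ↦ ((p, t), Ψ (p, t) x))
      (ContinuousOn.prodMk (by fun_prop) hz)
  obtain ⟨D, hD0, hD⟩ := exists_isSolution_linear
    (A := fun t ↦ ContinuousLinearMap.compL ℝ E E E (fderiv ℝ (Y (p, t)) (Ψ (p, t) x)))
    ((ContinuousLinearMap.compL ℝ E E E).continuous.comp_continuousOn hA)
    (ContinuousLinearMap.id ℝ E)
  refine ⟨D, hD0, hD, ?_⟩
  obtain ⟨K, hK1, δ, hδ, hL⟩ := exists_lipschitz_tube hY p hz
  have hL := hL.self_of_nhds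
  obtain ⟨C, hC⟩ := isCompact_Icc.exists_bound_of_continuousOn hA
  set M := max C 1 with hM
  have hM1 : 1 ≤ M := le_max_right _ _
  intro t₁ ht₁
  rw [hasFDerivAt_iff_isLittleO, Asymptotics.isLittleO_iff]
  intro c hc
  -- `ε` is the relative error allowed in the linearization of the vector field.
  set ε : ℝ := c / (Real.exp K * Real.exp M) with hε
  have hε0 : 0 < ε := by positivity
  have hg : ContinuousOn (uncurry fun (w : E) (t : ℝ) ↦ fderiv ℝ (Y (p, t)) (Ψ (p, t) x + w))
      (univ ×ˢ Icc 0 1) := by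
    refine hDY.comp_continuousOn (f := fun w : E × ℝ ↦ ((p, w.2), Ψ (p, w.2) x + w.1)) ?_
    have : ContinuousOn (fun w : E × ℝ ↦ Ψ (p, w.2) x) (univ ×ˢ Icc 0 1) :=
      hz.comp continuous_snd.continuousOn fun w hw ↦ hw.2
    exact ContinuousOn.prodMk (by fun_prop) (this.add (by fun_prop))
  have h1 := eventually_forall_norm_sub_lt isCompact_Icc hg (mem_univ 0) hε0
  rw [nhdsWithin_univ] at h1
  obtain ⟨δ', hδ', hball⟩ := Metric.eventually_nhds_iff_ball.1 h1
  have h2 := eventually_norm_flow_sub_lt hY h0 hΨ p x (lt_min hδ hδ')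
  have h3 : ∀ᶠ y in 𝓝 x, ∀ t ∈ Icc (0 : ℝ) 1, ‖Ψ (p, t) y - Ψ (p, t) x‖ < min δ δ' :=
    ((Continuous.prodMk_right p).tendsto x).eventually h2
  filter_upwards [h3] with y hy
  have hlip : ∀ t ∈ Icc (0 : ℝ) 1, ‖Ψ (p, t) y - Ψ (p, t) x‖ ≤ ‖y - x‖ * Real.exp K := by
    intro t ht
    have := dist_le_of_trajectories_ODE_of_mem (v := fun t ↦ Y (p, t)) (K := K.toNNReal)
      (s := fun t ↦ Metric.ball (Ψ (p, t) x) δ) (a := 0) (b := 1) (δ := ‖y - x‖)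
      (f := fun t ↦ Ψ (p, t) y) (g := fun t ↦ Ψ (p, t) x)
      (fun t ht ↦ hL t (Ico_subset_Icc_self ht))
      (hΨ p y).continuousOn (fun t ht ↦ (hΨ p y).hasDerivWithinAt_Ici ht)
      (fun t ht ↦ by
        rw [Metric.mem_ball, dist_eq_norm]
        exact (hy t (Ico_subset_Icc_self ht)).trans_le (min_le_left _ _))
      hz (fun t ht ↦ (hΨ p x).hasDerivWithinAt_Ici ht) (fun t ht ↦ Metric.mem_ball_self hδ)
      (by simp [h0, dist_eq_norm]) t ht
    rw [dist_eq_norm, Real.coe_toNNReal _ (by linarith), sub_zero] at this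
    refine this.trans ?_
    gcongr
    nlinarith [ht.1, ht.2]
  -- Grönwall's inequality for the remainder of the linearization of the flow.
  have hr : ∀ t ∈ Icc (0 : ℝ) 1, ‖Ψ (p, t) y - Ψ (p, t) x - D t (y - x)‖ ≤
      gronwallBound 0 M (ε * (‖y - x‖ * Real.exp K)) (t - 0) := by
    refine norm_le_gronwallBound_of_norm_deriv_right_le
      (f' := fun t ↦ Y (p, t) (Ψ (p, t) y) - Y (p, t) (Ψ (p, t) x) -
        (fderiv ℝ (Y (p, t)) (Ψ (p, t) x)) (D t (y - x)))
      (((hΨ p y).continuousOn.sub hz).sub (hD.continuousOn.clm_apply continuousOn_const))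
      (fun t ht ↦ (((hΨ p y).hasDerivWithinAt_Ici ht).sub
        ((hΨ p x).hasDerivWithinAt_Ici ht)).sub ?_) (by simp [h0, hD0]) fun t ht ↦ ?_
    · have := (hD.hasDerivWithinAt_Ici ht).clm_apply (hasDerivWithinAt_const t (Ici t) (y - x))
      simpa using this
    · have ht' := Ico_subset_Icc_self ht
      have hb : Metric.ball (Ψ (p, t) x) δ' ⊆ {w | ‖fderiv ℝ (Y (p, t)) w -
          fderiv ℝ (Y (p, t)) (Ψ (p, t) x)‖ < ε} := by
        intro w hw
        simpa using hball (w - Ψ (p, t) x) (by simpa [dist_eq_norm] using hw) t ht'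
      have h4 : ‖Y (p, t) (Ψ (p, t) y) - Y (p, t) (Ψ (p, t) x) -
          fderiv ℝ (Y (p, t)) (Ψ (p, t) x) (Ψ (p, t) y - Ψ (p, t) x)‖ ≤
          ε * ‖Ψ (p, t) y - Ψ (p, t) x‖ := by
        refine (convex_ball (Ψ (p, t) x) δ').norm_image_sub_le_of_norm_hasFDerivWithin_le'
          (fun w _ ↦ (hd t w).hasFDerivAt.hasFDerivWithinAt) (fun w hw ↦ (hb hw).le)
          (Metric.mem_ball_self hδ') ?_
        rw [Metric.mem_ball, dist_eq_norm]
        exact (hy t ht').trans_le (min_le_right _ _)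
      have h5 : Y (p, t) (Ψ (p, t) y) - Y (p, t) (Ψ (p, t) x) -
          fderiv ℝ (Y (p, t)) (Ψ (p, t) x) (D t (y - x)) =
          fderiv ℝ (Y (p, t)) (Ψ (p, t) x) (Ψ (p, t) y - Ψ (p, t) x - D t (y - x)) +
          (Y (p, t) (Ψ (p, t) y) - Y (p, t) (Ψ (p, t) x) -
            fderiv ℝ (Y (p, t)) (Ψ (p, t) x) (Ψ (p, t) y - Ψ (p, t) x)) := by
        simp only [map_sub]
        abel
      rw [h5]
      refine (norm_add_le _ _).trans (add_le_add ?_ ?_)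
      · refine (ContinuousLinearMap.le_opNorm _ _).trans ?_
        gcongr
        exact (hC t ht').trans (le_max_left _ _)
      · exact h4.trans (by gcongr; exact hlip t ht')
  refine (hr t₁ ht₁).trans ?_
  rw [gronwallBound_of_K_ne_0 (by linarith), sub_zero]
  have h6 : Real.exp (M * t₁) ≤ Real.exp M := Real.exp_le_exp.2 (by nlinarith [ht₁.2])
  have h7 : ε * (‖y - x‖ * Real.exp K) / M ≤ ε * (‖y - x‖ * Real.exp K) :=
    div_le_self (by positivity) hM1
  have h8 : c * ‖y - x‖ = ε * (‖y - x‖ * Real.exp K) * Real.exp M := by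
    rw [hε]
    field_simp
  simp only [zero_mul, zero_add]
  rw [h8]
  have h9 : (1 : ℝ) ≤ Real.exp (M * t₁) := Real.one_le_exp (by nlinarith [ht₁.1])
  exact mul_le_mul h7 (by linarith) (by linarith) (by positivity)

/-- **Smooth dependence on initial values and continuous dependence on parameters.** Flows of
families of vector fields are families of the same kind. The induction on the order passes from a
vector field on `E` to its tangent field `(x, v) ↦ (Y x, DY x v)` on `E × E`, whose flow is the
tangent map of the flow. -/
theorem famOn_flow (n : ℕ) : ∀ {E : Type} [NormedAddCommGroup E] [NormedSpace ℝ E]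
    [FiniteDimensional ℝ E] {Y Ψ : P × ℝ → E → E} (_ : ∀ m, FamOn univ univ m Y)
    (_ : ∀ p x, Ψ (p, 0) x = x)
    (_ : ∀ p x, IsSolution (fun t ↦ Y (p, t)) (fun t ↦ Ψ (p, t) x)),
    FamOn univ (timeDomain univ 0 1) n Ψ := by
  induction n with
  | zero => exact fun hY h0 hΨ ↦ continuousOn_flow (hY 1) h0 hΨ
  | succ n ih =>
    intro E _ _ _ Y Ψ hY h0 hΨ
    have hdom : FamDomain (univ : Set E) (timeDomain (univ : Set (P × E)) 0 1) :=
      FamDomain.univ_univ.timeDomain 0 1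
    have hdom2 : FamDomain (univ : Set (E × E)) (univ : Set ((P × ℝ) × (E × E))) :=
      FamDomain.univ_univ
    have hd : ∀ q y, DifferentiableAt ℝ (Y q) y := fun q y ↦
      differentiableWithinAt_univ.1 ((hY 1).2.1 (q, y) (mem_univ _))
    choose D hD0 hD hDΨ using exists_hasFDerivAt_flow (hY 1) h0 hΨ
    let TY : P × ℝ → E × E → E × E := fun q w ↦ (Y q w.1, fderivWithin ℝ (Y q) univ w.1 w.2)
    let TΨ : P × ℝ → E × E → E × E := fun q w ↦ (Ψ q w.1, D q.1 w.1 q.2 w.2)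
    have hTY : ∀ m, FamOn univ univ m TY := by
      intro m
      have hfst : FamOn univ univ m (fun (_ : P × ℝ) (w : E × E) ↦ w.1) :=
        .of_contDiff hdom2 contDiff_fst
      have hsnd : FamOn univ univ m (fun (_ : P × ℝ) (w : E × E) ↦ w.2) :=
        .of_contDiff hdom2 contDiff_snd
      refine FamOn.prodMk hdom2 ((hY m).comp hdom2 hfst (by simp) (by simp)) ?_
      exact FamOn.bilin hdom2 (ContinuousLinearMap.id ℝ (E →L[ℝ] E))
        ((hY (m + 1)).2.2.comp hdom2 hfst (by simp) (by simp)) hsnd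
    have hTΨ := ih hTY (Ψ := TΨ) (fun p w ↦ by simp [TΨ, h0, hD0]) (fun p w t ht ↦ by
      refine (hΨ p w.1 t ht).prodMk ?_
      have := (hD p w.1 t ht).clm_apply (hasDerivWithinAt_const t (Icc 0 1) w.2)
      simpa using this)
    refine ⟨continuousOn_flow (hY 1) h0 hΨ, fun z hz ↦
      (hDΨ z.1.1 z.2 z.1.2 hz.2).differentiableAt.differentiableWithinAt, ?_⟩
    let b := Module.finBasis ℝ E
    -- The columns of the derivative are components of the tangent flow on constant vectors.
    have hcol : ∀ i, FamOn univ (timeDomain univ 0 1) n (fun (q : P × ℝ) (x : E) ↦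
        D q.1 x q.2 (b i)) := fun i ↦
      (hTΨ.comp hdom (f := fun _ x ↦ (x, b i)) (.of_contDiff hdom (by fun_prop))
        (fun z hz ↦ ⟨mem_univ _, hz.2⟩) (by simp)).clm hdom (ContinuousLinearMap.snd ℝ E E)
    refine (FamOn.sum hdom (s := Finset.univ) fun i _ ↦ (hcol i).clm hdom
      (ContinuousLinearMap.smulRightL ℝ E E (LinearMap.toContinuousLinearMap (b.coord i)))).congr
      hdom fun z hz ↦ ?_
    simp only [fderivWithin_univ]
    rw [(hDΨ z.1.1 z.2 z.1.2 hz.2).fderiv]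
    ext v
    conv_lhs => rw [← b.sum_repr v, map_sum]
    simp only [sum_apply, map_smul]
    rfl

end FlatFlow

/-! ### Families of functions on the surface -/

/-- The closed half plane `{y | 0 ≤ y 0}` in which charts take their values. -/
abbrev halfPlane : Set Plane := range HalfPlaneModel

theorem uniqueDiffOn_halfPlane : UniqueDiffOn ℝ halfPlane := HalfPlaneModel.uniqueDiffOn

section Charts

variable {M : Type*} [TopologicalSpace M] [ChartedSpace (EuclideanHalfSpace 2) M]

/-- The smooth charts of `M`, with values in the half space. -/
abbrev smoothCharts (M : Type*) [TopologicalSpace M] [ChartedSpace (EuclideanHalfSpace 2) M] :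
    Set (OpenPartialHomeomorph M (EuclideanHalfSpace 2)) :=
  IsManifold.maximalAtlas HalfPlaneModel ∞ M

/-- A chart as a map to the plane. -/
abbrev chartMap (c : OpenPartialHomeomorph M (EuclideanHalfSpace 2)) : M → Plane :=
  c.extend HalfPlaneModel

/-- The inverse of a chart, as a map from the plane. -/
abbrev chartInv (c : OpenPartialHomeomorph M (EuclideanHalfSpace 2)) : Plane → M :=
  (c.extend HalfPlaneModel).symm

/-- The image of a chart in the plane, a relatively open subset of the half plane. -/
abbrev chartTarget (c : OpenPartialHomeomorph M (EuclideanHalfSpace 2)) : Set Plane :=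
  (c.extend HalfPlaneModel).target

variable {c c' : OpenPartialHomeomorph M (EuclideanHalfSpace 2)} {x : M} {y : Plane}

theorem chartTarget_subset : chartTarget c ⊆ halfPlane := c.extend_target_subset_range

theorem chartMap_mem_halfPlane : chartMap c x ∈ halfPlane := mem_range_self _

theorem chartMap_mem_target (hx : x ∈ c.source) : chartMap c x ∈ chartTarget c :=
  (c.extend HalfPlaneModel).map_source (by rwa [c.extend_source])

theorem chartInv_mem_source (hy : y ∈ chartTarget c) : chartInv c y ∈ c.source := by
  have := (c.extend HalfPlaneModel).map_target hy
  rwa [c.extend_source] at this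

theorem chartInv_chartMap (hx : x ∈ c.source) : chartInv c (chartMap c x) = x :=
  (c.extend HalfPlaneModel).left_inv (by rwa [c.extend_source])

theorem chartMap_chartInv (hy : y ∈ chartTarget c) : chartMap c (chartInv c y) = y :=
  (c.extend HalfPlaneModel).right_inv hy

theorem chartTarget_mem_nhdsWithin (hy : y ∈ chartTarget c) : chartTarget c ∈ 𝓝[halfPlane] y := by
  have := c.extend_target_mem_nhdsWithin (I := HalfPlaneModel) (chartInv_mem_source hy)
  exact (chartMap_chartInv hy) ▸ this

theorem continuousOn_chartMap : ContinuousOn (chartMap c) c.source := by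
  have := c.continuousOn_extend (I := HalfPlaneModel)
  rwa [c.extend_source] at this

theorem continuousOn_chartInv : ContinuousOn (chartInv c) (chartTarget c) :=
  c.continuousOn_extend_symm

theorem continuousWithinAt_chartInv (hy : y ∈ chartTarget c) :
    ContinuousWithinAt (chartInv c) halfPlane y :=
  (continuousOn_chartInv y hy).mono_of_mem_nhdsWithin (chartTarget_mem_nhdsWithin hy)

variable [IsManifold HalfPlaneModel ∞ M]

theorem contDiffWithinAt_transition (hc : c ∈ smoothCharts M) (hc' : c' ∈ smoothCharts M)
    (hy : y ∈ chartTarget c) (hy' : chartInv c y ∈ c'.source) :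
    ContDiffWithinAt ℝ ∞ (chartMap c' ∘ chartInv c) halfPlane y := by
  refine ModelWithCorners.contDiffWithinAt_extendCoordChange hc hc' ?_
  simp only [ModelWithCorners.extendCoordChange, PartialEquiv.trans_source,
    PartialEquiv.symm_source, mem_inter_iff, mem_preimage, c'.extend_source]
  exact ⟨hy, hy'⟩

theorem contDiffWithinAt_comp_chartInv {F : Type*} [NormedAddCommGroup F] [NormedSpace ℝ F]
    {u : M → F} (hc : c ∈ smoothCharts M) (hy : y ∈ chartTarget c)
    (hu : ContMDiffAt HalfPlaneModel 𝓘(ℝ, F) ∞ u (chartInv c y)) :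
    ContDiffWithinAt ℝ ∞ (u ∘ chartInv c) halfPlane y := by
  rw [← contMDiffWithinAt_iff_contDiffWithinAt]
  have h1 := contMDiffOn_extend_symm hc y (by rw [← c.extend_target']; exact hy)
  rw [← c.extend_target'] at h1
  exact hu.comp_contMDiffWithinAt y (h1.mono_of_mem_nhdsWithin (chartTarget_mem_nhdsWithin hy))

theorem contMDiffAt_of_contDiffWithinAt {F : Type*} [NormedAddCommGroup F] [NormedSpace ℝ F]
    {u : M → F} (hc : c ∈ smoothCharts M) (hx : x ∈ c.source)
    (hu : ContDiffWithinAt ℝ ∞ (u ∘ chartInv c) halfPlane (chartMap c x)) :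
    ContMDiffAt HalfPlaneModel 𝓘(ℝ, F) ∞ u x := by
  have h1 : ContMDiffAt HalfPlaneModel 𝓘(ℝ, Plane) ∞ (chartMap c) x :=
    c.contMDiffAt_extend hc hx
  have h2 := (contMDiffWithinAt_iff_contDiffWithinAt.2 hu).comp (s := univ) x h1.contMDiffWithinAt
    fun _ _ ↦ chartMap_mem_halfPlane
  rw [contMDiffWithinAt_univ] at h2
  refine h2.congr_of_eventuallyEq ?_
  filter_upwards [c.open_source.mem_nhds hx] with z hz
  simp only [Function.comp]
  rw [chartInv_chartMap hz]

end Charts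

section Families

variable {M : Type*} [TopologicalSpace M] [ChartedSpace (EuclideanHalfSpace 2) M]
  {P Q : Type*} [TopologicalSpace P] [TopologicalSpace Q]
  {F G H : Type} [NormedAddCommGroup F] [NormedSpace ℝ F] [NormedAddCommGroup G] [NormedSpace ℝ G]
  [NormedAddCommGroup H] [NormedSpace ℝ H]

/-- The part of `W ⊆ P × M` in the domain of the chart `c`, in coordinates. -/
def coordDomain (c : OpenPartialHomeomorph M (EuclideanHalfSpace 2)) (W : Set (P × M)) :
    Set (P × Plane) :=
  {z | z.2 ∈ chartTarget c ∧ (z.1, chartInv c z.2) ∈ W}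

/-- A family of functions `u p` on the surface, with all derivatives in charts jointly continuous
in the parameter and the point, on the open set `W ⊆ P × M`. -/
def FamMOn (W : Set (P × M)) (u : P → M → F) : Prop :=
  ∀ c ∈ smoothCharts M, ∀ n,
    FamOn halfPlane (coordDomain c W) n (fun p y ↦ u p (chartInv c y))

/-- A family of functions with all derivatives in charts jointly continuous. -/
abbrev FamM (u : P → M → F) : Prop := FamMOn univ u

/-- A family of self-maps of `M` with all derivatives jointly continuous, expressed by composing
with smooth functions. -/
def FamMap (ψ : P → M → M) : Prop :=
  ∀ u : M → ℝ, ContMDiff HalfPlaneModel 𝓘(ℝ, ℝ) ∞ u → FamM fun p x ↦ u (ψ p x)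

variable {W W' : Set (P × M)} {u v : P → M → F}

theorem famDomain_coordDomain (c : OpenPartialHomeomorph M (EuclideanHalfSpace 2))
    (hW : IsOpen W) : FamDomain halfPlane (coordDomain c W) where
  uniq := uniqueDiffOn_halfPlane
  mem _ hz := chartTarget_subset hz.1
  nhds z hz := by
    have h1 : ContinuousWithinAt (fun y ↦ (z.1, chartInv c y)) halfPlane z.2 :=
      continuousWithinAt_const.prodMk (continuousWithinAt_chartInv hz.1)
    filter_upwards [chartTarget_mem_nhdsWithin hz.1, h1.eventually_mem (hW.mem_nhds hz.2)]
      with y hy hy' using ⟨hy, hy'⟩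

theorem FamMOn.mono (hu : FamMOn W u) (h : W' ⊆ W) : FamMOn W' u :=
  fun c hc n ↦ (hu c hc n).mono fun _ hz ↦ ⟨hz.1, h hz.2⟩

theorem FamMOn.congr (hu : FamMOn W u) (hW : IsOpen W) (h : ∀ z ∈ W, v z.1 z.2 = u z.1 z.2) :
    FamMOn W v :=
  fun c hc n ↦ (hu c hc n).congr (famDomain_coordDomain c hW) fun _ hz ↦ h _ hz.2

theorem coordDomain_mem_nhdsWithin {c : OpenPartialHomeomorph M (EuclideanHalfSpace 2)}
    {Ω : Set (P × Plane)} (hΩ : ∀ z ∈ Ω, z.2 ∈ chartTarget c) {z : P × Plane} (hz : z ∈ Ω)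
    (hW : IsOpen W) (hzW : (z.1, chartInv c z.2) ∈ W) : ∃ V ∈ 𝓝 z, V ∩ Ω ⊆ coordDomain c W := by
  have h1 : ContinuousWithinAt (fun w : P × Plane ↦ (w.1, chartInv c w.2)) Ω z := by
    refine continuousWithinAt_fst.prodMk ?_
    exact (continuousOn_chartInv z.2 (hΩ z hz)).comp continuousWithinAt_snd hΩ
  have h2 := h1.eventually_mem (hW.mem_nhds hzW)
  obtain ⟨V, hV, h3⟩ := mem_nhdsWithin_iff_exists_mem_nhds_inter.1 h2
  exact ⟨V, hV, fun w hw ↦ ⟨hΩ w hw.2, h3 hw⟩⟩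

theorem FamMOn.of_local (h : ∀ z ∈ W, ∃ W', IsOpen W' ∧ z ∈ W' ∧ FamMOn W' u) :
    FamMOn W u := by
  intro c hc n
  refine FamOn.of_local fun z hz ↦ ?_
  obtain ⟨W', hW', hzW', hu⟩ := h _ hz.2
  obtain ⟨V, hV, hVW⟩ := coordDomain_mem_nhdsWithin (Ω := coordDomain c W) (fun w hw ↦ hw.1) hz hW' hzW'
  exact ⟨V, hV, (hu c hc n).mono hVW⟩

theorem FamMOn.clm (hW : IsOpen W) (L : F →L[ℝ] G) (hu : FamMOn W u) :
    FamMOn W fun p x ↦ L (u p x) :=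
  fun c hc n ↦ (hu c hc n).clm (famDomain_coordDomain c hW) L

theorem FamMOn.add (hW : IsOpen W) (hu : FamMOn W u) (hv : FamMOn W v) :
    FamMOn W fun p x ↦ u p x + v p x :=
  fun c hc n ↦ (hu c hc n).add (famDomain_coordDomain c hW) (hv c hc n)

theorem FamMOn.neg (hW : IsOpen W) (hu : FamMOn W u) : FamMOn W fun p x ↦ -u p x :=
  hu.clm hW (-ContinuousLinearMap.id ℝ F)

theorem FamMOn.sub (hW : IsOpen W) (hu : FamMOn W u) (hv : FamMOn W v) :
    FamMOn W fun p x ↦ u p x - v p x := by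
  simpa only [sub_eq_add_neg] using hu.add hW (hv.neg hW)

theorem FamMOn.smul (hW : IsOpen W) {u : P → M → ℝ} (hu : FamMOn W u) (hv : FamMOn W v) :
    FamMOn W fun p x ↦ u p x • v p x :=
  fun c hc n ↦ (hu c hc n).smul (famDomain_coordDomain c hW) (hv c hc n)

theorem FamMOn.mul (hW : IsOpen W) {u v : P → M → ℝ} (hu : FamMOn W u) (hv : FamMOn W v) :
    FamMOn W fun p x ↦ u p x * v p x :=
  hu.smul hW hv

theorem FamMOn.sum (hW : IsOpen W) {ι : Type*} {s : Finset ι} {u : ι → P → M → F}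
    (hu : ∀ i ∈ s, FamMOn W (u i)) : FamMOn W fun p x ↦ ∑ i ∈ s, u i p x :=
  fun c hc n ↦ FamOn.sum (famDomain_coordDomain c hW) fun i hi ↦ hu i hi c hc n

theorem FamMOn.pi (hW : IsOpen W) {ι : Type} [Fintype ι] {u : P → M → ι → ℝ}
    (hu : ∀ i, FamMOn W fun p x ↦ u p x i) : FamMOn W u :=
  fun c hc n ↦ FamOn.pi (famDomain_coordDomain c hW) fun i ↦ hu i c hc n

theorem FamMOn.plane (hW : IsOpen W) {u : P → M → Plane}
    (hu : ∀ i, FamMOn W fun p x ↦ u p x i) : FamMOn W u :=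
  (FamMOn.pi hW (u := fun p x i ↦ u p x i) hu).clm hW
    ((EuclideanSpace.equiv (Fin 2) ℝ).symm : (Fin 2 → ℝ) →L[ℝ] Plane)

theorem FamMOn.of_param (hW : IsOpen W) {f : P → F} (hf : Continuous f) :
    FamMOn W fun p (_ : M) ↦ f p :=
  fun c _ _ ↦ FamOn.of_param (famDomain_coordDomain c hW) (hf.comp continuous_fst).continuousOn

theorem FamMOn.param {θ : Q → P} (hθ : Continuous θ) (hu : FamMOn W u) :
    FamMOn {z : Q × M | (θ z.1, z.2) ∈ W} fun q x ↦ u (θ q) x :=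
  fun c hc n ↦ (hu c hc n).param (hθ.comp continuous_fst).continuousOn fun _ hz ↦ hz

variable [IsManifold HalfPlaneModel ∞ M]

theorem FamMOn.of_chart {c : OpenPartialHomeomorph M (EuclideanHalfSpace 2)}
    (hc : c ∈ smoothCharts M) (hW : IsOpen W) (hWc : ∀ z ∈ W, z.2 ∈ c.source)
    (h : ∀ n, FamOn halfPlane (coordDomain c W) n (fun p y ↦ u p (chartInv c y))) :
    FamMOn W u := by
  intro c' hc' n
  have hd := famDomain_coordDomain c' hW
  have hsrc : ∀ z ∈ coordDomain c' W, chartInv c' z.2 ∈ c.source := fun z hz ↦ hWc _ hz.2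
  have h1 : FamOn halfPlane (coordDomain c' W) n (fun _ y ↦ (chartMap c ∘ chartInv c') y) :=
    .of_contDiffWithinAt hd fun z hz ↦ contDiffWithinAt_transition hc' hc hz.1 (hsrc z hz)
  refine ((h n).comp hd h1 (fun z hz ↦ ⟨?_, ?_⟩) (fun z hz ↦ ?_)).congr hd fun z hz ↦ ?_
  · exact chartMap_mem_target (hsrc z hz)
  · simp only [Function.comp]
    rw [chartInv_chartMap (hsrc z hz)]
    exact hz.2
  · exact Eventually.of_forall fun _ ↦ chartMap_mem_halfPlane
  · simp only [Function.comp]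
    rw [chartInv_chartMap (hsrc z hz)]

theorem FamMOn.of_contMDiffAt (hW : IsOpen W) {u : M → F}
    (hu : ∀ z ∈ W, ContMDiffAt HalfPlaneModel 𝓘(ℝ, F) ∞ u z.2) : FamMOn W fun _ ↦ u :=
  fun c hc _ ↦ FamOn.of_contDiffWithinAt (g := u ∘ chartInv c) (famDomain_coordDomain c hW)
    fun _ hz ↦ contDiffWithinAt_comp_chartInv hc hz.1 (hu _ hz.2)

theorem FamM.of_contMDiff {u : M → F} (hu : ContMDiff HalfPlaneModel 𝓘(ℝ, F) ∞ u) :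
    FamM fun _ : P ↦ u :=
  .of_contMDiffAt isOpen_univ fun z _ ↦ hu z.2

theorem FamMOn.contMDiffAt (hW : IsOpen W) (hu : FamMOn W u) {z : P × M} (hz : z ∈ W) :
    ContMDiffAt HalfPlaneModel 𝓘(ℝ, F) ∞ (u z.1) z.2 := by
  have hc := IsManifold.chart_mem_maximalAtlas (I := HalfPlaneModel) (n := ∞) z.2
  have hx := mem_chart_source (EuclideanHalfSpace 2) z.2
  refine contMDiffAt_of_contDiffWithinAt hc hx (contDiffWithinAt_infty.2 fun n ↦ ?_)
  refine (hu _ hc n).contDiffWithinAt (famDomain_coordDomain _ hW) (z := (z.1, _)) ⟨?_, ?_⟩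
  · exact chartMap_mem_target hx
  · simp only
    rwa [chartInv_chartMap hx]

theorem FamM.contMDiff (hu : FamM u) (p : P) : ContMDiff HalfPlaneModel 𝓘(ℝ, F) ∞ (u p) :=
  fun x ↦ hu.contMDiffAt isOpen_univ (mem_univ (p, x))

theorem FamMOn.continuousOn (hW : IsOpen W) (hu : FamMOn W u) : ContinuousOn (uncurry u) W := by
  intro z hz
  have hc := IsManifold.chart_mem_maximalAtlas (I := HalfPlaneModel) (n := ∞) z.2
  have hx := mem_chart_source (EuclideanHalfSpace 2) z.2
  set c := chartAt (EuclideanHalfSpace 2) z.2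
  have hV : IsOpen (W ∩ univ ×ˢ c.source) := hW.inter (isOpen_univ.prod c.open_source)
  have h1 : ContinuousOn (fun w : P × M ↦ (w.1, chartMap c w.2)) (W ∩ univ ×ˢ c.source) :=
    continuousOn_fst.prodMk (continuousOn_chartMap.comp continuousOn_snd fun w hw ↦ hw.2.2)
  have h2 : ContinuousOn (uncurry u) (W ∩ univ ×ˢ c.source) := by
    refine ((hu c hc 0).continuousOn.comp h1 fun w hw ↦ ⟨chartMap_mem_target hw.2.2, ?_⟩).congr
      fun w hw ↦ ?_
    · simp only
      rw [chartInv_chartMap hw.2.2]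
      exact hw.1
    · simp only [uncurry, Function.comp]
      rw [chartInv_chartMap hw.2.2]
  exact (h2.continuousAt (hV.mem_nhds ⟨hz, mem_univ _, hx⟩)).continuousWithinAt

theorem FamM.continuous (hu : FamM u) : Continuous (uncurry u) :=
  continuousOn_univ.1 (hu.continuousOn isOpen_univ)

end Families

/-! ### Composition and differentials of families -/

section Covectors

/-- The wedge product of two covectors of the plane, evaluated on the standard basis. -/
def wedge (ξ η : Plane →L[ℝ] ℝ) : ℝ :=
  ξ (EuclideanSpace.single 0 1) * η (EuclideanSpace.single 1 1) -
    ξ (EuclideanSpace.single 1 1) * η (EuclideanSpace.single 0 1)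

theorem plane_eq (v : Plane) :
    v = v 0 • EuclideanSpace.single 0 1 + v 1 • EuclideanSpace.single 1 1 := by
  ext i
  fin_cases i <;> simp

theorem covector_apply (ξ : Plane →L[ℝ] ℝ) (v : Plane) :
    ξ v = v 0 * ξ (EuclideanSpace.single 0 1) + v 1 * ξ (EuclideanSpace.single 1 1) := by
  conv_lhs => rw [plane_eq v]
  simp

/-- The determinant of a linear map of the plane. -/
def planeDet (A : Plane →L[ℝ] Plane) : ℝ :=
  A (EuclideanSpace.single 0 1) 0 * A (EuclideanSpace.single 1 1) 1 -
    A (EuclideanSpace.single 0 1) 1 * A (EuclideanSpace.single 1 1) 0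

theorem wedge_comp (ξ η : Plane →L[ℝ] ℝ) (A : Plane →L[ℝ] Plane) :
    wedge (ξ.comp A) (η.comp A) = planeDet A * wedge ξ η := by
  simp only [wedge, planeDet, ContinuousLinearMap.comp_apply]
  rw [covector_apply ξ (A (EuclideanSpace.single 0 1)), covector_apply ξ (A (EuclideanSpace.single 1 1)),
    covector_apply η (A (EuclideanSpace.single 0 1)), covector_apply η (A (EuclideanSpace.single 1 1))]
  ring

theorem wedge_mul_area (ξ η : Plane →L[ℝ] ℝ) (v w : Plane) :
    ξ v * η w - ξ w * η v = wedge ξ η * (v 0 * w 1 - v 1 * w 0) := by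
  rw [covector_apply ξ v, covector_apply ξ w, covector_apply η v, covector_apply η w, wedge]
  ring

end Covectors

section PreferredChart

variable {M : Type*} [TopologicalSpace M] [ChartedSpace (EuclideanHalfSpace 2) M]

/-- The preferred chart at a point. -/
abbrev chart (x : M) : OpenPartialHomeomorph M (EuclideanHalfSpace 2) :=
  chartAt (EuclideanHalfSpace 2) x

theorem chart_mem [IsManifold HalfPlaneModel ∞ M] (x : M) :
    chart x ∈ smoothCharts M := IsManifold.chart_mem_maximalAtlas x

theorem mem_source (x : M) : x ∈ (chart x).source := mem_chart_source _ x

end PreferredChart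

section Composition

variable {M : Type*} [TopologicalSpace M] [ChartedSpace (EuclideanHalfSpace 2) M] [T2Space M]
  [IsManifold HalfPlaneModel ∞ M]
  {P Q : Type*} [TopologicalSpace P] [TopologicalSpace Q]
  {F : Type} [NormedAddCommGroup F] [NormedSpace ℝ F]

/-- Charts extend to smooth functions on the whole surface after shrinking their domain. -/
theorem exists_contMDiff_eqOn_chartMap (x : M) :
    ∃ g : M → Plane, ContMDiff HalfPlaneModel 𝓘(ℝ, Plane) ∞ g ∧
      ∃ U, IsOpen U ∧ x ∈ U ∧ U ⊆ (chart x).source ∧ EqOn g (chartMap (chart x)) U := by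
  let b : SmoothBumpFunction HalfPlaneModel x := Classical.arbitrary _
  refine ⟨fun z ↦ b z • chartMap (chart x) z,
    b.contMDiff_smul (contMDiffOn_extChartAt (I := HalfPlaneModel)), ?_⟩
  obtain ⟨V, hV, hVo, hxV⟩ := eventually_nhds_iff.1 b.eventuallyEq_one
  refine ⟨V ∩ (chart x).source, hVo.inter (chart x).open_source, ⟨hxV, mem_source x⟩,
    inter_subset_right, fun z hz ↦ ?_⟩
  simp [hV z hz.1]

theorem FamMap.continuous {ψ : P → M → M} (hψ : FamMap ψ) : Continuous (uncurry ψ) := by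
  rw [continuous_iff_continuousAt]
  intro z s hs
  obtain ⟨b, -, hbs⟩ :=
    (SmoothBumpFunction.nhds_basis_support (I := HalfPlaneModel) hs).mem_iff.1 hs
  have h1 : ContinuousAt (fun w : P × M ↦ b (uncurry ψ w)) z :=
    (hψ b b.contMDiff).continuous.continuousAt
  have h2 : b (uncurry ψ z) ≠ 0 := by
    rw [b.eq_one]
    exact one_ne_zero
  have h3 := h1.eventually_ne h2
  exact mem_of_superset h3 fun w hw ↦ hbs hw

theorem FamMap.comp_plane {ψ : P → M → M} (hψ : FamMap ψ) {u : M → Plane}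
    (hu : ContMDiff HalfPlaneModel 𝓘(ℝ, Plane) ∞ u) : FamM fun p x ↦ u (ψ p x) := by
  refine FamMOn.plane isOpen_univ fun i ↦ hψ (fun x ↦ u x i) ?_
  exact (EuclideanSpace.proj i : Plane →L[ℝ] ℝ).contDiff.contMDiff.comp hu

/-- In charts, a family of self-maps is a family of maps between subsets of the half plane. -/
theorem FamMap.exists_chart {ψ : P → M → M} (hψ : FamMap ψ) (z : P × M) :
    ∃ W : Set (P × M), IsOpen W ∧ z ∈ W ∧
      (∀ w ∈ W, ψ w.1 w.2 ∈ (chart (ψ z.1 z.2)).source) ∧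
      FamMOn W fun p x ↦ chartMap (chart (ψ z.1 z.2)) (ψ p x) := by
  obtain ⟨g, hg, U, hU, hxU, hUs, hgU⟩ := exists_contMDiff_eqOn_chartMap (ψ z.1 z.2)
  have hW : IsOpen (uncurry ψ ⁻¹' U) := hU.preimage hψ.continuous
  exact ⟨uncurry ψ ⁻¹' U, hW, hxU, fun w hw ↦ hUs hw,
    ((hψ.comp_plane hg).mono (subset_univ _)).congr hW fun w hw ↦ (hgU hw).symm⟩

theorem FamMOn.comp {W : Set (P × M)} (hW : IsOpen W) {u : P → M → F} (hu : FamMOn W u)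
    {ψ : P → M → M} (hψ : FamMap ψ) :
    FamMOn {z : P × M | (z.1, ψ z.1 z.2) ∈ W} fun p x ↦ u p (ψ p x) := by
  have hW' : IsOpen {z : P × M | (z.1, ψ z.1 z.2) ∈ W} :=
    hW.preimage (continuous_fst.prodMk hψ.continuous)
  refine FamMOn.of_local fun z hz ↦ ?_
  obtain ⟨V, hV, hzV, hVs, hVψ⟩ := hψ.exists_chart z
  refine ⟨V ∩ {z : P × M | (z.1, ψ z.1 z.2) ∈ W}, hV.inter hW', ⟨hzV, hz⟩, fun c hc n ↦ ?_⟩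
  set c' := chart (ψ z.1 z.2)
  have hd := famDomain_coordDomain c (hV.inter hW')
  have h1 := (hVψ c hc n).mono (Ω' := coordDomain c (V ∩ {z : P × M | (z.1, ψ z.1 z.2) ∈ W}))
    fun w hw ↦ ⟨hw.1, hw.2.1⟩
  refine ((hu c' (chart_mem _) n).comp hd h1 (fun w hw ↦ ⟨?_, ?_⟩) (fun w hw ↦ ?_)).congr hd
    fun w hw ↦ ?_
  · exact chartMap_mem_target (hVs _ hw.2.1)
  · simp only
    rw [chartInv_chartMap (hVs _ hw.2.1)]
    exact hw.2.2
  · exact Eventually.of_forall fun _ ↦ chartMap_mem_halfPlane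
  · simp only
    rw [chartInv_chartMap (hVs _ hw.2.1)]

theorem FamM.comp {u : P → M → F} (hu : FamM u) {ψ : P → M → M} (hψ : FamMap ψ) :
    FamM fun p x ↦ u p (ψ p x) :=
  FamMOn.comp isOpen_univ hu hψ

theorem FamM.param {u : P → M → F} (hu : FamM u) {θ : Q → P} (hθ : Continuous θ) :
    FamM fun q x ↦ u (θ q) x :=
  FamMOn.param hθ hu

theorem FamMap.param {ψ : P → M → M} (hψ : FamMap ψ) {θ : Q → P} (hθ : Continuous θ) :
    FamMap fun q x ↦ ψ (θ q) x :=
  fun u hu ↦ (hψ u hu).param hθ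

theorem FamMap.comp {φ ψ : P → M → M} (hφ : FamMap φ) (hψ : FamMap ψ) :
    FamMap fun p x ↦ φ p (ψ p x) :=
  fun u hu ↦ (hφ u hu).comp hψ

theorem FamMap.contMDiff {ψ : P → M → M} (hψ : FamMap ψ) (p : P) :
    ContMDiff HalfPlaneModel HalfPlaneModel ∞ (ψ p) := by
  intro x
  obtain ⟨W, hW, hxW, -, hWψ⟩ := hψ.exists_chart (p, x)
  rw [contMDiffAt_iff_target]
  refine ⟨(hψ.continuous.comp (Continuous.prodMk_right p)).continuousAt, ?_⟩
  exact hWψ.contMDiffAt hW hxW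

end Composition

section Derivative

variable {M : Type*} [TopologicalSpace M] [ChartedSpace (EuclideanHalfSpace 2) M]
  [IsManifold HalfPlaneModel ∞ M]

/-- The differential of a function in the chart `c`, at a point of the half plane. -/
def chartDeriv (c : OpenPartialHomeomorph M (EuclideanHalfSpace 2)) (u : M → ℝ) (y : Plane) :
    Plane →L[ℝ] ℝ :=
  fderivWithin ℝ (u ∘ chartInv c) halfPlane y

/-- The differential of a function, in the preferred chart of each point. -/
def coDeriv (u : M → ℝ) (x : M) : Plane →L[ℝ] ℝ :=
  chartDeriv (chart x) u (chartMap (chart x) x)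

/-- A smooth function on the surface. -/
abbrev SmoothFun (u : M → ℝ) : Prop := ContMDiff HalfPlaneModel 𝓘(ℝ, ℝ) ∞ u

variable {u v : M → ℝ} {x : M} {c : OpenPartialHomeomorph M (EuclideanHalfSpace 2)}

theorem differentiableWithinAt_chart (hu : ContMDiffAt HalfPlaneModel 𝓘(ℝ, ℝ) ∞ u x)
    (hc : c ∈ smoothCharts M) (hx : x ∈ c.source) :
    DifferentiableWithinAt ℝ (u ∘ chartInv c) halfPlane (chartMap c x) :=
  (contDiffWithinAt_comp_chartInv hc (chartMap_mem_target hx)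
    (by rwa [chartInv_chartMap hx])).differentiableWithinAt (by simp)

/-- The derivative of the chart `c` at `x`, with respect to the preferred chart at `x`. -/
def chartJacobian (c : OpenPartialHomeomorph M (EuclideanHalfSpace 2)) (x : M) :
    Plane →L[ℝ] Plane :=
  fderivWithin ℝ (chartMap c ∘ chartInv (chart x)) halfPlane (chartMap (chart x) x)

theorem coDeriv_eq (hu : ContMDiffAt HalfPlaneModel 𝓘(ℝ, ℝ) ∞ u x)
    (hc : c ∈ smoothCharts M) (hx : x ∈ c.source) :
    coDeriv u x = (chartDeriv c u (chartMap c x)).comp (chartJacobian c x) := by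
  have hxs := mem_source x
  have hxt := chartMap_mem_target hxs
  have hinv := chartInv_chartMap hxs
  have h1 : HasFDerivWithinAt (chartMap c ∘ chartInv (chart x)) (chartJacobian c x) halfPlane
      (chartMap (chart x) x) :=
    ((contDiffWithinAt_transition (chart_mem x) hc hxt
      (by rwa [hinv])).differentiableWithinAt (by simp)).hasFDerivWithinAt
  have h2 : HasFDerivWithinAt (u ∘ chartInv c) (chartDeriv c u (chartMap c x)) halfPlane
      ((chartMap c ∘ chartInv (chart x)) (chartMap (chart x) x)) := by
    simp only [Function.comp]
    rw [hinv]
    exact (differentiableWithinAt_chart hu hc hx).hasFDerivWithinAt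
  have h3 := h2.comp _ h1 (fun _ _ ↦ chartMap_mem_halfPlane)
  refine (h3.congr_of_eventuallyEq ?_ ?_).fderivWithin
    (uniqueDiffOn_halfPlane _ chartMap_mem_halfPlane)
  · have h4 := (continuousWithinAt_chartInv hxt).eventually_mem
      (c.open_source.mem_nhds (by rwa [hinv]))
    filter_upwards [h4] with y hy
    simp only [Function.comp]
    rw [chartInv_chartMap hy]
  · simp only [Function.comp]
    rw [hinv, chartInv_chartMap hx]

theorem mfderiv_apply_eq_coDeriv (hu : ContMDiffAt HalfPlaneModel 𝓘(ℝ, ℝ) ∞ u x)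
    (w : TangentSpace HalfPlaneModel x) :
    (mfderiv HalfPlaneModel 𝓘(ℝ, ℝ) u x w : ℝ) = coDeriv u x w := by
  rw [(hu.mdifferentiableAt (by simp)).mfderiv]
  rfl

section Algebra

variable (hu : ContMDiffAt HalfPlaneModel 𝓘(ℝ, ℝ) ∞ u x)
  (hv : ContMDiffAt HalfPlaneModel 𝓘(ℝ, ℝ) ∞ v x)

include hu hv

theorem coDeriv_add : coDeriv (fun z ↦ u z + v z) x = coDeriv u x + coDeriv v x :=
  fderivWithin_fun_add (uniqueDiffOn_halfPlane _ chartMap_mem_halfPlane)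
    (differentiableWithinAt_chart hu (chart_mem x) (mem_source x))
    (differentiableWithinAt_chart hv (chart_mem x) (mem_source x))

theorem coDeriv_sub : coDeriv (fun z ↦ u z - v z) x = coDeriv u x - coDeriv v x :=
  fderivWithin_fun_sub (uniqueDiffOn_halfPlane _ chartMap_mem_halfPlane)
    (differentiableWithinAt_chart hu (chart_mem x) (mem_source x))
    (differentiableWithinAt_chart hv (chart_mem x) (mem_source x))

theorem coDeriv_mul : coDeriv (fun z ↦ u z * v z) x = u x • coDeriv v x + v x • coDeriv u x := by
  have := fderivWithin_fun_mul (uniqueDiffOn_halfPlane _ chartMap_mem_halfPlane)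
    (differentiableWithinAt_chart hu (chart_mem x) (mem_source x))
    (differentiableWithinAt_chart hv (chart_mem x) (mem_source x))
  simp only [Function.comp, chartInv_chartMap (mem_source x)] at this
  exact this

end Algebra

theorem coDeriv_const (r : ℝ) (x : M) : coDeriv (fun _ : M ↦ r) x = 0 :=
  fderivWithin_const_apply ..

theorem coDeriv_sum {ι : Type*} {s : Finset ι} {u : ι → M → ℝ}
    (hu : ∀ i ∈ s, ContMDiffAt HalfPlaneModel 𝓘(ℝ, ℝ) ∞ (u i) x) :
    coDeriv (fun z ↦ ∑ i ∈ s, u i z) x = ∑ i ∈ s, coDeriv (u i) x := by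
  have := fderivWithin_fun_sum (𝕜 := ℝ) (A := fun i ↦ u i ∘ chartInv (chart x)) (u := s)
    (uniqueDiffOn_halfPlane _ (chartMap_mem_halfPlane (c := chart x) (x := x)))
    fun i hi ↦ differentiableWithinAt_chart (hu i hi) (chart_mem x) (mem_source x)
  exact this

theorem coDeriv_congr (h : u =ᶠ[𝓝 x] v) : coDeriv u x = coDeriv v x := by
  have hxt := chartMap_mem_target (mem_source x)
  have hinv := chartInv_chartMap (mem_source x)
  refine EventuallyEq.fderivWithin_eq ?_ ?_
  · refine (continuousWithinAt_chartInv hxt).eventually (p := fun z ↦ u z = v z) ?_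
    rw [hinv]
    exact h
  · simp only [Function.comp, hinv]
    exact h.self_of_nhds

theorem coDeriv_comp {ψ : M → M} (hψ : ContMDiffAt HalfPlaneModel HalfPlaneModel ∞ ψ x)
    (hu : ContMDiffAt HalfPlaneModel 𝓘(ℝ, ℝ) ∞ u (ψ x)) (w : TangentSpace HalfPlaneModel x) :
    coDeriv (fun z ↦ u (ψ z)) x w =
      coDeriv u (ψ x) (mfderiv HalfPlaneModel HalfPlaneModel ψ x w) := by
  have h1 : ContMDiffAt HalfPlaneModel 𝓘(ℝ, ℝ) ∞ (fun z ↦ u (ψ z)) x := hu.comp x hψ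
  have h2 := mfderiv_comp x (hu.mdifferentiableAt (by simp)) (hψ.mdifferentiableAt (by simp))
  exact (mfderiv_apply_eq_coDeriv h1 w).symm.trans
    ((DFunLike.congr_fun h2 w).trans (mfderiv_apply_eq_coDeriv hu _))

variable {P : Type*} [TopologicalSpace P] {F : Type} [NormedAddCommGroup F] [NormedSpace ℝ F]

theorem FamMOn.chartDeriv {W : Set (P × M)} {u : P → M → ℝ} (hu : FamMOn W u)
    (hc : c ∈ smoothCharts M) (n : ℕ) :
    FamOn halfPlane (coordDomain c W) n (fun p ↦ chartDeriv c (u p)) :=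
  (hu c hc (n + 1)).2.2

theorem famOn_wedge {S : Set Plane} {Ω : Set (P × Plane)} (hΩ : FamDomain S Ω) {n : ℕ}
    {ξ η : P → Plane → Plane →L[ℝ] ℝ} (hξ : FamOn S Ω n ξ) (hη : FamOn S Ω n η) :
    FamOn S Ω n (fun p y ↦ wedge (ξ p y) (η p y)) := by
  have e : ∀ {ξ : P → Plane → Plane →L[ℝ] ℝ} (v : Plane), FamOn S Ω n ξ →
      FamOn S Ω n (fun p y ↦ ξ p y v) := fun v h ↦ h.clm hΩ (ContinuousLinearMap.apply ℝ ℝ v)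
  have h := ((e (EuclideanSpace.single 0 1) hξ).mul hΩ (e (EuclideanSpace.single 1 1) hη)).add hΩ
    (((e (EuclideanSpace.single 1 1) hξ).mul hΩ (e (EuclideanSpace.single 0 1) hη)).clm hΩ
      (-ContinuousLinearMap.id ℝ ℝ))
  exact h.congr hΩ fun z _ ↦ by simp [wedge, sub_eq_add_neg]

/-- The quotient of two sections of the second exterior power of the cotangent bundle does not
depend on charts: on the preferred charts of `coDeriv` both acquire the same Jacobian factor. -/
theorem FamM.wedge_div {ι : Type*} [Fintype ι] {u v : P → M → ℝ} (hu : FamM u) (hv : FamM v)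
    {a h : ι → P → M → ℝ} (ha : ∀ i, FamM (a i)) (hh : ∀ i, FamM (h i))
    (h0 : ∀ p x, ∑ i, wedge (coDeriv (a i p) x) (coDeriv (h i p) x) ≠ 0) :
    FamM fun p x ↦ wedge (coDeriv (u p) x) (coDeriv (v p) x) /
      ∑ i, wedge (coDeriv (a i p) x) (coDeriv (h i p) x) := by
  refine FamMOn.of_local fun z _ ↦ ?_
  set c := chart z.2
  have hc : c ∈ smoothCharts M := chart_mem z.2
  have hW : IsOpen (univ ×ˢ c.source : Set (P × M)) := isOpen_univ.prod c.open_source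
  refine ⟨univ ×ˢ c.source, hW, ⟨mem_univ _, mem_source z.2⟩, ?_⟩
  have hd := famDomain_coordDomain c hW
  have hsm : ∀ {u : P → M → ℝ}, FamM u → ∀ w : P × Plane, ContMDiffAt HalfPlaneModel 𝓘(ℝ, ℝ) ∞
    (u w.1) (chartInv c w.2) := fun h w ↦ h.contMDiff _ _
  have key : ∀ {u v : P → M → ℝ}, FamM u → FamM v → ∀ w ∈ coordDomain c (univ ×ˢ c.source),
      wedge (coDeriv (u w.1) (chartInv c w.2)) (coDeriv (v w.1) (chartInv c w.2)) =
        planeDet (chartJacobian c (chartInv c w.2)) *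
          wedge (chartDeriv c (u w.1) w.2) (chartDeriv c (v w.1) w.2) := by
    intro u v hu hv w hw
    rw [coDeriv_eq (hsm hu w) hc hw.2.2, coDeriv_eq (hsm hv w) hc hw.2.2, wedge_comp,
      chartMap_chartInv hw.1]
  have hsum : ∀ w ∈ coordDomain c (univ ×ˢ c.source), ∑ i, wedge
      (coDeriv (a i w.1) (chartInv c w.2)) (coDeriv (h i w.1) (chartInv c w.2)) =
      planeDet (chartJacobian c (chartInv c w.2)) *
        ∑ i, wedge (chartDeriv c (a i w.1) w.2) (chartDeriv c (h i w.1) w.2) := by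
    intro w hw
    rw [Finset.mul_sum]
    exact Finset.sum_congr rfl fun i _ ↦ key (ha i) (hh i) w hw
  refine FamMOn.of_chart hc hW (fun w hw ↦ hw.2) fun n ↦ ?_
  have hden := FamOn.sum hd (s := Finset.univ) fun i _ ↦
    famOn_wedge hd (((ha i).mono (subset_univ (univ ×ˢ c.source))).chartDeriv hc n)
      (((hh i).mono (subset_univ (univ ×ˢ c.source))).chartDeriv hc n)
  have hnum := famOn_wedge hd ((hu.mono (subset_univ (univ ×ˢ c.source))).chartDeriv hc n)
    ((hv.mono (subset_univ (univ ×ˢ c.source))).chartDeriv hc n)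
  have hne : ∀ w ∈ coordDomain c (univ ×ˢ c.source),
      planeDet (chartJacobian c (chartInv c w.2)) ≠ 0 ∧
        ∑ i, wedge (chartDeriv c (a i w.1) w.2) (chartDeriv c (h i w.1) w.2) ≠ 0 := by
    intro w hw
    have := h0 w.1 (chartInv c w.2)
    rw [hsum w hw] at this
    exact ⟨left_ne_zero_of_mul this, right_ne_zero_of_mul this⟩
  have hinv := hden.comp_contDiffOn hd (g := fun r : ℝ ↦ r⁻¹) isOpen_compl_singleton
    (fun _ hr ↦ (contDiffAt_inv ℝ hr).contDiffWithinAt) fun w hw ↦ (hne w hw).2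
  refine (hnum.mul hd hinv).congr hd fun w hw ↦ ?_
  rw [key hu hv w hw, hsum w hw, mul_div_mul_left _ _ (hne w hw).1, div_eq_mul_inv]

theorem coordDomain_univ (c : OpenPartialHomeomorph M (EuclideanHalfSpace 2)) :
    FamDomain halfPlane (coordDomain c (univ : Set (P × M))) :=
  famDomain_coordDomain c isOpen_univ

theorem FamM.integral [CompleteSpace F] {u : P × ℝ → M → F} (hu : FamM u) {a b : ℝ} (hab : a ≤ b) :
    FamM fun p x ↦ ∫ s in a..b, u (p, s) x := fun c hc n ↦
  FamOn.integral HalfPlaneModel.convex_range (coordDomain_univ c) hab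
    ((hu c hc n).mono fun _ hz ↦ ⟨hz.1.1, mem_univ _⟩)

/-- Differentiation under the integral sign. -/
theorem FamM.coDeriv_integral {u : P × ℝ → M → ℝ} (hu : FamM u) {a b : ℝ} (hab : a ≤ b)
    (p : P) (x : M) (w : Plane) :
    coDeriv (fun x ↦ ∫ s in a..b, u (p, s) x) x w = ∫ s in a..b, coDeriv (u (p, s)) x w := by
  have hd := coordDomain_univ (P := P) (chart x)
  have hz : (p, chartMap (chart x) x) ∈ coordDomain (chart x) (univ : Set (P × M)) :=
    ⟨chartMap_mem_target (mem_source x), mem_univ _⟩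
  have h1 := (hu (chart x) (chart_mem x) 1).mono
    (Ω' := timeDomain (coordDomain (chart x) (univ : Set (P × M))) a b)
    fun _ hz ↦ ⟨hz.1.1, mem_univ _⟩
  have h2 := hasFDerivWithinAt_integral HalfPlaneModel.convex_range hd hab h1 hz
  have h3 := h2.fderivWithin (uniqueDiffOn_halfPlane _ chartMap_mem_halfPlane)
  have h4 := intervalIntegrable_timeDomain hab
    (f := fun q y ↦ fderivWithin ℝ (fun y ↦ u q (chartInv (chart x) y)) halfPlane y)
    h1.2.2 hz
  have h5 := DFunLike.congr_fun h3 w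
  rw [ContinuousLinearMap.intervalIntegral_apply h4] at h5
  exact h5

/-- The differential of a family varies continuously along a curve of parameters. -/
theorem FamM.continuous_coDeriv_apply {u : P → M → ℝ} (hu : FamM u) (x : M) (w : Plane) :
    Continuous fun p ↦ coDeriv (u p) x w := by
  have h1 := (hu.chartDeriv (chart_mem x) 0).continuousOn
  have h2 : Continuous fun p ↦ coDeriv (u p) x :=
    h1.comp_continuous (f := fun p ↦ (p, chartMap (chart x) x)) (by fun_prop)
      fun p ↦ ⟨chartMap_mem_target (mem_source x), mem_univ _⟩
  exact h2.clm_apply continuous_const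

end Derivative

/-! ### Families of diffeomorphisms and the `C^∞` topology -/

section DiffeoTopology

variable {M : Type*} [TopologicalSpace M] [ChartedSpace (EuclideanHalfSpace 2) M]
  [IsManifold HalfPlaneModel ∞ M]
  {P Q : Type*} [TopologicalSpace P] [TopologicalSpace Q]
  {c c' : OpenPartialHomeomorph M (EuclideanHalfSpace 2)}

theorem contMDiffAt_chartMap_comp (hc' : c' ∈ smoothCharts M) {f : M → M} {x : M}
    (hf : ContMDiffAt HalfPlaneModel HalfPlaneModel ∞ f x) (hx : f x ∈ c'.source) :
    ContMDiffAt HalfPlaneModel 𝓘(ℝ, Plane) ∞ (fun z ↦ chartMap c' (f z)) x := by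
  have h1 : ContMDiffAt HalfPlaneModel 𝓘(ℝ, Plane) ∞ (chartMap c') (f x) :=
    c'.contMDiffAt_extend hc' hx
  exact h1.comp x hf

/-- The derivatives of a fixed family in charts are jointly continuous on `W`. -/
theorem FamMOn.continuousOn_iteratedFDerivWithin {F : Type} [NormedAddCommGroup F]
    [NormedSpace ℝ F] {W : Set (P × M)} (hW : IsOpen W) {u : P → M → F} (hu : FamMOn W u)
    (hc : c ∈ smoothCharts M) (j : ℕ) :
    ContinuousOn (fun z : P × M ↦ iteratedFDerivWithin ℝ j (fun y ↦ u z.1 (chartInv c y)) halfPlane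
      (chartMap c z.2)) (W ∩ univ ×ˢ c.source) := by
  have h1 := ((famOn_iff_iterated (famDomain_coordDomain c hW)).1 (hu c hc j)).2 j le_rfl
  refine h1.comp (f := fun z : P × M ↦ (z.1, chartMap c z.2)) ?_ fun z hz ↦ ?_
  · exact continuousOn_fst.prodMk (continuousOn_chartMap.comp continuousOn_snd fun z hz ↦ hz.2.2)
  · refine ⟨chartMap_mem_target hz.2.2, ?_⟩
    simp only
    rw [chartInv_chartMap hz.2.2]
    exact hz.1

/-- A map into the diffeomorphisms is continuous if it is a family of maps with jointly continuous
derivatives. -/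
theorem FamMap.continuous_diffeo [T2Space M] {Θ : Q → Diffeo M}
    (hΘ : FamMap fun q ↦ (Θ q : M → M)) : Continuous Θ := by
  refine continuous_generateFrom_iff.2 ?_
  rintro _ ⟨c, hc, c', hc', K, k, ε, f, hK, hKc, hf, hε, rfl⟩
  have hcont := hΘ.continuous
  have hW : IsOpen {z : Q × M | Θ z.1 z.2 ∈ c'.source} := c'.open_source.preimage hcont
  have h1 : FamMOn {z : Q × M | Θ z.1 z.2 ∈ c'.source} fun q x ↦ chartMap c' (Θ q x) := by
    have h2 : FamMOn (univ ×ˢ c'.source : Set (Q × M)) fun _ ↦ chartMap c' :=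
      .of_contMDiffAt (isOpen_univ.prod c'.open_source) fun z hz ↦
        c'.contMDiffAt_extend hc' hz.2
    exact (h2.comp (isOpen_univ.prod c'.open_source) hΘ).mono fun z hz ↦ ⟨mem_univ _, hz⟩
  have hWf : IsOpen {z : Q × M | f z.2 ∈ c'.source} :=
    c'.open_source.preimage (f.continuous.comp continuous_snd)
  have hF : FamMOn {z : Q × M | f z.2 ∈ c'.source} fun _ x ↦ chartMap c' (f x) :=
    .of_contMDiffAt hWf fun z hz ↦ contMDiffAt_chartMap_comp hc' f.contMDiff.contMDiffAt hz
  rw [isOpen_iff_mem_nhds]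
  intro q₀ hq₀
  have key : ∀ᶠ q in 𝓝 q₀, ∀ x ∈ K, Θ q x ∈ c'.source ∧ ∀ j ∈ Iic k,
      ‖iteratedFDerivWithin ℝ j (fun y ↦ chartMap c' (Θ q (chartInv c y))) halfPlane
          (chartMap c x) -
        iteratedFDerivWithin ℝ j (fun y ↦ chartMap c' (f (chartInv c y))) halfPlane
          (chartMap c x)‖ < ε := by
    refine hK.eventually_forall_of_forall_eventually fun x hx ↦ ?_
    have hx1 : (q₀, x) ∈ {z : Q × M | Θ z.1 z.2 ∈ c'.source} := hq₀.1 hx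
    refine Filter.Eventually.and (hW.mem_nhds hx1) ?_
    rw [eventually_all_finite (finite_Iic k)]
    intro j hj
    have hs : IsOpen (univ ×ˢ c.source : Set (Q × M)) := isOpen_univ.prod c.open_source
    have h3 := (h1.continuousOn_iteratedFDerivWithin hW hc j).continuousAt
      ((hW.inter hs).mem_nhds ⟨hx1, mem_univ _, hKc hx⟩)
    have h4 := (hF.continuousOn_iteratedFDerivWithin hWf hc j).continuousAt
      ((hWf.inter hs).mem_nhds (x := (q₀, x)) ⟨hf hx, mem_univ _, hKc hx⟩)
    exact (h3.sub h4).norm.eventually_lt continuousAt_const (hq₀.2 j hj x hx)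
  filter_upwards [key] with q hq using ⟨fun x hx ↦ (hq x hx).1, fun j hj x hx ↦ (hq x hx).2 j hj⟩

theorem isOpen_cInftyNhd (hc : c ∈ smoothCharts M) (hc' : c' ∈ smoothCharts M) {K : Set M}
    (hK : IsCompact K) (hKc : K ⊆ c.source) (k : ℕ) {ε : ℝ} (hε : 0 < ε) {f : Diffeo M}
    (hf : MapsTo f K c'.source) : IsOpen (cInftyNhd c c' K k ε f) :=
  TopologicalSpace.isOpen_generateFrom_of_mem
    ⟨c, hc, c', hc', K, k, ε, f, hK, hKc, hf, hε, rfl⟩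

theorem mem_cInftyNhd_self {K : Set M} (k : ℕ) {ε : ℝ} (hε : 0 < ε) {f : Diffeo M}
    (hf : MapsTo f K c'.source) : f ∈ cInftyNhd c c' K k ε f :=
  ⟨hf, fun j _ x _ ↦ by simpa⟩

/-- The `C^∞` topology makes all derivatives of a diffeomorphism jointly continuous in the
diffeomorphism and the point. -/
theorem famMap_diffeo [T2Space M] [CompactSpace M] : FamMap fun φ : Diffeo M ↦ (φ : M → M) := by
  intro u hu
  refine FamMOn.of_local fun z _ ↦ ?_
  set c := chart z.2 with hc_def
  set c' := chart (z.1 z.2) with hc'_def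
  have hc : c ∈ smoothCharts M := chart_mem _
  have hc' : c' ∈ smoothCharts M := chart_mem _
  have hn : c.source ∩ z.1 ⁻¹' c'.source ∈ 𝓝 z.2 :=
    (c.open_source.inter (c'.open_source.preimage z.1.continuous)).mem_nhds
      ⟨mem_source _, mem_source (z.1 z.2)⟩
  obtain ⟨K, hK, hKs, hKc⟩ := local_compact_nhds hn
  have hKsrc : K ⊆ c.source := fun x hx ↦ (hKs hx).1
  set V := cInftyNhd c c' K 0 1 z.1
  have hV : IsOpen V := isOpen_cInftyNhd hc hc' hKc hKsrc 0 one_pos fun x hx ↦ (hKs hx).2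
  have hW : IsOpen (V ×ˢ interior K) := hV.prod isOpen_interior
  refine ⟨V ×ˢ interior K, hW, ⟨mem_cInftyNhd_self 0 one_pos fun x hx ↦ (hKs hx).2,
    mem_interior_iff_mem_nhds.2 hK⟩, ?_⟩
  have hsrc : ∀ w ∈ coordDomain c (V ×ˢ interior K), w.1 (chartInv c w.2) ∈ c'.source :=
    fun w hw ↦ hw.2.1.1 (interior_subset hw.2.2)
  refine FamMOn.of_chart hc hW (fun w hw ↦ hKsrc (interior_subset hw.2)) fun n ↦ ?_
  have hd := famDomain_coordDomain c hW
  have hone : ∀ φ : Diffeo M, FamMOn {w : Unit × M | φ w.2 ∈ c'.source}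
      fun _ x ↦ chartMap c' (φ x) := fun φ ↦ .of_contMDiffAt
    (c'.open_source.preimage (φ.continuous.comp continuous_snd))
    fun z hz ↦ contMDiffAt_chartMap_comp hc' φ.contMDiff.contMDiffAt hz
  have hexpr : FamOn halfPlane (coordDomain c (V ×ˢ interior K)) n
      fun φ y ↦ chartMap c' (φ (chartInv c y)) := by
    rw [famOn_iff_iterated hd]
    refine ⟨fun w hw ↦ ?_, fun j _ w hw ↦ ?_⟩
    · exact (hone w.1 c hc n).contDiffWithinAt (z := ((), w.2)) (famDomain_coordDomain c
        (c'.open_source.preimage (w.1.continuous.comp continuous_snd))) ⟨hw.1, hsrc w hw⟩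
    -- The derivatives of a nearby `φ` at a nearby point are compared with those of `w.1` there.
    · rw [ContinuousWithinAt, Metric.tendsto_nhds]
      intro ε hε
      have ho : IsOpen {v : Unit × M | w.1 v.2 ∈ c'.source} :=
        c'.open_source.preimage (w.1.continuous.comp continuous_snd)
      have h1 := ((famOn_iff_iterated (famDomain_coordDomain c ho)).1 (hone w.1 c hc j)).2 j le_rfl
        ((), w.2) ⟨hw.1, hsrc w hw⟩
      have h2 : ContinuousWithinAt (fun v : Unit × Plane ↦ iteratedFDerivWithin ℝ j
          (fun y ↦ chartMap c' (w.1 (chartInv c y))) halfPlane v.2) (univ ×ˢ chartTarget c)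
          ((), w.2) := by
        refine h1.mono_of_mem_nhdsWithin ?_
        obtain ⟨U, hU, hUs⟩ := coordDomain_mem_nhdsWithin (c := c)
          (Ω := (univ ×ˢ chartTarget c : Set (Unit × Plane)))
          (fun z hz ↦ hz.2) (z := ((), w.2)) ⟨mem_univ _, hw.1⟩ ho (hsrc w hw)
        exact mem_nhdsWithin_iff_exists_mem_nhds_inter.2 ⟨U, hU, hUs⟩
      have h3 : Tendsto (fun v : Diffeo M × Plane ↦ ((), v.2))
          (𝓝[coordDomain c (V ×ˢ interior K)] w) (𝓝[univ ×ˢ chartTarget c] ((), w.2)) := by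
        refine tendsto_nhdsWithin_iff.2 ⟨?_, ?_⟩
        · exact (Continuous.tendsto (by fun_prop) w).mono_left nhdsWithin_le_nhds
        · filter_upwards [self_mem_nhdsWithin] with v hv using ⟨mem_univ _, hv.1⟩
      have h4 := (Metric.tendsto_nhds.1 (h2.tendsto.comp h3)) (ε / 2) (half_pos hε)
      have hN : IsOpen (cInftyNhd c c' K j (ε / 2) w.1) :=
        isOpen_cInftyNhd hc hc' hKc hKsrc j (half_pos hε) hw.2.1.1
      have h5 : ∀ᶠ v in 𝓝[coordDomain c (V ×ˢ interior K)] w, v.1 ∈ cInftyNhd c c' K j (ε / 2) w.1 :=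
        nhdsWithin_le_nhds ((hN.preimage continuous_fst).mem_nhds
          (mem_cInftyNhd_self j (half_pos hε) hw.2.1.1))
      filter_upwards [h4, h5, self_mem_nhdsWithin] with v h6 h7 h8
      have h9 := h7.2 j le_rfl _ (interior_subset h8.2.2)
      have h10 : chartMap c (chartInv c v.2) = v.2 := chartMap_chartInv h8.1
      rw [show c.extend HalfPlaneModel ((chartInv c v.2)) = v.2 from h10, ← dist_eq_norm] at h9
      exact (dist_triangle _ _ _).trans_lt ((add_lt_add h9 h6).trans_eq (add_halves ε))
  have h1 : FamMOn (univ ×ˢ c'.source : Set (Diffeo M × M)) fun _ ↦ u :=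
    .of_contMDiffAt (isOpen_univ.prod c'.open_source) fun z _ ↦ hu z.2
  refine ((h1 c' hc' n).comp hd hexpr (fun w hw ↦ ⟨chartMap_mem_target (hsrc w hw), mem_univ _, ?_⟩)
    fun w hw ↦ Eventually.of_forall fun _ ↦ chartMap_mem_halfPlane).congr hd fun w hw ↦ ?_
  · simp only
    rw [chartInv_chartMap (hsrc w hw)]
    exact hsrc w hw
  · simp only
    rw [chartInv_chartMap (hsrc w hw)]

end DiffeoTopology

/-! ### Embedding the surface and extending functions from it -/

section Cover

variable (M : Type*) [TopologicalSpace M] [ChartedSpace (EuclideanHalfSpace 2) M]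

/-- A finite atlas of preferred charts with bump functions, and a smooth partition of unity each
member of which is supported where the bump function is equal to `1`. -/
structure BumpCover where
  /-- The number of charts. -/
  size : ℕ
  /-- The points at which the preferred charts are taken. -/
  center : Fin size → M
  /-- The bump functions. -/
  bump : Fin size → M → ℝ
  /-- The partition of unity. -/
  part : Fin size → M → ℝ
  smooth_bump : ∀ k, SmoothFun (bump k)
  smooth_part : ∀ k, SmoothFun (part k)
  smooth_coord : ∀ k, ContMDiff HalfPlaneModel 𝓘(ℝ, Plane) ∞
    fun x ↦ bump k x • chartMap (chart (center k)) x
  tsupport_bump : ∀ k, tsupport (bump k) ⊆ (chart (center k)).source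
  sum_part : ∀ x, ∑ k, part k x = 1
  bump_eq_one : ∀ k x, part k x ≠ 0 → bump k =ᶠ[𝓝 x] 1

variable {M} in
/-- A finite smooth partition of unity subordinate to a choice of an open neighbourhood of each
point of the compact surface. -/
theorem exists_smooth_partition [T2Space M] [CompactSpace M] [IsManifold HalfPlaneModel ∞ M]
    {U : M → Set M} (hU : ∀ x, IsOpen (U x)) (hxU : ∀ x, x ∈ U x) :
    ∃ (n : ℕ) (p : Fin n → M) (χ : Fin n → M → ℝ), (∀ k, SmoothFun (χ k)) ∧
      (∀ x, ∑ k, χ k x = 1) ∧ ∀ k, tsupport (χ k) ⊆ U (p k) := by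
  obtain ⟨t, ht⟩ := isCompact_univ.elim_finite_subcover U hU fun x _ ↦ mem_iUnion.2 ⟨x, hxU x⟩
  obtain ⟨ρ, hρ⟩ := SmoothPartitionOfUnity.exists_isSubordinate HalfPlaneModel
    (isClosed_univ (X := M)) (fun k : Fin t.card ↦ U (t.equivFin.symm k)) (fun _ ↦ hU _) (by
      intro x hx
      obtain ⟨y, hy, hxy⟩ := mem_iUnion₂.1 (ht hx)
      refine mem_iUnion.2 ⟨t.equivFin ⟨y, hy⟩, ?_⟩
      simpa using hxy)
  refine ⟨t.card, fun k ↦ t.equivFin.symm k, fun k ↦ ρ k, fun k ↦ (ρ k).contMDiff, fun x ↦ ?_, hρ⟩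
  rw [← finsum_eq_sum_of_fintype]
  exact ρ.sum_eq_one (mem_univ x)

theorem nonempty_bumpCover [T2Space M] [CompactSpace M] [IsManifold HalfPlaneModel ∞ M] :
    Nonempty (BumpCover M) := by
  let b : ∀ x : M, SmoothBumpFunction HalfPlaneModel x := fun x ↦ Classical.arbitrary _
  obtain ⟨n, p, χ, hχ, hsum, hsupp⟩ := exists_smooth_partition
    (U := fun x ↦ interior {z | b x z = 1}) (fun _ ↦ isOpen_interior)
    fun x ↦ mem_interior_iff_mem_nhds.2 (b x).eventuallyEq_one
  exact ⟨⟨n, p, fun k ↦ b (p k), χ, fun k ↦ (b (p k)).contMDiff, hχ,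
    fun k ↦ (b (p k)).contMDiff_smul (contMDiffOn_extChartAt (I := HalfPlaneModel)),
    fun k ↦ (b (p k)).tsupport_subset_chartAt_source, hsum,
    fun k x hx ↦ mem_interior_iff_mem_nhds.1 (hsupp k (subset_tsupport _ hx))⟩⟩

end Cover

section Embedding

variable {M : Type*} [TopologicalSpace M] [ChartedSpace (EuclideanHalfSpace 2) M] (B : BumpCover M)

namespace BumpCover

/-- The indices of the coordinates of the embedding given by a cover: for each chart the member of
the partition of unity, and the two coordinates of the chart times the bump function. -/
abbrev Index : Type := Fin B.size × Option (Fin 2)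

/-- The Euclidean space in which the surface is embedded. -/
abbrev Ambient : Type := B.Index → ℝ

/-- The coordinates of the embedding. -/
def coord : B.Index → M → ℝ
  | (k, none), x => B.part k x
  | (k, some l), x => (B.bump k x • chartMap (chart (B.center k)) x) l

/-- The embedding of the surface. -/
def embed (x : M) : B.Ambient := fun j ↦ B.coord j x

/-- The projection of the ambient space to the coordinates of a chart. -/
def block (k : Fin B.size) : B.Ambient →L[ℝ] Plane :=
  ((EuclideanSpace.equiv (Fin 2) ℝ).symm : (Fin 2 → ℝ) →L[ℝ] Plane).comp
    (ContinuousLinearMap.pi fun l ↦ ContinuousLinearMap.proj (k, some l))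

theorem block_embed (k : Fin B.size) (x : M) :
    B.block k (B.embed x) = B.bump k x • chartMap (chart (B.center k)) x := by
  ext l
  rfl

theorem mem_source_of_part {k : Fin B.size} {x : M} (h : B.part k x ≠ 0) :
    x ∈ (chart (B.center k)).source := by
  refine B.tsupport_bump k (subset_tsupport _ ?_)
  rw [mem_support, (B.bump_eq_one k x h).self_of_nhds]
  exact one_ne_zero

theorem block_embed_of_part {k : Fin B.size} {x : M} (h : B.part k x ≠ 0) :
    B.block k (B.embed x) = chartMap (chart (B.center k)) x := by
  rw [block_embed, (B.bump_eq_one k x h).self_of_nhds]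
  simp

theorem exists_part_ne_zero (x : M) : ∃ k, B.part k x ≠ 0 := by
  by_contra! h
  have := B.sum_part x
  simp [h] at this

theorem embed_injective : Injective B.embed := by
  intro x x' h
  obtain ⟨k, hk⟩ := B.exists_part_ne_zero x
  have hk' : B.part k x' ≠ 0 := by
    have : B.embed x (k, none) = B.embed x' (k, none) := by rw [h]
    exact (show B.part k x = B.part k x' from this) ▸ hk
  have h1 : chartMap (chart (B.center k)) x = chartMap (chart (B.center k)) x' := by
    rw [← B.block_embed_of_part hk, ← B.block_embed_of_part hk', h]
  rw [← chartInv_chartMap (B.mem_source_of_part hk), h1,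
    chartInv_chartMap (B.mem_source_of_part hk')]

theorem smooth_coordinate (j : B.Index) : SmoothFun (B.coord j) := by
  obtain ⟨k, _ | l⟩ := j
  · exact B.smooth_part k
  · exact (EuclideanSpace.proj l : Plane →L[ℝ] ℝ).contDiff.contMDiff.comp (B.smooth_coord k)

theorem continuous_embed : Continuous B.embed :=
  continuous_pi fun j ↦ (B.smooth_coordinate j).continuous

theorem isClosedEmbedding_embed [CompactSpace M] : IsClosedEmbedding B.embed :=
  B.continuous_embed.isClosedEmbedding B.embed_injective

end BumpCover

end Embedding

section Frontier

variable {M : Type*} [TopologicalSpace M] [ChartedSpace (EuclideanHalfSpace 2) M]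
  [IsManifold HalfPlaneModel ∞ M]

theorem mem_boundary_of_mem_frontier {x : M} {y : Plane} (hy : y ∈ chartTarget (chart x))
    (hf : y ∈ frontier halfPlane) : chartInv (chart x) y ∈ HalfPlaneModel.boundary M := by
  rw [← ModelWithCorners.compl_interior]
  intro h
  have h1 := (HalfPlaneModel.isInteriorPoint_iff_of_mem_atlas (n := ∞) (by simp)
    (chart_mem_atlas _ x) (chartInv_mem_source hy)).1 h
  rw [show (chart x).extend HalfPlaneModel (chartInv (chart x) y) = y from
    chartMap_chartInv hy] at h1
  exact hf.2 (interior_mono chartTarget_subset h1)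

end Frontier

section Extension

variable {M : Type*} [TopologicalSpace M] [ChartedSpace (EuclideanHalfSpace 2) M]
  [IsManifold HalfPlaneModel ∞ M] [T2Space M] [CompactSpace M]
  {P : Type*} [TopologicalSpace P] {F : Type} [NormedAddCommGroup F] [NormedSpace ℝ F]

/-- Extension by zero, to the plane, of a family of functions supported in a chart and vanishing
near the boundary. -/
theorem FamM.famOn_indicator {g : P → M → F} (hg : FamM g)
    (hg0 : ∀ p, ∀ x ∈ HalfPlaneModel.boundary M, g p =ᶠ[𝓝 x] 0) {x : M} {K : Set M}
    (hK : IsClosed K) (hKc : K ⊆ (chart x).source) (h0 : ∀ p, ∀ z ∉ K, g p z = 0) (n : ℕ) :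
    FamOn univ univ n fun p ↦ (chartTarget (chart x)).indicator (g p ∘ chartInv (chart x)) := by
  set c := chart x
  have hK' : IsClosed (chartMap c '' K) :=
    (hK.isCompact.image_of_continuousOn (continuousOn_chartMap.mono hKc)).isClosed
  have hmem : ∀ y ∈ chartTarget c, y ∉ chartMap c '' K → ∀ p, g p (chartInv c y) = 0 := by
    intro y hy hyK p
    refine h0 p _ fun h ↦ hyK ⟨_, h, chartMap_chartInv hy⟩
  have hKT : chartMap c '' K ⊆ chartTarget c := by
    rintro _ ⟨z, hz, rfl⟩
    exact chartMap_mem_target (hKc hz)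
  have h1 : FamOn halfPlane (univ ×ˢ chartTarget c) n fun p ↦ g p ∘ chartInv c :=
    (hg c (chart_mem x) n).mono fun z hz ↦ ⟨hz.2, mem_univ _⟩
  have h2 := h1.indicator uniqueDiffOn_halfPlane (fun y hy ↦ chartTarget_mem_nhdsWithin hy) hK'
    (fun p y hy hyK ↦ hmem y hy hyK p) (inter_subset_left.trans hKT)
  have h3 := h2.indicator_univ HalfPlaneModel.isClosed_range (fun p y hy ↦ ?_)
  · rw [univ_prod_univ] at h3
    convert h3 using 2 with p
    rw [indicator_indicator, inter_eq_right.2 chartTarget_subset]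
  · by_cases hyK : y ∈ chartMap c '' K
    · have hyT := hKT hyK
      have h4 := (continuousWithinAt_chartInv hyT).eventually
        (hg0 p _ (mem_boundary_of_mem_frontier hyT hy))
      filter_upwards [h4] with w hw
      by_cases hwT : w ∈ chartTarget c
      · rw [indicator_of_mem hwT]
        exact hw
      · exact indicator_of_notMem hwT _
    · filter_upwards [nhdsWithin_le_nhds (hK'.isOpen_compl.mem_nhds hyK)] with w hw
      by_cases hwT : w ∈ chartTarget c
      · rw [indicator_of_mem hwT]
        exact hmem w hwT hw p
      · exact indicator_of_notMem hwT _

/-- A family of functions vanishing near the boundary extends along the embedding to a family on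
the ambient space, supported in a fixed ball. -/
theorem FamM.exists_extension (B : BumpCover M) {g : P → M → F} (hg : FamM g)
    (hg0 : ∀ p, ∀ x ∈ HalfPlaneModel.boundary M, g p =ᶠ[𝓝 x] 0) :
    ∃ Y : P → B.Ambient → F, (∀ n, FamOn univ univ n Y) ∧ (∀ p x, Y p (B.embed x) = g p x) ∧
      ∃ R, ∀ p z, R ≤ ‖z‖ → Y p z = 0 := by
  obtain ⟨R, hR⟩ := (isCompact_range B.continuous_embed).isBounded.exists_norm_le
  have hRp : (0 : ℝ) < max R 0 + 1 := by positivity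
  let χ : ContDiffBump (0 : B.Ambient) := ⟨max R 0 + 1, max R 0 + 2, hRp, by linarith⟩
  have hv : ∀ k : Fin B.size, ∀ n, FamOn univ univ n fun p ↦
      (chartTarget (chart (B.center k))).indicator
        ((fun x ↦ B.bump k x • g p x) ∘ chartInv (chart (B.center k))) := fun k n ↦
    FamM.famOn_indicator (FamMOn.smul isOpen_univ (FamM.of_contMDiff (B.smooth_bump k)) hg)
      (fun p x hx ↦ by
        filter_upwards [hg0 p x hx] with z hz
        simp [hz])
      (isClosed_tsupport _) (B.tsupport_bump k)
      (fun p z hz ↦ by simp [image_eq_zero_of_notMem_tsupport hz]) n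
  -- On the surface the coordinate `z (k, none)` is the `k`-th member of the partition of unity.
  refine ⟨fun p z ↦ χ z • ∑ k, z (k, none) • (chartTarget (chart (B.center k))).indicator
    ((fun x ↦ B.bump k x • g p x) ∘ chartInv (chart (B.center k))) (B.block k z), ?_, ?_, ?_⟩
  · intro n
    have hd : FamDomain (univ : Set B.Ambient) (univ : Set (P × B.Ambient)) := .univ_univ
    refine FamOn.smul hd (.of_contDiff hd χ.contDiff) (FamOn.sum hd fun k _ ↦ ?_)
    refine FamOn.smul hd (.of_contDiff hd (contDiff_apply ℝ ℝ (k, none))) ?_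
    exact (hv k n).comp hd (.of_contDiff hd (B.block k).contDiff) (by simp) (by simp)
  · intro p x
    have h1 : χ (B.embed x) = 1 := by
      refine χ.one_of_mem_closedBall ?_
      rw [mem_closedBall_zero_iff]
      have := hR _ (mem_range_self x)
      exact this.trans ((le_max_left R 0).trans (by simp [χ]))
    have h2 : ∀ k, B.embed x (k, none) • (chartTarget (chart (B.center k))).indicator
        ((fun x ↦ B.bump k x • g p x) ∘ chartInv (chart (B.center k))) (B.block k (B.embed x)) =
        B.part k x • g p x := by
      intro k
      change B.part k x • _ = _
      by_cases hk : B.part k x = 0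
      · simp [hk]
      · rw [B.block_embed_of_part hk,
          indicator_of_mem (chartMap_mem_target (B.mem_source_of_part hk))]
        simp only [comp_apply]
        rw [chartInv_chartMap (B.mem_source_of_part hk), (B.bump_eq_one k x hk).self_of_nhds]
        simp
    simp only [h1, h2, ← Finset.sum_smul, B.sum_part, one_smul]
  · refine ⟨max R 0 + 2, fun p z hz ↦ ?_⟩
    simp only
    rw [χ.zero_of_le_dist (by simpa [χ] using hz), zero_smul]

end Extension

/-! ### Flows on the surface -/

section CompactFields

variable {P : Type*} [TopologicalSpace P] {E : Type} [NormedAddCommGroup E] [NormedSpace ℝ E]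
  [FiniteDimensional ℝ E]

/-- A family of vector fields supported in a fixed ball is bounded and Lipschitz, uniformly on
compact time intervals. -/
theorem exists_bound_lipschitz {Y : P × ℝ → E → E} (hY : FamOn univ univ 1 Y) {R : ℝ}
    (hR : ∀ q z, R ≤ ‖z‖ → Y q z = 0) (p : P) :
    ∃ (K : NNReal) (C : ℝ), (∀ t ∈ Icc (0 : ℝ) 1, LipschitzWith K (Y (p, t))) ∧
      ∀ t ∈ Icc (0 : ℝ) 1, ∀ x, ‖Y (p, t) x‖ ≤ C := by
  have hc : IsCompact (Icc (0 : ℝ) 1 ×ˢ Metric.closedBall (0 : E) R) :=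
    isCompact_Icc.prod (isCompact_closedBall _ _)
  have h0 : Continuous (uncurry Y) := continuousOn_univ.1 hY.1
  have h1 : Continuous (uncurry fun q z ↦ fderiv ℝ (Y q) z) := by
    have := hY.2.2.continuousOn
    simpa only [fderivWithin_univ, continuousOn_univ] using this
  obtain ⟨C, hC⟩ := hc.exists_bound_of_continuousOn (f := fun w : ℝ × E ↦ Y (p, w.1) w.2)
    (h0.comp (f := fun w : ℝ × E ↦ ((p, w.1), w.2)) (by fun_prop)).continuousOn
  obtain ⟨K, hK⟩ := hc.exists_bound_of_continuousOn
    (f := fun w : ℝ × E ↦ fderiv ℝ (Y (p, w.1)) w.2)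
    (h1.comp (f := fun w : ℝ × E ↦ ((p, w.1), w.2)) (by fun_prop)).continuousOn
  refine ⟨K.toNNReal, max C 0, fun t ht ↦ ?_, fun t ht x ↦ ?_⟩
  · have hd : Differentiable ℝ (Y (p, t)) := fun z ↦
      differentiableWithinAt_univ.1 (hY.2.1 ((p, t), z) (mem_univ _))
    refine lipschitzWith_of_nnnorm_fderiv_le hd fun z ↦ ?_
    rw [← NNReal.coe_le_coe, coe_nnnorm]
    by_cases hz : ‖z‖ ≤ R
    · exact (hK (t, z) ⟨ht, by simpa using hz⟩).trans (le_max_left _ _)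
    · have : Y (p, t) =ᶠ[𝓝 z] fun _ ↦ 0 := by
        filter_upwards [(isOpen_lt continuous_const continuous_norm).mem_nhds (not_le.1 hz)]
          with w hw using hR _ _ (le_of_lt hw)
      rw [this.fderiv_eq]
      simp
  · by_cases hx : ‖x‖ ≤ R
    · exact (hC (t, x) ⟨ht, by simpa using hx⟩).trans (le_max_left _ _)
    · rw [hR _ _ (not_le.1 hx).le]
      simp

end CompactFields

section Fields

variable {M : Type*} [TopologicalSpace M] [ChartedSpace (EuclideanHalfSpace 2) M]
  [IsManifold HalfPlaneModel ∞ M] [T2Space M]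
  {P Q : Type*} [TopologicalSpace P] [TopologicalSpace Q]

/-- A family of vector fields on the surface with jointly continuous derivatives, each of which
vanishes near the boundary. A vector field is given by its components in the preferred chart of
each point, and its smoothness is tested on smooth functions. -/
structure IsFieldFamily (X : P → M → Plane) : Prop where
  smooth : ∀ u, SmoothFun u → FamM fun p x ↦ coDeriv u x (X p x)
  vanish : ∀ p, ∀ x ∈ HalfPlaneModel.boundary M, X p =ᶠ[𝓝 x] 0

/-- The curve `γ`, on the unit interval, is an integral curve of the time-dependent vector field
`Z`, as tested on smooth functions. -/
def IsFlowLine (Z : ℝ → M → Plane) (γ : ℝ → M) : Prop :=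
  ∀ u : M → ℝ, SmoothFun u → ∀ t ∈ Icc (0 : ℝ) 1,
    HasDerivWithinAt (fun t ↦ u (γ t)) (coDeriv u (γ t) (Z t (γ t))) (Icc 0 1) t

theorem IsFieldFamily.param {X : P → M → Plane} (hX : IsFieldFamily X) {θ : Q → P}
    (hθ : Continuous θ) : IsFieldFamily fun q ↦ X (θ q) :=
  ⟨fun u hu ↦ (hX.smooth u hu).param hθ, fun q ↦ hX.vanish (θ q)⟩

theorem IsFieldFamily.smul {X : P → M → Plane} (hX : IsFieldFamily X) {f : P → ℝ}
    (hf : Continuous f) : IsFieldFamily fun p x ↦ f p • X p x := by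
  refine ⟨fun u hu ↦ ?_, fun p x hx ↦ ?_⟩
  · simp only [map_smul]
    exact FamMOn.smul isOpen_univ (.of_param isOpen_univ hf) (hX.smooth u hu)
  · filter_upwards [hX.vanish p x hx] with z hz
    simp [hz]

variable (B : BumpCover M)

/-- The components of a vector field in the ambient space of the embedding. -/
def BumpCover.push (X : P → M → Plane) (p : P) (x : M) : B.Ambient :=
  fun j ↦ coDeriv (B.coord j) x (X p x)

theorem IsFieldFamily.famM_push {X : P → M → Plane} (hX : IsFieldFamily X) : FamM (B.push X) :=
  FamMOn.pi isOpen_univ fun j ↦ hX.smooth _ (B.smooth_coordinate j)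

theorem IsFieldFamily.push_vanish {X : P → M → Plane} (hX : IsFieldFamily X) (p : P) {x : M}
    (hx : x ∈ HalfPlaneModel.boundary M) : B.push X p =ᶠ[𝓝 x] 0 := by
  filter_upwards [hX.vanish p x hx] with z hz
  ext j
  simp [BumpCover.push, hz]

theorem IsFlowLine.isSolution {X : P × ℝ → M → Plane} {p : P} {γ : ℝ → M}
    (h : IsFlowLine (fun t ↦ X (p, t)) γ) {Y : P × ℝ → B.Ambient → B.Ambient}
    (hY : ∀ q x, Y q (B.embed x) = B.push X q x) :
    IsSolution (fun t ↦ Y (p, t)) (fun t ↦ B.embed (γ t)) := by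
  intro t ht
  simp only [hY]
  exact hasDerivWithinAt_pi.2 fun j ↦ h _ (B.smooth_coordinate j) t ht

theorem IsSolution.eqOn {E : Type} [NormedAddCommGroup E] [NormedSpace ℝ E] {Y : ℝ → E → E}
    {K : NNReal} (hK : ∀ t ∈ Icc (0 : ℝ) 1, LipschitzWith K (Y t)) {z w : ℝ → E}
    (hz : IsSolution Y z) (hw : IsSolution Y w) (h : z 0 = w 0) : EqOn z w (Icc 0 1) :=
  ODE_solution_unique_of_mem_Icc_right (s := fun _ ↦ univ)
    (fun t ht ↦ (hK t (Ico_subset_Icc_self ht)).lipschitzOnWith)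
    hz.continuousOn (fun _ ht ↦ hz.hasDerivWithinAt_Ici ht) (fun _ _ ↦ mem_univ _)
    hw.continuousOn (fun _ ht ↦ hw.hasDerivWithinAt_Ici ht) (fun _ _ ↦ mem_univ _) h

theorem coDeriv_chartMap {c : OpenPartialHomeomorph M (EuclideanHalfSpace 2)}
    (hc : c ∈ smoothCharts M) {x : M} (hx : x ∈ c.source) (l : Fin 2) (w : Plane) :
    coDeriv (fun z ↦ chartMap c z l) x w = chartJacobian c x w l := by
  have h1 : HasFDerivWithinAt (chartMap c ∘ chartInv (chart x)) (chartJacobian c x) halfPlane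
      (chartMap (chart x) x) :=
    ((contDiffWithinAt_transition (chart_mem x) hc (chartMap_mem_target (mem_source x))
      (by rwa [chartInv_chartMap (mem_source x)])).differentiableWithinAt
        (by simp)).hasFDerivWithinAt
  have h2 := (EuclideanSpace.proj l : Plane →L[ℝ] ℝ).hasFDerivAt.comp_hasFDerivWithinAt _ h1
  exact DFunLike.congr_fun (h2.fderivWithin (uniqueDiffOn_halfPlane _ chartMap_mem_halfPlane)) w

theorem BumpCover.block_push (X : P → M → Plane) {p : P} {x : M} {k : Fin B.size}
    (hk : B.part k x ≠ 0) :
    B.block k (B.push X p x) = chartJacobian (chart (B.center k)) x (X p x) := by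
  ext l
  rw [← coDeriv_chartMap (chart_mem _) (B.mem_source_of_part hk)]
  change coDeriv (B.coord (k, some l)) x (X p x) = _
  rw [coDeriv_congr (v := fun z ↦ chartMap (chart (B.center k)) z l)]
  filter_upwards [B.bump_eq_one k x hk] with z hz
  simp [BumpCover.coord, hz]

end Fields

section Flow

variable {M : Type*} [TopologicalSpace M] [ChartedSpace (EuclideanHalfSpace 2) M]
  [IsManifold HalfPlaneModel ∞ M] [T2Space M] [CompactSpace M]
  {P Q : Type*} [TopologicalSpace P] [TopologicalSpace Q]

theorem IsFlowLine.eqOn {X : P × ℝ → M → Plane} (hX : IsFieldFamily X) {p : P} {γ γ' : ℝ → M}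
    (h : IsFlowLine (fun t ↦ X (p, t)) γ) (h' : IsFlowLine (fun t ↦ X (p, t)) γ')
    (h0 : γ 0 = γ' 0) {t : ℝ} (ht : t ∈ Icc (0 : ℝ) 1) : γ t = γ' t := by
  obtain ⟨B⟩ := nonempty_bumpCover M
  obtain ⟨Y, hY, hYX, R, hR⟩ := (hX.famM_push B).exists_extension B
    fun q x hx ↦ hX.push_vanish B q hx
  obtain ⟨K, C, hK, hC⟩ := exists_bound_lipschitz (hY 1) hR p
  exact B.embed_injective (IsSolution.eqOn hK (h.isSolution B hYX) (h'.isSolution B hYX)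
    (congrArg B.embed h0) ht)

/-- Each value of a vector field vanishing at the boundary is the velocity of a curve. -/
theorem IsFieldFamily.exists_curve (B : BumpCover M) {X : P → M → Plane} (hX : IsFieldFamily X)
    (p : P) (x : M) : ∃ γ : ℝ → M, γ 0 = x ∧
      HasDerivAt (fun s ↦ B.embed (γ s)) (B.push X p x) 0 := by
  by_cases hx : x ∈ HalfPlaneModel.boundary M
  · refine ⟨fun _ ↦ x, rfl, ?_⟩
    rw [(hX.push_vanish B p hx).self_of_nhds]
    exact hasDerivAt_const _ _
  · rw [← mem_compl_iff, ModelWithCorners.compl_boundary] at hx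
    have hn : halfPlane ∈ 𝓝 (chartMap (chart x) x) := mem_interior_iff_mem_nhds.1 hx
    refine ⟨fun s ↦ chartInv (chart x) (chartMap (chart x) x + s • X p x), ?_, ?_⟩
    · simp only [zero_smul, add_zero]
      exact chartInv_chartMap (mem_source x)
    · refine hasDerivAt_pi.2 fun j ↦ ?_
      have h1 := ((differentiableWithinAt_chart (B.smooth_coordinate j x) (chart_mem x)
        (mem_source x)).hasFDerivWithinAt).hasFDerivAt hn
      have h2 : HasDerivAt (fun s : ℝ ↦ chartMap (chart x) x + s • X p x) (X p x) 0 := by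
        simpa using ((hasDerivAt_id (0 : ℝ)).smul_const (X p x)).const_add (chartMap (chart x) x)
      exact HasFDerivAt.comp_hasDerivAt_of_eq (0 : ℝ) h1 h2 (by simp)

/-- The image of the surface is invariant under the extended vector field: the distance of a
solution to it grows at most exponentially, by comparison with curves on the surface. -/
theorem IsSolution.mem_range_embed (B : BumpCover M) {X : P × ℝ → M → Plane}
    (hX : IsFieldFamily X) {Y : P × ℝ → B.Ambient → B.Ambient}
    (hY : ∀ q x, Y q (B.embed x) = B.push X q x) {p : P} {K : NNReal}
    (hK : ∀ t ∈ Icc (0 : ℝ) 1, LipschitzWith K (Y (p, t))) {z : ℝ → B.Ambient}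
    (hz : IsSolution (fun t ↦ Y (p, t)) z) (h0 : z 0 ∈ range B.embed) {t : ℝ}
    (ht : t ∈ Icc (0 : ℝ) 1) : z t ∈ range B.embed := by
  have hcl := B.isClosedEmbedding_embed.isClosed_range
  have hne : (range B.embed).Nonempty := ⟨_, h0⟩
  have hcpt : IsCompact (range B.embed) := isCompact_range B.continuous_embed
  have key : ∀ t ∈ Icc (0 : ℝ) 1, Metric.infDist (z t) (range B.embed) ≤
      gronwallBound 0 K 0 (t - 0) := by
    refine le_gronwallBound_of_liminf_deriv_right_le
      (f' := fun t ↦ K * Metric.infDist (z t) (range B.embed)) ?_ (fun t ht r hr ↦ ?_) ?_ ?_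
    · exact (Metric.continuous_infDist_pt _).comp_continuousOn hz.continuousOn
    -- The nearest point `x` can be moved along the surface with the velocity of `Y` at it.
    · obtain ⟨_, ⟨x, rfl⟩, hx⟩ := hcpt.exists_infDist_eq_dist hne (z t)
      obtain ⟨γ, hγ0, hγ⟩ := hX.exists_curve B (p, t) x
      have h1 : HasDerivAt (fun s ↦ B.embed (γ (s - t))) (B.push X (p, t) x) t := by
        have := HasDerivAt.comp_sub_const t t (f := fun s ↦ B.embed (γ s)) (by simpa using hγ)
        exact this
      have h2 := (hz.hasDerivWithinAt_Ici ht).sub h1.hasDerivWithinAt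
      have h3 : ‖Y (p, t) (z t) - B.push X (p, t) x‖ < r := by
        refine lt_of_le_of_lt ?_ hr
        rw [← hY, hx, ← dist_eq_norm]
        exact (hK t (Ico_subset_Icc_self ht)).dist_le_mul _ _
      refine (h2.liminf_right_slope_norm_le h3).mp ?_
      filter_upwards [self_mem_nhdsWithin] with s hs h4
      refine lt_of_le_of_lt ?_ h4
      have hs' : 0 < s - t := sub_pos.2 hs
      refine mul_le_mul_of_nonneg_left (sub_le_sub ?_ ?_) (inv_nonneg.2 hs'.le)
      · rw [Pi.sub_apply, ← dist_eq_norm]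
        exact Metric.infDist_le_dist_of_mem (mem_range_self _)
      · rw [Pi.sub_apply, sub_self, hγ0, hx, dist_eq_norm]
    · rw [Metric.infDist_zero_of_mem h0]
    · intro t _
      simp
  have h1 := key t ht
  rw [gronwallBound_ε0, zero_mul] at h1
  exact (hcl.mem_iff_infDist_zero hne).2 (le_antisymm h1 Metric.infDist_nonneg)

theorem FamMOn.comp_of_chartMap {W : Set (P × M)} (hW : IsOpen W)
    {c : OpenPartialHomeomorph M (EuclideanHalfSpace 2)} (hc : c ∈ smoothCharts M)
    {ψ : P → M → M} (hψ : FamMOn W fun p x ↦ chartMap c (ψ p x))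
    (hWc : ∀ z ∈ W, ψ z.1 z.2 ∈ c.source) {u : M → ℝ} (hu : SmoothFun u) :
    FamMOn W fun p x ↦ u (ψ p x) := by
  intro c' hc' n
  have hd := famDomain_coordDomain c' hW
  have h1 : FamM fun _ : P ↦ u := .of_contMDiff hu
  refine ((h1 c hc n).comp hd (hψ c' hc' n)
    (fun w hw ↦ ⟨chartMap_mem_target (hWc _ hw.2), mem_univ _⟩)
    fun w hw ↦ Eventually.of_forall fun _ ↦ chartMap_mem_halfPlane).congr hd fun w hw ↦ ?_
  simp only
  rw [chartInv_chartMap (hWc _ hw.2)]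

/-- A family of self-maps has jointly continuous derivatives if its composition with the embedding
does. -/
theorem BumpCover.famMap_of_embed (B : BumpCover M) {ψ : P → M → M}
    (hψ : FamM fun p x ↦ B.embed (ψ p x)) : FamMap ψ := by
  have hcont : Continuous (uncurry ψ) :=
    B.isClosedEmbedding_embed.isInducing.continuous_iff.2 hψ.continuous
  intro u hu
  refine FamMOn.of_local fun z _ ↦ ?_
  obtain ⟨k, hk⟩ := B.exists_part_ne_zero (ψ z.1 z.2)
  have hW : IsOpen {w : P × M | B.part k (ψ w.1 w.2) ≠ 0} :=
    isOpen_ne_fun ((B.smooth_part k).continuous.comp hcont) continuous_const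
  refine ⟨_, hW, hk, FamMOn.comp_of_chartMap hW (chart_mem (B.center k)) ?_
    (fun w hw ↦ B.mem_source_of_part hw) hu⟩
  exact ((hψ.mono (subset_univ _)).clm hW (B.block k)).congr hW fun w hw ↦
    (B.block_embed_of_part hw).symm

/-- Solutions in the ambient space that stay on the surface are integral curves. -/
theorem BumpCover.isFlowLine (B : BumpCover M) {X : P × ℝ → M → Plane}
    {Y : P × ℝ → B.Ambient → B.Ambient} (hY : ∀ q x, Y q (B.embed x) = B.push X q x) {p : P}
    {γ : ℝ → M} {z : ℝ → B.Ambient} (hz : IsSolution (fun t ↦ Y (p, t)) z)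
    (hγ : ∀ t ∈ Icc (0 : ℝ) 1, B.embed (γ t) = z t) : IsFlowLine (fun t ↦ X (p, t)) γ := by
  intro u hu t ht
  obtain ⟨k, hk⟩ := B.exists_part_ne_zero (γ t)
  set c := chart (B.center k)
  have hsrc := B.mem_source_of_part hk
  have hγc : ContinuousOn γ (Icc 0 1) :=
    B.isClosedEmbedding_embed.isInducing.continuousOn_iff.2 (hz.continuousOn.congr hγ)
  have hpart : ∀ᶠ s in 𝓝[Icc 0 1] t, B.part k (γ s) ≠ 0 :=
    ((B.smooth_part k).continuous.continuousAt.comp_continuousWithinAt (hγc t ht)).eventually_ne hk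
  have hblock : (fun s ↦ chartMap c (γ s)) =ᶠ[𝓝[Icc 0 1] t] fun s ↦ B.block k (z s) := by
    filter_upwards [hpart, self_mem_nhdsWithin] with s hs hsI
    rw [← hγ s hsI, B.block_embed_of_part hs]
  have h1 : HasDerivWithinAt (fun s ↦ chartMap c (γ s)) (chartJacobian c (γ t) (X (p, t) (γ t)))
      (Icc 0 1) t := by
    have h2 := (B.block k).hasFDerivAt.comp_hasDerivWithinAt t (hz t ht)
    simp only [← hγ t ht, hY, B.block_push X hk] at h2
    exact h2.congr_of_eventuallyEq hblock (hblock.self_of_nhdsWithin ht)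
  have h3 := (differentiableWithinAt_chart (hu (γ t)) (chart_mem _) hsrc).hasFDerivWithinAt
  have h4 := h3.comp_hasDerivWithinAt t h1 fun _ _ ↦ chartMap_mem_halfPlane
  rw [coDeriv_eq (hu (γ t)) (chart_mem _) hsrc]
  refine h4.congr_of_eventuallyEq ?_ ?_
  · filter_upwards [hpart] with s hs
    simp only [comp_apply]
    rw [chartInv_chartMap (B.mem_source_of_part hs)]
  · simp only [comp_apply]
    rw [chartInv_chartMap hsrc]

/-- The clamping of a real number to the unit interval. -/
def clamp (t : ℝ) : ℝ := projIcc (0 : ℝ) 1 zero_le_one t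

theorem continuous_clamp : Continuous clamp := continuous_subtype_val.comp continuous_projIcc

theorem clamp_mem (t : ℝ) : clamp t ∈ Icc (0 : ℝ) 1 := (projIcc (0 : ℝ) 1 zero_le_one t).2

theorem clamp_of_mem {t : ℝ} (ht : t ∈ Icc (0 : ℝ) 1) : clamp t = t := by
  rw [clamp, projIcc_of_mem _ ht]

/-- Flows of families of time-dependent vector fields on the surface. -/
theorem IsFieldFamily.exists_flow {X : P × ℝ → M → Plane} (hX : IsFieldFamily X) :
    ∃ ψ : P × ℝ → M → M, FamMap ψ ∧ (∀ p x, ψ (p, 0) x = x) ∧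
      ∀ p x, IsFlowLine (fun t ↦ X (p, t)) (fun t ↦ ψ (p, t) x) := by
  obtain ⟨B⟩ := nonempty_bumpCover M
  obtain ⟨Y, hY, hYX, R, hR⟩ := (hX.famM_push B).exists_extension B
    fun q x hx ↦ hX.push_vanish B q hx
  have hc : Continuous (uncurry Y) := continuousOn_univ.1 (hY 0)
  have hex : ∀ p z₀, ∃ z : ℝ → B.Ambient, z 0 = z₀ ∧ IsSolution (fun t ↦ Y (p, t)) z := by
    intro p z₀
    obtain ⟨K, C, hK, hC⟩ := exists_bound_lipschitz (hY 1) hR p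
    exact exists_isSolution_of_lipschitz hK hC (fun x ↦
      (hc.comp (f := fun t : ℝ ↦ ((p, t), x)) (by fun_prop)).continuousOn) z₀
  choose Ψ hΨ0 hΨ using hex
  have hmem : ∀ (q : P × ℝ) (x : M), ∃ y, B.embed y = Ψ q.1 (B.embed x) (clamp q.2) := by
    intro q x
    obtain ⟨K, C, hK, hC⟩ := exists_bound_lipschitz (hY 1) hR q.1
    exact (hΨ q.1 (B.embed x)).mem_range_embed B hX hYX hK
      (by rw [hΨ0]; exact mem_range_self _) (clamp_mem _)
  choose ψ hψ using hmem
  have hflow : ∀ n, FamOn univ (timeDomain univ 0 1) n fun q z ↦ Ψ q.1 z q.2 :=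
    fun n ↦ famOn_flow n hY hΨ0 hΨ
  refine ⟨ψ, B.famMap_of_embed ?_, fun p x ↦ ?_, fun p x ↦ ?_⟩
  · simp only [hψ]
    intro c hc' n
    have hd := coordDomain_univ (P := P × ℝ) c
    have h1 : FamOn univ univ n fun (q : P × ℝ) z ↦ Ψ q.1 z (clamp q.2) :=
      (hflow n).param (θ := fun q : P × ℝ ↦ (q.1, clamp q.2))
        (by have := continuous_clamp; fun_prop) fun z _ ↦ ⟨mem_univ _, clamp_mem _⟩
    have h2 : FamM fun _ : P × ℝ ↦ B.embed :=
      FamMOn.pi isOpen_univ fun j ↦ FamM.of_contMDiff (B.smooth_coordinate j)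
    exact h1.comp hd (h2 c hc' n) (by simp) (by simp)
  · refine B.embed_injective ?_
    rw [hψ]
    simp only
    rw [clamp_of_mem (by simp), hΨ0]
  · refine B.isFlowLine hYX (hΨ p (B.embed x)) fun t ht ↦ ?_
    rw [hψ]
    simp only
    rw [clamp_of_mem ht]

end Flow

/-! ### Flows by diffeomorphisms -/

section FlowDiffeo

variable {M : Type*} [TopologicalSpace M] [ChartedSpace (EuclideanHalfSpace 2) M]
  [IsManifold HalfPlaneModel ∞ M] [T2Space M] [CompactSpace M]
  {P Q : Type*} [TopologicalSpace P] [TopologicalSpace Q]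

theorem IsFlowLine.comp_affine {Z : ℝ → M → Plane} {γ : ℝ → M} (h : IsFlowLine Z γ) {a : ℝ → ℝ}
    {s : ℝ} (ha : ∀ t, HasDerivAt a s t) (hmaps : MapsTo a (Icc 0 1) (Icc 0 1)) :
    IsFlowLine (fun t x ↦ s • Z (a t) x) (fun t ↦ γ (a t)) := by
  intro u hu t ht
  have h1 := (h u hu (a t) (hmaps ht)).comp t (ha t).hasDerivWithinAt hmaps
  rw [map_smul, smul_eq_mul, mul_comm]
  exact h1

/-- The flow of a family of time-dependent vector fields consists of diffeomorphisms; the inverses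
are the flows of the fields with time reversed. -/
theorem IsFieldFamily.exists_flow_diffeo {X : P × ℝ → M → Plane} (hX : IsFieldFamily X) :
    ∃ Ψ : P × ℝ → Diffeo M, FamMap (fun q ↦ (Ψ q : M → M)) ∧ (∀ p x, Ψ (p, 0) x = x) ∧
      (∀ p x, IsFlowLine (fun t ↦ X (p, t)) (fun t ↦ Ψ (p, t) x)) ∧
      ∀ p x, (∀ t, X (p, t) x = 0) → ∀ t, Ψ (p, t) x = x := by
  obtain ⟨ψ, hψ, hψ0, hψX⟩ := hX.exists_flow
  -- The field that runs the flow of `X` from time `clamp τ` back to `0`.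
  have hX' : IsFieldFamily fun (q : (P × ℝ) × ℝ) x ↦
      (-clamp q.1.2) • X (q.1.1, clamp q.1.2 * (1 - q.2)) x :=
    (hX.param (θ := fun q : (P × ℝ) × ℝ ↦ (q.1.1, clamp q.1.2 * (1 - q.2)))
      (by have := continuous_clamp; fun_prop)).smul
      (f := fun q : (P × ℝ) × ℝ ↦ -clamp q.1.2) (by have := continuous_clamp; fun_prop)
  -- The field whose flow over the unit interval is that of `X` over `[0, clamp τ]`, needed to see
  -- that the inverse is also a right inverse.
  have hX'' : IsFieldFamily fun (q : (P × ℝ) × ℝ) x ↦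
      (clamp q.1.2) • X (q.1.1, clamp q.1.2 * q.2) x :=
    (hX.param (θ := fun q : (P × ℝ) × ℝ ↦ (q.1.1, clamp q.1.2 * q.2))
      (by have := continuous_clamp; fun_prop)).smul
      (f := fun q : (P × ℝ) × ℝ ↦ clamp q.1.2) (by have := continuous_clamp; fun_prop)
  obtain ⟨χ, hχ, hχ0, hχX⟩ := hX'.exists_flow
  have hm1 : ∀ τ, MapsTo (fun t ↦ clamp τ * (1 - t)) (Icc 0 1) (Icc 0 1) := fun τ t ht ↦ by
    have := clamp_mem τ
    exact ⟨mul_nonneg this.1 (sub_nonneg.2 ht.2),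
      mul_le_one₀ this.2 (sub_nonneg.2 ht.2) (by linarith [ht.1])⟩
  have hm2 : ∀ τ, MapsTo (fun t ↦ clamp τ * t) (Icc 0 1) (Icc 0 1) := fun τ t ht ↦ by
    have := clamp_mem τ
    exact ⟨mul_nonneg this.1 ht.1, mul_le_one₀ this.2 ht.1 ht.2⟩
  have hd1 : ∀ τ t, HasDerivAt (fun t ↦ clamp τ * (1 - t)) (-clamp τ) t := fun τ t ↦ by
    simpa using ((hasDerivAt_id t).const_sub 1).const_mul (clamp τ)
  have hd2 : ∀ τ t, HasDerivAt (fun t ↦ clamp τ * t) (clamp τ) t := fun τ t ↦ by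
    simpa using (hasDerivAt_id t).const_mul (clamp τ)
  have hone : (1 : ℝ) ∈ Icc (0 : ℝ) 1 := by simp
  have hl : ∀ q x, χ (q, 1) (ψ (q.1, clamp q.2) x) = x := by
    intro q x
    have h1 := (hψX q.1 x).comp_affine (hd1 q.2) (hm1 q.2)
    have h2 := IsFlowLine.eqOn hX' (p := q) (hχX q (ψ (q.1, clamp q.2) x)) h1
      (by rw [hχ0]; simp) hone
    rw [h2]
    simp [hψ0]
  have hr : ∀ q y, ψ (q.1, clamp q.2) (χ (q, 1) y) = y := by
    intro q y
    have h1 := (hχX q y).comp_affine (a := fun t ↦ 1 - t) (s := -1)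
      (fun t ↦ by simpa using (hasDerivAt_id t).const_sub 1)
      fun t ht ↦ ⟨sub_nonneg.2 ht.2, by linarith [ht.1]⟩
    have h2 := (hψX q.1 (χ (q, 1) y)).comp_affine (hd2 q.2) (hm2 q.2)
    have h3 := IsFlowLine.eqOn hX'' (p := q) h2 (by simpa using h1) (by simp [hψ0]) hone
    simp only [mul_one, sub_self, hχ0] at h3
    exact h3
  refine ⟨fun q ↦
    { toFun := ψ (q.1, clamp q.2)
      invFun := χ (q, 1)
      left_inv := hl q
      right_inv := hr q
      contMDiff_toFun := hψ.contMDiff _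
      contMDiff_invFun := hχ.contMDiff _ }, ?_, ?_, ?_, ?_⟩
  · exact hψ.param (θ := fun q : P × ℝ ↦ (q.1, clamp q.2))
      (by have := continuous_clamp; fun_prop)
  · intro p x
    change ψ (p, clamp 0) x = x
    rw [clamp_of_mem (by simp), hψ0]
  · intro p x u hu t ht
    have h1 := hψX p x u hu t ht
    change HasDerivWithinAt (fun t ↦ u (ψ (p, clamp t) x))
      (coDeriv u (ψ (p, clamp t) x) (X (p, t) (ψ (p, clamp t) x))) (Icc 0 1) t
    rw [clamp_of_mem ht]
    exact h1.congr (fun s hs ↦ by rw [clamp_of_mem hs]) (by rw [clamp_of_mem ht])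
  · intro p x hx t
    change ψ (p, clamp t) x = x
    have h1 : IsFlowLine (fun t ↦ X (p, t)) (fun _ ↦ x) := by
      intro u hu s _
      simp only [hx, map_zero]
      exact hasDerivWithinAt_const _ _ _
    exact IsFlowLine.eqOn hX (hψX p x) h1 (hψ0 p x) (clamp_mem t)

end FlowDiffeo

/-! ### Exterior derivatives of sums `∑ a i • d(h i)` -/

section Forms

variable {M : Type*} [TopologicalSpace M] [ChartedSpace (EuclideanHalfSpace 2) M]
  [IsManifold HalfPlaneModel ∞ M] {ι κ : Type} [Fintype ι] [Fintype κ]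

/-- The 1-form `∑ i, a i • d(h i)`, in the preferred chart of each point. -/
def formSum (a h : ι → M → ℝ) (x : M) : Plane →L[ℝ] ℝ := ∑ i, a i x • coDeriv (h i) x

/-- The exterior derivative `∑ i, d(a i) ∧ d(h i)` of `formSum a h`, evaluated on the coordinate
vectors of the preferred chart of each point. -/
def areaSum (a h : ι → M → ℝ) (x : M) : ℝ := ∑ i, wedge (coDeriv (a i) x) (coDeriv (h i) x)

theorem formSum_apply (a h : ι → M → ℝ) (x : M) (v : Plane) :
    formSum a h x v = ∑ i, a i x * coDeriv (h i) x v := by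
  simp [formSum, sum_apply]

theorem areaSum_mul (a h : ι → M → ℝ) (x : M) (v w : Plane) :
    ∑ i, (coDeriv (a i) x v * coDeriv (h i) x w - coDeriv (a i) x w * coDeriv (h i) x v) =
      areaSum a h x * (v 0 * w 1 - v 1 * w 0) := by
  simp only [wedge_mul_area, areaSum, Finset.sum_mul]

variable {x : M}

/-- The differential of a function in the preferred chart at `x`, from the differential in the
preferred charts of the points nearby. -/
theorem chartDeriv_eq {u : M → ℝ} {z : M} (hu : ContMDiffAt HalfPlaneModel 𝓘(ℝ, ℝ) ∞ u z)
    (hz : z ∈ (chart x).source) : chartDeriv (chart x) u (chartMap (chart x) z) =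
      (coDeriv u z).comp (tangentCoordChange HalfPlaneModel x z z) := by
  have h1 : HasFDerivWithinAt (chartMap (chart z) ∘ chartInv (chart x))
      (tangentCoordChange HalfPlaneModel x z z) halfPlane (chartMap (chart x) z) :=
    hasFDerivWithinAt_tangentCoordChange (by
      simp only [extChartAt_source]
      exact ⟨hz, mem_source z⟩)
  have h2 : HasFDerivWithinAt (u ∘ chartInv (chart z)) (coDeriv u z) halfPlane
      ((chartMap (chart z) ∘ chartInv (chart x)) (chartMap (chart x) z)) := by
    simp only [comp_apply]
    rw [chartInv_chartMap hz]
    exact (differentiableWithinAt_chart hu (chart_mem z) (mem_source z)).hasFDerivWithinAt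
  have h3 := h2.comp _ h1 fun _ _ ↦ chartMap_mem_halfPlane
  refine (h3.congr_of_eventuallyEq ?_ ?_).fderivWithin
    (uniqueDiffOn_halfPlane _ chartMap_mem_halfPlane)
  · have h4 := (continuousWithinAt_chartInv (chartMap_mem_target hz)).eventually_mem
      ((chart z).open_source.mem_nhds (by rw [chartInv_chartMap hz]; exact mem_source z))
    filter_upwards [h4] with y hy
    simp only [comp_apply]
    rw [chartInv_chartMap hy]
  · simp only [comp_apply]
    rw [chartInv_chartMap hz, chartInv_chartMap (mem_source z)]

/-- The 1-form `formSum a h` in the preferred chart at `x`. -/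
def chartForm (x : M) (a h : ι → M → ℝ) (y : Plane) : Plane →L[ℝ] ℝ :=
  ∑ i, a i (chartInv (chart x) y) • chartDeriv (chart x) (h i) y

theorem chartForm_eq {a h : ι → M → ℝ} (hh : ∀ i, SmoothFun (h i)) {y : Plane}
    (hy : y ∈ chartTarget (chart x)) :
    chartForm x a h y = (formSum a h (chartInv (chart x) y)).comp
      (tangentCoordChange HalfPlaneModel x (chartInv (chart x) y) (chartInv (chart x) y)) := by
  ext v
  have h1 : ∀ i, chartDeriv (chart x) (h i) y = (coDeriv (h i) (chartInv (chart x) y)).comp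
      (tangentCoordChange HalfPlaneModel x (chartInv (chart x) y) (chartInv (chart x) y)) := by
    intro i
    have h2 := chartDeriv_eq (hh i (chartInv (chart x) y)) (chartInv_mem_source hy)
    rwa [chartMap_chartInv hy] at h2
  simp only [chartForm, h1, formSum_apply, ContinuousLinearMap.comp_apply, sum_apply,
    smul_apply, smul_eq_mul]

theorem hasFDerivWithinAt_chartForm {a h : ι → M → ℝ} (ha : ∀ i, SmoothFun (a i))
    (hh : ∀ i, SmoothFun (h i)) :
    HasFDerivWithinAt (chartForm x a h)
      (∑ i, (a i x • fderivWithin ℝ (fderivWithin ℝ (h i ∘ chartInv (chart x)) halfPlane) halfPlane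
          (chartMap (chart x) x) + (coDeriv (a i) x).smulRight (coDeriv (h i) x)))
      halfPlane (chartMap (chart x) x) := by
  have hy : chartMap (chart x) x ∈ halfPlane := chartMap_mem_halfPlane
  refine HasFDerivWithinAt.fun_sum fun i _ ↦ ?_
  have h1 := (differentiableWithinAt_chart (ha i x) (chart_mem x) (mem_source x)).hasFDerivWithinAt
  have h2 : ContDiffWithinAt ℝ ∞ (h i ∘ chartInv (chart x)) halfPlane (chartMap (chart x) x) :=
    contDiffWithinAt_comp_chartInv (chart_mem x) (chartMap_mem_target (mem_source x)) (hh i _)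
  have h3 := (h2.fderivWithin_right (m := 1) uniqueDiffOn_halfPlane
    (WithTop.coe_le_coe.2 le_top) hy).differentiableWithinAt one_ne_zero |>.hasFDerivWithinAt
  have h4 := h1.smul h3
  simp only [comp_apply, chartInv_chartMap (mem_source x)] at h4
  exact h4

theorem fderivWithin_chartForm_sub {a h : ι → M → ℝ} (ha : ∀ i, SmoothFun (a i))
    (hh : ∀ i, SmoothFun (h i)) (v w : Plane) :
    fderivWithin ℝ (chartForm x a h) halfPlane (chartMap (chart x) x) v w -
      fderivWithin ℝ (chartForm x a h) halfPlane (chartMap (chart x) x) w v =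
      areaSum a h x * (v 0 * w 1 - v 1 * w 0) := by
  have hy : chartMap (chart x) x ∈ halfPlane := chartMap_mem_halfPlane
  have hs : ∀ i, fderivWithin ℝ (fderivWithin ℝ (h i ∘ chartInv (chart x)) halfPlane) halfPlane
      (chartMap (chart x) x) v w = fderivWithin ℝ (fderivWithin ℝ (h i ∘ chartInv (chart x))
        halfPlane) halfPlane (chartMap (chart x) x) w v := by
    intro i
    have h2 : ContDiffWithinAt ℝ ∞ (h i ∘ chartInv (chart x)) halfPlane (chartMap (chart x) x) :=
      contDiffWithinAt_comp_chartInv (chart_mem x) (chartMap_mem_target (mem_source x)) (hh i _)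
    exact h2.isSymmSndFDerivWithinAt (by simpa using ENat.LEInfty.out) uniqueDiffOn_halfPlane
      (HalfPlaneModel.range_subset_closure_interior hy) hy v w
  rw [(hasFDerivWithinAt_chartForm ha hh).fderivWithin (uniqueDiffOn_halfPlane _ hy), ← areaSum_mul]
  simp only [sum_apply, add_apply,
    smul_apply, ContinuousLinearMap.smulRight_apply, smul_eq_mul, hs,
    ← Finset.sum_sub_distrib]
  exact Finset.sum_congr rfl fun i _ ↦ by ring

/-- Forms that differ by an exact form have the same exterior derivative. -/
theorem areaSum_eq_of_eventually {a h : ι → M → ℝ} (ha : ∀ i, SmoothFun (a i))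
    (hh : ∀ i, SmoothFun (h i)) {a' h' : κ → M → ℝ} (ha' : ∀ i, SmoothFun (a' i))
    (hh' : ∀ i, SmoothFun (h' i)) {F : M → ℝ} (hF : SmoothFun F)
    (heq : ∀ᶠ z in 𝓝 x, formSum a h z = formSum a' h' z + coDeriv F z) :
    areaSum a h x = areaSum a' h' x := by
  have hxt := chartMap_mem_target (mem_source x)
  have hy : chartMap (chart x) x ∈ halfPlane := chartMap_mem_halfPlane
  have h1 : chartForm x a h =ᶠ[𝓝[halfPlane] chartMap (chart x) x] fun y ↦
      chartForm x a' h' y + chartForm x (fun _ : Unit ↦ fun _ ↦ (1 : ℝ)) (fun _ ↦ F) y := by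
    have h2 := (continuousWithinAt_chartInv hxt).eventually
      (by rw [chartInv_chartMap (mem_source x)]; exact heq)
    filter_upwards [h2, chartTarget_mem_nhdsWithin hxt] with y hy hyt
    rw [chartForm_eq hh hyt, chartForm_eq hh' hyt, chartForm_eq (fun _ ↦ hF) hyt, hy]
    ext v
    simp [formSum]
  have h3 := hasFDerivWithinAt_chartForm (x := x) ha' hh'
  have h4 := hasFDerivWithinAt_chartForm (x := x) (a := fun _ : Unit ↦ fun _ ↦ (1 : ℝ))
    (fun _ ↦ contMDiff_const) (fun _ ↦ hF)
  have h5 := h1.fderivWithin_eq (𝕜 := ℝ) (h1.self_of_nhdsWithin hy)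
  have h10 := fderivWithin_fun_add (𝕜 := ℝ) (uniqueDiffOn_halfPlane _ hy)
    h3.differentiableWithinAt h4.differentiableWithinAt
  rw [h10] at h5
  have h6 := fderivWithin_chartForm_sub (x := x) ha hh (EuclideanSpace.single 0 1)
    (EuclideanSpace.single 1 1)
  have h7 := fderivWithin_chartForm_sub (x := x) ha' hh' (EuclideanSpace.single 0 1)
    (EuclideanSpace.single 1 1)
  have h8 := fderivWithin_chartForm_sub (x := x) (a := fun _ : Unit ↦ fun _ ↦ (1 : ℝ))
    (h := fun _ ↦ F) (fun _ ↦ contMDiff_const) (fun _ ↦ hF) (EuclideanSpace.single 0 1)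
    (EuclideanSpace.single 1 1)
  have h9 : areaSum (fun _ : Unit ↦ fun _ : M ↦ (1 : ℝ)) (fun _ ↦ F) x = 0 := by
    simp [areaSum, coDeriv_const, wedge]
  rw [h5] at h6
  rw [h9] at h8
  simp only [add_apply] at h6
  simp at h6 h7 h8
  linarith

/-- The exterior derivative of a form that is globally a sum `∑ a i d(h i)`. -/
theorem extD_eq {α : OneForm M} {a h : ι → M → ℝ} (ha : ∀ i, SmoothFun (a i))
    (hh : ∀ i, SmoothFun (h i))
    (hα : ∀ (x : M) (v : TangentSpace HalfPlaneModel x), α x v = formSum a h x v) (x : M)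
    (v w : TangentSpace HalfPlaneModel x) :
    extD α x v w = ∑ i, (coDeriv (a i) x v * coDeriv (h i) x w -
      coDeriv (a i) x w * coDeriv (h i) x v) := by
  have hxt := chartMap_mem_target (mem_source x)
  have hy : chartMap (chart x) x ∈ halfPlane := chartMap_mem_halfPlane
  have h1 : ∀ y ∈ chartTarget (chart x), coordForm α x y = chartForm x a h y := by
    intro y hy
    ext w
    have h2 : ∀ i, chartDeriv (chart x) (h i) y w = coDeriv (h i) (chartInv (chart x) y)
        (mfderivWithin 𝓘(ℝ, Plane) HalfPlaneModel (extChartAt HalfPlaneModel x).symm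
          (range HalfPlaneModel) y w) := by
      intro i
      have h3 : MDifferentiableWithinAt 𝓘(ℝ, Plane) HalfPlaneModel
          (extChartAt HalfPlaneModel x).symm (range HalfPlaneModel) y :=
        mdifferentiableWithinAt_extChartAt_symm hy
      have h4 := mfderiv_comp_mfderivWithin (I := 𝓘(ℝ, Plane)) (I' := HalfPlaneModel)
        (I'' := 𝓘(ℝ, ℝ)) (g := h i) y ((hh i _).mdifferentiableAt (by simp)) h3
        (uniqueDiffOn_halfPlane.uniqueMDiffOn y (chartTarget_subset hy))
      rw [mfderivWithin_eq_fderivWithin] at h4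
      exact (DFunLike.congr_fun h4 w).trans (mfderiv_apply_eq_coDeriv (hh i _) _)
    have h5 : coordForm α x y w = formSum a h (chartInv (chart x) y)
        (mfderivWithin 𝓘(ℝ, Plane) HalfPlaneModel (extChartAt HalfPlaneModel x).symm
          (range HalfPlaneModel) y w) := hα _ _
    refine h5.trans ((formSum_apply ..).trans ?_)
    simp only [chartForm, sum_apply, smul_apply, smul_eq_mul, h2]
  have h2 : coordForm α x =ᶠ[𝓝[halfPlane] chartMap (chart x) x] chartForm x a h := by
    filter_upwards [chartTarget_mem_nhdsWithin hxt] with y hy using h1 y hy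
  have h3 := (hasFDerivWithinAt_chartForm (x := x) ha hh).congr_of_eventuallyEq h2
    (h2.self_of_nhdsWithin hy)
  -- The tangent space is identified with the plane by the preferred chart.
  have hid : ∀ v : TangentSpace HalfPlaneModel x,
      mfderiv HalfPlaneModel 𝓘(ℝ, Plane) (extChartAt HalfPlaneModel x) x v = v := by
    intro v
    have h4 : MDifferentiableAt HalfPlaneModel 𝓘(ℝ, Plane) (extChartAt HalfPlaneModel x) x :=
      (contMDiffAt_extChartAt (I := HalfPlaneModel) (x := x) (n := 1)).mdifferentiableAt one_ne_zero
    rw [h4.mfderiv]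
    exact tangentCoordChange_self (I := HalfPlaneModel) (by rw [extChartAt_source]; exact mem_source x)
  have h5 : DifferentiableWithinAt ℝ (fun y ↦
      ContinuousAlternatingMap.ofSubsingleton ℝ Plane ℝ (0 : Fin 1) (coordForm α x y)) halfPlane
        (chartMap (chart x) x) :=
    (ContinuousAlternatingMap.ofSubsingletonLIE (𝕜 := ℝ) (E := Plane) (F := ℝ)
      (0 : Fin 1)).toContinuousLinearEquiv
      |>.toContinuousLinearMap.differentiableAt.comp_differentiableWithinAt _
        h3.differentiableWithinAt
  have h6 : ∀ v w : Plane, fderivWithin ℝ (fun y ↦ coordForm α x y w) halfPlane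
      (chartMap (chart x) x) v =
        fderivWithin ℝ (chartForm x a h) halfPlane (chartMap (chart x) x) v w := by
    intro v w
    have h7 := ((ContinuousLinearMap.apply ℝ ℝ w).hasFDerivAt.comp_hasFDerivWithinAt _
      h3).fderivWithin (uniqueDiffOn_halfPlane _ hy)
    rw [(hasFDerivWithinAt_chartForm ha hh).fderivWithin (uniqueDiffOn_halfPlane _ hy)]
    exact DFunLike.congr_fun h7 v
  have h8 : ∀ v w : Plane, extDerivWithin (fun y ↦
      ContinuousAlternatingMap.ofSubsingleton ℝ Plane ℝ (0 : Fin 1) (coordForm α x y)) halfPlane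
        (chartMap (chart x) x) ![v, w] = areaSum a h x * (v 0 * w 1 - v 1 * w 0) := by
    intro v w
    rw [extDerivWithin_apply h5 (uniqueDiffOn_halfPlane _ hy), ← fderivWithin_chartForm_sub ha hh,
      Fin.sum_univ_two, ← h6, ← h6, sub_eq_add_neg]
    simp [Fin.removeNth]
  have h9 : extD α x v w = extDerivWithin (fun y ↦
      ContinuousAlternatingMap.ofSubsingleton ℝ Plane ℝ (0 : Fin 1) (coordForm α x y)) halfPlane
        (chartMap (chart x) x) ![v, w] := by
    rw [extD, hid, hid]
    rfl
  exact h9.trans ((h8 v w).trans (areaSum_mul ..).symm)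

end Forms

/-! ### Presenting 1-forms as sums, and orientation -/

section Presentation

variable {M : Type*} [TopologicalSpace M] [ChartedSpace (EuclideanHalfSpace 2) M]
  [IsManifold HalfPlaneModel ∞ M]

/-- The coefficients of a smooth 1-form in a chart are smooth. -/
theorem IsSmoothForm.contMDiffAt_coeff {α : OneForm M} (hα : IsSmoothForm α) {x z : M}
    (hz : z ∈ (chart x).source) (e : Plane) : ContMDiffAt HalfPlaneModel 𝓘(ℝ, ℝ) ∞
      (fun z ↦ α z (tangentCoordChange HalfPlaneModel x z z e)) z := by
  have h1 : ContMDiffAt HalfPlaneModel (HalfPlaneModel.prod 𝓘(ℝ, Plane →L[ℝ] Plane)) ∞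
      (fun m ↦ Bundle.TotalSpace.mk' (Plane →L[ℝ] Plane)
        (E := fun m : M ↦ Bundle.Trivial M Plane m →L[ℝ] TangentSpace HalfPlaneModel m) m
        ((trivializationAt Plane (TangentSpace HalfPlaneModel (M := M)) x).symmL ℝ m)) z :=
    Bundle.Trivialization.contMDiffAt_symmL (IB := HalfPlaneModel) (n := ∞)
      (trivializationAt Plane (TangentSpace HalfPlaneModel (M := M)) x) hz
  have h2 : ContMDiffAt HalfPlaneModel (HalfPlaneModel.prod 𝓘(ℝ, Plane)) ∞
      (fun m ↦ Bundle.TotalSpace.mk' Plane (E := Bundle.Trivial M Plane) m e) z := by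
    rw [Bundle.contMDiffAt_section]
    exact contMDiffAt_const
  have h3 := h1.clm_bundle_apply h2
  have h4 := (hα z).clm_bundle_apply h3
  rw [Bundle.contMDiffAt_section] at h4
  refine h4.congr_of_eventuallyEq ?_
  filter_upwards [(chart x).open_source.mem_nhds hz] with w hw
  have h5 := TangentBundle.symmL_trivializationAt_eq_core (I := HalfPlaneModel) hw
  exact congrArg (α w) (DFunLike.congr_fun h5 e).symm

/-- A smooth 1-form on the compact surface is a finite sum of products of smooth functions and
differentials of smooth functions. -/
theorem IsSmoothForm.exists_formSum [T2Space M] [CompactSpace M] {α : OneForm M}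
    (hα : IsSmoothForm α) : ∃ (ι : Type) (_ : Fintype ι) (a h : ι → M → ℝ),
      (∀ i, SmoothFun (a i)) ∧ (∀ i, SmoothFun (h i)) ∧
      ∀ (x : M) (v : TangentSpace HalfPlaneModel x), α x v = formSum a h x v := by
  obtain ⟨B⟩ := nonempty_bumpCover M
  refine ⟨Fin B.size × Fin 2, inferInstance, fun i x ↦ B.part i.1 x *
    α x (tangentCoordChange HalfPlaneModel (B.center i.1) x x (EuclideanSpace.single i.2 1)),
    fun i ↦ B.coord (i.1, some i.2), fun i x ↦ ?_, fun i ↦ B.smooth_coordinate _, fun x v ↦ ?_⟩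
  · by_cases hx : x ∈ (chart (B.center i.1)).source
    · exact (B.smooth_part i.1 x).mul (hα.contMDiffAt_coeff hx _)
    · refine (contMDiffAt_const (c := (0 : ℝ))).congr_of_eventuallyEq ?_
      filter_upwards [(isClosed_tsupport _).isOpen_compl.mem_nhds
        fun h ↦ hx (B.tsupport_bump i.1 h)] with z hz
      have hz' : B.part i.1 z = 0 := by
        by_contra h
        have := (B.bump_eq_one i.1 z h).self_of_nhds
        rw [image_eq_zero_of_notMem_tsupport hz] at this
        exact zero_ne_one this
      simp [hz']
  · have key : ∀ k, ∑ l, B.part k x *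
        α x (tangentCoordChange HalfPlaneModel (B.center k) x x (EuclideanSpace.single l 1)) *
          coDeriv (B.coord (k, some l)) x v = B.part k x * α x v := by
      intro k
      by_cases hk : B.part k x = 0
      · simp [hk]
      · have hsrc := B.mem_source_of_part hk
        have h1 : ∀ l, coDeriv (B.coord (k, some l)) x v =
            (tangentCoordChange HalfPlaneModel x (B.center k) x v : Plane) l := by
          intro l
          rw [coDeriv_congr (v := fun z ↦ chartMap (chart (B.center k)) z l)]
          · exact coDeriv_chartMap (chart_mem _) hsrc l v
          · filter_upwards [B.bump_eq_one k x hk] with z hz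
            simp [BumpCover.coord, hz]
        have h2 : tangentCoordChange HalfPlaneModel (B.center k) x x
            (tangentCoordChange HalfPlaneModel x (B.center k) x v) = v := by
          refine (tangentCoordChange_comp ?_).trans (tangentCoordChange_self ?_)
          · simp only [extChartAt_source]
            exact ⟨⟨mem_source x, hsrc⟩, mem_source x⟩
          · rw [extChartAt_source]
            exact mem_source x
        have h3 : ∀ w : Plane, α x (tangentCoordChange HalfPlaneModel (B.center k) x x w) =
            ∑ l, w l * α x (tangentCoordChange HalfPlaneModel (B.center k) x x
              (EuclideanSpace.single l 1)) := by
          intro w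
          let L : Plane →L[ℝ] ℝ := ContinuousLinearMap.comp (α x)
            (tangentCoordChange HalfPlaneModel (B.center k) x x)
          rw [Fin.sum_univ_two]
          exact covector_apply L w
        have h4 := h3 (tangentCoordChange HalfPlaneModel x (B.center k) x v)
        rw [h2] at h4
        rw [h4, Finset.mul_sum]
        refine Finset.sum_congr rfl fun l _ ↦ ?_
        rw [h1]
        ring
    have h5 : α x v = ∑ k, B.part k x * α x v := by
      rw [← Finset.sum_mul, B.sum_part, one_mul]
    rw [h5]
    refine Eq.trans ?_ (formSum_apply ..).symm
    rw [Fintype.sum_prod_type]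
    exact Finset.sum_congr rfl fun k _ ↦ (key k).symm

end Presentation

section Orientation

variable {M : Type*} [TopologicalSpace M] [ChartedSpace (EuclideanHalfSpace 2) M]
  [IsManifold HalfPlaneModel ∞ M] {ι : Type} [Fintype ι] {α : OneForm M} {a h : ι → M → ℝ}

variable (ha : ∀ i, SmoothFun (a i)) (hh : ∀ i, SmoothFun (h i))
  (hα : ∀ (x : M) (v : TangentSpace HalfPlaneModel x), α x v = formSum a h x v)

include ha hh hα

theorem extD_eq_areaSum (x : M) (v w : Plane) :
    extD α x v w = areaSum a h x * (v 0 * w 1 - v 1 * w 0) :=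
  (extD_eq ha hh hα x v w).trans (areaSum_mul ..)

theorem areaSum_ne_zero
    (hnd : ∀ (x : M) (v : TangentSpace HalfPlaneModel x), v ≠ 0 → ∃ w, extD α x v w ≠ 0) (x : M) :
    areaSum a h x ≠ 0 := by
  have h0 : (EuclideanSpace.single 0 1 : Plane) ≠ 0 := by
    intro h
    have := congrArg (fun v : Plane ↦ v 0) h
    simp at this
  obtain ⟨w, hw⟩ := hnd x (EuclideanSpace.single 0 1 : Plane) h0
  exact left_ne_zero_of_mul (ne_of_eq_of_ne (extD_eq_areaSum ha hh hα x _ w).symm hw)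

theorem extD_mfderiv (φ : Diffeo M) (x : M) (v w : Plane) :
    extD α (φ x) (mfderiv HalfPlaneModel HalfPlaneModel φ x v)
      (mfderiv HalfPlaneModel HalfPlaneModel φ x w) =
      areaSum (fun i z ↦ a i (φ z)) (fun i z ↦ h i (φ z)) x * (v 0 * w 1 - v 1 * w 0) := by
  refine (extD_eq ha hh hα _ _ _).trans (Eq.trans ?_ (areaSum_mul ..))
  refine Finset.sum_congr rfl fun i _ ↦ ?_
  have h1 := fun v : Plane ↦ coDeriv_comp (φ.contMDiff x) (ha i (φ x)) v
  have h2 := fun v : Plane ↦ coDeriv_comp (φ.contMDiff x) (hh i (φ x)) v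
  rw [← h1, ← h1, ← h2, ← h2]

theorem pullback_apply_eq (φ : Diffeo M) (x : M) (v : Plane) :
    pullback φ α x v = formSum (fun i z ↦ a i (φ z)) (fun i z ↦ h i (φ z)) x v := by
  refine (hα _ _).trans ((formSum_apply ..).trans (Eq.trans ?_ (formSum_apply ..).symm))
  refine Finset.sum_congr rfl fun i _ ↦ ?_
  exact congrArg (a i (φ x) * ·) (coDeriv_comp (φ.contMDiff x) (hh i (φ x)) v).symm

theorem areaSum_comp_ne_zero (hne : ∀ x, areaSum a h x ≠ 0) (φ : Diffeo M) (x : M) :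
    areaSum (fun i z ↦ a i (φ z)) (fun i z ↦ h i (φ z)) x ≠ 0 := by
  have hsurj : ∀ v : Plane, ∃ v' : Plane, mfderiv HalfPlaneModel HalfPlaneModel φ x v' = v := by
    intro v
    exact (φ.mfderivToContinuousLinearEquiv (by simp) x).surjective v
  obtain ⟨v, hv⟩ := hsurj (EuclideanSpace.single 0 1)
  obtain ⟨w, hw⟩ := hsurj (EuclideanSpace.single 1 1)
  have h1 := extD_mfderiv ha hh hα φ x v w
  rw [hv, hw, extD_eq_areaSum ha hh hα] at h1
  intro h0
  rw [h0, zero_mul] at h1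
  simp [hne] at h1

theorem isOrientationPreserving_iff (hne : ∀ x, areaSum a h x ≠ 0) (φ : Diffeo M) :
    IsOrientationPreserving α φ ↔
      ∀ x, 0 < areaSum (fun i z ↦ a i (φ z)) (fun i z ↦ h i (φ z)) x / areaSum a h x := by
  constructor
  · intro hφ x
    have h1 := hφ x (EuclideanSpace.single 0 1 : Plane)
      (areaSum a h x • EuclideanSpace.single 1 1 : Plane)
    rw [extD_mfderiv ha hh hα, extD_eq_areaSum ha hh hα] at h1
    have h2 : 0 < areaSum a h x * areaSum a h x := mul_self_pos.2 (hne x)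
    simp only [PiLp.smul_apply, PiLp.single_apply, smul_eq_mul] at h1
    simp at h1
    have h3 := h1 (hne x)
    rw [div_eq_mul_inv, ← mul_inv_cancel_right₀ (hne x) (areaSum (fun i z ↦ a i (φ z)) _ x)]
    have h4 : 0 < (areaSum a h x)⁻¹ * (areaSum a h x)⁻¹ :=
      mul_self_pos.2 (inv_ne_zero (hne x))
    rw [mul_assoc]
    exact mul_pos h3 h4
  · intro hφ x v w hvw
    have h1 : extD α x v w = areaSum a h x * _ := extD_eq_areaSum ha hh hα x v w
    have h2 := extD_mfderiv ha hh hα φ x v w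
    rw [h1] at hvw
    refine lt_of_lt_of_eq ?_ h2.symm
    have h3 := mul_pos (hφ x) hvw
    rwa [← mul_assoc, div_mul_cancel₀ _ (hne x)] at h3

/-- Exact symplectomorphisms preserve the area form. -/
theorem IsExactSymplectomorphism.areaSum_comp {φ : Diffeo M} (hφ : IsExactSymplectomorphism α φ)
    (x : M) : areaSum (fun i z ↦ a i (φ z)) (fun i z ↦ h i (φ z)) x = areaSum a h x := by
  obtain ⟨F, hF, hFα⟩ := hφ
  refine areaSum_eq_of_eventually (a := fun i z ↦ a i (φ z)) (h := fun i z ↦ h i (φ z))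
    (fun i ↦ (ha i).comp φ.contMDiff)
    (fun i ↦ (hh i).comp φ.contMDiff) ha hh hF (Eventually.of_forall fun z ↦ ?_)
  ext v
  have h1 := (hFα z v).trans (mfderiv_apply_eq_coDeriv (hF z) v)
  have h2 : (pullback φ α z - α z) v = pullback φ α z v - α z v := rfl
  rw [h2, pullback_apply_eq ha hh hα] at h1
  have h3 : α z v = formSum a h z v := hα z v
  rw [h3] at h1
  rw [add_apply, ← h1]
  ring

theorem exactC_subset_diffPlusC (hne : ∀ x, areaSum a h x ≠ 0) : exactC α ⊆ diffPlusC α := by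
  rintro φ ⟨hc, hφ⟩
  refine ⟨hc, (isOrientationPreserving_iff ha hh hα hne φ).2 fun x ↦ ?_⟩
  rw [hφ.areaSum_comp ha hh hα, div_self (hne x)]
  exact one_pos

end Orientation

/-! ### Integration along the radii of charts -/

section Boundary

variable {M : Type*} [TopologicalSpace M] [ChartedSpace (EuclideanHalfSpace 2) M]
  [IsManifold HalfPlaneModel ∞ M]

theorem mem_boundary_iff {x p : M} (hx : x ∈ (chart p).source) :
    x ∈ HalfPlaneModel.boundary M ↔ chartMap (chart p) x 0 = 0 := by
  have h1 : chartMap (chart p) x 0 = 0 ↔ chartMap (chart p) x ∈ frontier halfPlane := by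
    rw [frontier_range_modelWithCornersEuclideanHalfSpace]
    exact eq_comm
  rw [h1]
  constructor
  · intro h
    have h2 := (HalfPlaneModel.isBoundaryPoint_iff_of_mem_atlas (n := ∞) (by simp)
      (chart_mem_atlas _ p) hx).1 h
    refine ⟨subset_closure chartMap_mem_halfPlane, fun h3 ↦ h2.2 ?_⟩
    rw [mem_interior_iff_mem_nhds] at h3 ⊢
    have h4 := chartTarget_mem_nhdsWithin (chartMap_mem_target hx)
    rwa [nhdsWithin_eq_nhds.2 h3] at h4
  · intro h
    have h2 := mem_boundary_of_mem_frontier (chartMap_mem_target hx) h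
    rwa [chartInv_chartMap hx] at h2

/-- A radius of a ball in the preferred chart at each point, which for interior points does not
meet the boundary. -/
theorem exists_chart_radius (p : M) : ∃ ε > 0,
    Metric.ball (chartMap (chart p) p) ε ∩ halfPlane ⊆ chartTarget (chart p) ∧
    (p ∉ HalfPlaneModel.boundary M →
      ∀ y ∈ Metric.ball (chartMap (chart p) p) ε, y ∈ halfPlane → y 0 ≠ 0) := by
  obtain ⟨ε, hε, h1⟩ := Metric.mem_nhdsWithin_iff.1
    (chartTarget_mem_nhdsWithin (chartMap_mem_target (mem_source p)))
  by_cases hp : p ∈ HalfPlaneModel.boundary M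
  · exact ⟨ε, hε, h1, fun h ↦ absurd hp h⟩
  · have h2 : {y : Plane | y 0 ≠ 0} ∈ 𝓝 (chartMap (chart p) p) := by
      refine IsOpen.mem_nhds ?_ fun h ↦ hp ((mem_boundary_iff (mem_source p)).2 h)
      exact isOpen_ne_fun (EuclideanSpace.proj (0 : Fin 2) : Plane →L[ℝ] ℝ).continuous
        continuous_const
    obtain ⟨δ, hδ, h3⟩ := Metric.mem_nhds_iff.1 h2
    exact ⟨min ε δ, lt_min hε hδ, fun y hy ↦ h1
      ⟨Metric.ball_subset_ball (min_le_left _ _) hy.1, hy.2⟩,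
      fun _ y hy _ ↦ h3 (Metric.ball_subset_ball (min_le_right _ _) hy)⟩

/-- The radius given by `exists_chart_radius`. -/
def chartRadius (p : M) : ℝ := (exists_chart_radius p).choose

/-- A round neighbourhood of `p` in its preferred chart. -/
def chartDisc (p : M) : Set M :=
  (chart p).source ∩ chartMap (chart p) ⁻¹' Metric.ball (chartMap (chart p) p) (chartRadius p)

theorem chartRadius_pos (p : M) : 0 < chartRadius p := (exists_chart_radius p).choose_spec.1

theorem isOpen_chartDisc (p : M) : IsOpen (chartDisc p) :=
  continuousOn_chartMap.isOpen_inter_preimage (chart p).open_source Metric.isOpen_ball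

theorem mem_chartDisc_self (p : M) : p ∈ chartDisc p :=
  ⟨mem_source p, Metric.mem_ball_self (chartRadius_pos p)⟩

theorem mem_boundary_of_mem_chartDisc {p x : M} (hx : x ∈ chartDisc p)
    (h : x ∈ HalfPlaneModel.boundary M) : p ∈ HalfPlaneModel.boundary M := by
  by_contra hp
  exact (exists_chart_radius p).choose_spec.2.2 hp _ hx.2 chartMap_mem_halfPlane
    ((mem_boundary_iff hx.1).1 h)

/-- The points of the segment from the centre of the chart at `p`. -/
theorem segment_mem_target {p : M} {y : Plane} (hy : y ∈ halfPlane)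
    (hyb : y ∈ Metric.ball (chartMap (chart p) p) (chartRadius p)) {s : ℝ}
    (hs : s ∈ Icc (0 : ℝ) 1) : chartMap (chart p) p + s • (y - chartMap (chart p) p) ∈
      chartTarget (chart p) := by
  have h1 := (convex_ball (chartMap (chart p) p) (chartRadius p)).add_smul_sub_mem
    (Metric.mem_ball_self (chartRadius_pos p)) hyb hs
  have h2 := HalfPlaneModel.convex_range.add_smul_sub_mem
    (chartMap_mem_halfPlane (c := chart p) (x := p)) hy hs
  exact (exists_chart_radius p).choose_spec.2.1 ⟨h1, h2⟩

end Boundary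

section Radial

variable {M : Type*} [TopologicalSpace M] [ChartedSpace (EuclideanHalfSpace 2) M]
  [IsManifold HalfPlaneModel ∞ M] {P : Type*} [TopologicalSpace P] {κ : Type} [Fintype κ]

/-- The integral of the 1-form `∑ a i d(h i)` along the segment from `p` to `z`, in the preferred
chart at `p`. -/
def radialIntegral (p : M) (a h : κ → M → ℝ) (z : M) : ℝ :=
  ∫ s in (0 : ℝ)..1, chartForm p a h
    (chartMap (chart p) p + s • (chartMap (chart p) z - chartMap (chart p) p))
      (chartMap (chart p) z - chartMap (chart p) p)

variable {A K : κ → P → M → ℝ}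

theorem famOn_chartForm (hA : ∀ i, FamM (A i)) (hK : ∀ i, FamM (K i)) (p : M) (n : ℕ) :
    FamOn halfPlane (univ ×ˢ chartTarget (chart p)) n
      fun φ ↦ chartForm p (fun i ↦ A i φ) (fun i ↦ K i φ) := by
  have hd : FamDomain halfPlane (univ ×ˢ chartTarget (chart p) : Set (P × Plane)) :=
    .prod uniqueDiffOn_halfPlane chartTarget_subset fun y hy ↦ chartTarget_mem_nhdsWithin hy
  have hsub : (univ ×ˢ chartTarget (chart p) : Set (P × Plane)) ⊆ coordDomain (chart p) univ :=
    fun z hz ↦ ⟨hz.2, mem_univ _⟩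
  refine FamOn.sum hd fun i _ ↦ FamOn.smul hd ?_ ?_
  · exact (hA i _ (chart_mem p) n).mono hsub
  · exact ((hK i).chartDeriv (chart_mem p) n).mono hsub

theorem famMOn_radialIntegral (hA : ∀ i, FamM (A i)) (hK : ∀ i, FamM (K i)) (p : M) :
    FamMOn (univ ×ˢ chartDisc p : Set (P × M))
      fun φ ↦ radialIntegral p (fun i ↦ A i φ) (fun i ↦ K i φ) := by
  have hW : IsOpen (univ ×ˢ chartDisc p : Set (P × M)) := isOpen_univ.prod (isOpen_chartDisc p)
  refine FamMOn.of_chart (chart_mem p) hW (fun z hz ↦ hz.2.1) fun n ↦ ?_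
  have hd := famDomain_coordDomain (chart p) hW
  have hT := hd.timeDomain 0 1
  have hball : ∀ z ∈ coordDomain (chart p) (univ ×ˢ chartDisc p : Set (P × M)),
      z.2 ∈ Metric.ball (chartMap (chart p) p) (chartRadius p) := fun z hz ↦ by
    have := hz.2.2.2
    rwa [mem_preimage, chartMap_chartInv hz.1] at this
  set y₀ := chartMap (chart p) p with hy₀
  have h1 : FamOn halfPlane (timeDomain (coordDomain (chart p)
      (univ ×ˢ chartDisc p : Set (P × M))) 0 1) n fun _ y ↦ y - y₀ :=
    .of_contDiff hT (contDiff_id.sub contDiff_const)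
  have h2 : FamOn halfPlane (timeDomain (coordDomain (chart p)
      (univ ×ˢ chartDisc p : Set (P × M))) 0 1) n fun (q : P × ℝ) y ↦ y₀ + q.2 • (y - y₀) :=
    (FamOn.of_contDiff hT contDiff_const).add hT
      ((FamOn.of_param hT (by fun_prop)).smul hT h1)
  have h3 : FamOn halfPlane (timeDomain (coordDomain (chart p)
      (univ ×ˢ chartDisc p : Set (P × M))) 0 1) n fun (q : P × ℝ) y ↦
        chartForm p (fun i ↦ A i q.1) (fun i ↦ K i q.1) (y₀ + q.2 • (y - y₀)) := by
    have h4 := (famOn_chartForm hA hK p n).param (θ := fun q : P × ℝ ↦ q.1)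
      (Ω' := univ ×ˢ chartTarget (chart p)) (by fun_prop) (fun z hz ↦ ⟨mem_univ _, hz.2⟩)
    refine h4.comp hT h2 (fun z hz ↦ ⟨mem_univ _, ?_⟩) fun z hz ↦ ?_
    · exact segment_mem_target (chartTarget_subset hz.1.1) (hball _ hz.1) hz.2
    · filter_upwards [self_mem_nhdsWithin] with y hy
      exact HalfPlaneModel.convex_range.add_smul_sub_mem chartMap_mem_halfPlane hy hz.2
  have h5 := h3.bilin hT (ContinuousLinearMap.id ℝ (Plane →L[ℝ] ℝ)) h1
  refine (FamOn.integral HalfPlaneModel.convex_range hd zero_le_one h5).congr hd fun z hz ↦ ?_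
  simp only [radialIntegral]
  rw [chartMap_chartInv hz.1]
  rfl

/-- The radial integral of an exact form. -/
theorem radialIntegral_eq_sub {a h : κ → M → ℝ} (ha : ∀ i, SmoothFun (a i))
    (hh : ∀ i, SmoothFun (h i)) {F : M → ℝ} (hF : SmoothFun F)
    (hFa : ∀ x, formSum a h x = coDeriv F x) {p z : M} (hz : z ∈ chartDisc p) :
    radialIntegral p a h z = F z - F p := by
  set c := chart p
  set y₀ := chartMap c p
  set y := chartMap c z
  have hmem : ∀ s ∈ Icc (0 : ℝ) 1, y₀ + s • (y - y₀) ∈ chartTarget c := fun s hs ↦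
    segment_mem_target chartMap_mem_halfPlane hz.2 hs
  have hform : ∀ w ∈ chartTarget c, chartForm p a h w = fderivWithin ℝ (F ∘ chartInv c) halfPlane w := by
    intro w hw
    rw [chartForm_eq hh hw, hFa, ← chartDeriv_eq (hF _) (chartInv_mem_source hw),
      chartMap_chartInv hw]
    rfl
  have hderiv : ∀ s ∈ Icc (0 : ℝ) 1, HasDerivWithinAt (fun s : ℝ ↦ F (chartInv c (y₀ + s • (y - y₀))))
      (chartForm p a h (y₀ + s • (y - y₀)) (y - y₀)) (Icc 0 1) s := by
    intro s hs
    rw [hform _ (hmem s hs)]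
    have h1 : HasFDerivWithinAt (F ∘ chartInv c) (fderivWithin ℝ (F ∘ chartInv c) halfPlane
        (y₀ + s • (y - y₀))) halfPlane (y₀ + s • (y - y₀)) :=
      ((contDiffWithinAt_comp_chartInv (chart_mem p) (hmem s hs) (hF _)).differentiableWithinAt
        (by simp)).hasFDerivWithinAt
    have h2 : HasDerivWithinAt (fun s : ℝ ↦ y₀ + s • (y - y₀)) (y - y₀) (Icc 0 1) s := by
      simpa using ((hasDerivWithinAt_id s (Icc 0 1)).smul_const (y - y₀)).const_add y₀
    exact h1.comp_hasDerivWithinAt s h2 fun s hs ↦ chartTarget_subset (hmem s hs)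
  have hcont : ContinuousOn (fun s : ℝ ↦ chartForm p a h (y₀ + s • (y - y₀)) (y - y₀))
      (Icc 0 1) := by
    have h1 := (famOn_chartForm (P := Unit) (A := fun i _ ↦ a i) (K := fun i _ ↦ h i)
      (fun i ↦ .of_contMDiff (ha i)) (fun i ↦ .of_contMDiff (hh i)) p 0).continuousOn
    have h2 := h1.comp (f := fun s : ℝ ↦ ((), y₀ + s • (y - y₀))) (s := Icc 0 1) (by fun_prop)
      fun s hs ↦ ⟨mem_univ _, hmem s hs⟩
    exact h2.clm_apply continuousOn_const
  have h1 := intervalIntegral.integral_eq_sub_of_hasDerivAt_of_le zero_le_one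
    (fun s hs ↦ (hderiv s hs).continuousWithinAt)
    (fun s hs ↦ (hderiv s (Ioo_subset_Icc_self hs)).hasDerivAt (Icc_mem_nhds hs.1 hs.2))
    (hcont.intervalIntegrable_of_Icc zero_le_one)
  rw [radialIntegral, h1]
  simp only [one_smul, zero_smul, add_zero, add_sub_cancel]
  rw [chartInv_chartMap hz.1, chartInv_chartMap (mem_source p)]

/-- Segments between boundary points run in the boundary, near which the form vanishes. -/
theorem radialIntegral_eventually_eq_zero {a h : κ → M → ℝ} (hh : ∀ i, SmoothFun (h i))
    (h0 : ∀ x ∈ HalfPlaneModel.boundary M, ∀ᶠ z in 𝓝 x, formSum a h z = 0) {p x : M}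
    (hx : x ∈ chartDisc p) (hxb : x ∈ HalfPlaneModel.boundary M) :
    ∀ᶠ z in 𝓝 x, radialIntegral p a h z = 0 := by
  have hpb := mem_boundary_of_mem_chartDisc hx hxb
  set c := chart p
  set y₀ := chartMap c p
  have key : ∀ᶠ z in 𝓝 x, ∀ s ∈ Icc (0 : ℝ) 1,
      chartForm p a h (y₀ + clamp s • (chartMap c z - y₀)) = 0 := by
    refine isCompact_Icc.eventually_forall_of_forall_eventually fun s hs ↦ ?_
    have hcl := clamp_mem s
    have hmem := segment_mem_target (p := p) chartMap_mem_halfPlane hx.2 hcl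
    have hb : chartInv c (y₀ + clamp s • (chartMap c x - y₀)) ∈ HalfPlaneModel.boundary M := by
      rw [mem_boundary_iff (chartInv_mem_source hmem), chartMap_chartInv hmem]
      have e1 : chartMap (chart p) p 0 = 0 := (mem_boundary_iff (mem_source p)).1 hpb
      have e2 : chartMap (chart p) x 0 = 0 := (mem_boundary_iff hx.1).1 hxb
      simp [e1, e2]
    have h1 : ∀ᶠ y in 𝓝[halfPlane] (y₀ + clamp s • (chartMap c x - y₀)), chartForm p a h y = 0 := by
      filter_upwards [(continuousWithinAt_chartInv hmem).eventually (h0 _ hb),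
        chartTarget_mem_nhdsWithin hmem] with y hy hyt
      rw [chartForm_eq hh hyt, hy, ContinuousLinearMap.zero_comp]
    refine Tendsto.eventually (f := fun w : M × ℝ ↦ y₀ + clamp w.2 • (chartMap c w.1 - y₀)) ?_ h1
    refine tendsto_nhdsWithin_iff.2 ⟨?_, Eventually.of_forall fun w ↦
      HalfPlaneModel.convex_range.add_smul_sub_mem chartMap_mem_halfPlane
        chartMap_mem_halfPlane (clamp_mem _)⟩
    have h2 : ContinuousAt (chartMap c) x :=
      continuousOn_chartMap.continuousAt ((chart p).open_source.mem_nhds hx.1)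
    have h3 : ContinuousAt (fun w : M × ℝ ↦ chartMap c w.1) (x, s) :=
      ContinuousAt.comp (f := Prod.fst) (x := (x, s)) h2 continuousAt_fst
    exact continuousAt_const.add ((continuous_clamp.comp continuous_snd).continuousAt.smul
      (h3.sub continuousAt_const))
  filter_upwards [key] with z hz
  rw [radialIntegral, intervalIntegral.integral_congr (g := fun _ ↦ (0 : ℝ))]
  · simp
  · intro s hs
    rw [uIcc_of_le zero_le_one] at hs
    have := hz s hs
    rw [clamp_of_mem hs] at this
    simp only
    rw [this]
    rfl

end Radial

/-! ### Primitives of families of 1-forms -/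

section Primitive

variable {M : Type*} [TopologicalSpace M] [ChartedSpace (EuclideanHalfSpace 2) M]
  [IsManifold HalfPlaneModel ∞ M] {P : Type*} [TopologicalSpace P] {κ : Type} [Fintype κ]

/-- `F` is a primitive of the member `φ` of the family of 1-forms `∑ A i d(K i)`. -/
def IsPrimitive (A K : κ → P → M → ℝ) (φ : P) (F : M → ℝ) : Prop :=
  SmoothFun F ∧ ∀ x, formSum (fun i ↦ A i φ) (fun i ↦ K i φ) x = coDeriv F x

/-- The points `x` and `y` are related if the difference of the values there of a primitive of a
member of the family, whenever one exists, is a continuous function of the parameter. -/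
def primitiveSetoid (A K : κ → P → M → ℝ) : Setoid M where
  r x y := ∃ l : P → ℝ, Continuous l ∧ ∀ φ F, IsPrimitive A K φ F → F y - F x = l φ
  iseqv :=
    { refl := fun x ↦ ⟨fun _ ↦ 0, continuous_const, fun φ F _ ↦ sub_self _⟩
      symm := fun ⟨l, hl, h⟩ ↦ ⟨fun φ ↦ -l φ, hl.neg, fun φ F hF ↦ by
        linarith [h φ F hF]⟩
      trans := fun ⟨l, hl, h⟩ ⟨l', hl', h'⟩ ↦ ⟨fun φ ↦ l φ + l' φ, hl.add hl', fun φ F hF ↦ by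
        linarith [h φ F hF, h' φ F hF]⟩ }

/-- The relation that moreover all primitives have the same value at `x` and `y`. -/
def levelSetoid (A K : κ → P → M → ℝ) : Setoid M where
  r x y := primitiveSetoid A K x y ∧ ∀ φ F, IsPrimitive A K φ F → F x = F y
  iseqv :=
    { refl := fun x ↦ ⟨Setoid.refl' _ x, fun _ _ _ ↦ rfl⟩
      symm := fun ⟨h, h'⟩ ↦ ⟨Setoid.symm' _ h, fun φ F hF ↦ (h' φ F hF).symm⟩
      trans := fun ⟨h, h'⟩ ⟨k, k'⟩ ↦
        ⟨Setoid.trans' _ h k, fun φ F hF ↦ (h' φ F hF).trans (k' φ F hF)⟩ }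

variable {A K : κ → P → M → ℝ}

theorem primitiveSetoid_of_mem_chartDisc (hA : ∀ i, FamM (A i)) (hK : ∀ i, FamM (K i)) {p x : M}
    (hx : x ∈ chartDisc p) : primitiveSetoid A K p x := by
  refine ⟨fun φ ↦ radialIntegral p (fun i ↦ A i φ) (fun i ↦ K i φ) x, ?_, fun φ F hF ↦ ?_⟩
  · exact ((famMOn_radialIntegral hA hK p).continuousOn
      (isOpen_univ.prod (isOpen_chartDisc p))).comp_continuous (f := fun φ ↦ (φ, x)) (by fun_prop)
      fun φ ↦ ⟨mem_univ _, hx⟩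
  · exact (radialIntegral_eq_sub (fun i ↦ (hA i).contMDiff φ) (fun i ↦ (hK i).contMDiff φ) hF.1
      hF.2 hx).symm

theorem levelSetoid_of_mem_boundary (hA : ∀ i, FamM (A i)) (hK : ∀ i, FamM (K i))
    (h0 : ∀ φ, ∀ x ∈ HalfPlaneModel.boundary M,
      ∀ᶠ z in 𝓝 x, formSum (fun i ↦ A i φ) (fun i ↦ K i φ) z = 0) {p x : M}
    (hx : x ∈ chartDisc p) (hxb : x ∈ HalfPlaneModel.boundary M) : levelSetoid A K p x := by
  refine ⟨primitiveSetoid_of_mem_chartDisc hA hK hx, fun φ F hF ↦ ?_⟩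
  have h1 := radialIntegral_eq_sub (fun i ↦ (hA i).contMDiff φ) (fun i ↦ (hK i).contMDiff φ) hF.1
    hF.2 hx
  rw [(radialIntegral_eventually_eq_zero (fun i ↦ (hK i).contMDiff φ) (h0 φ) hx
    hxb).self_of_nhds] at h1
  linarith

/-- Multiplication by a cutoff function extends a family from an open set. -/
theorem FamMOn.cutoff {U : Set M} (hU : IsOpen U) {u : P → M → ℝ}
    (hu : FamMOn (univ ×ˢ U : Set (P × M)) u) {χ : M → ℝ} (hχ : SmoothFun χ)
    (hχU : tsupport χ ⊆ U) : FamM fun φ x ↦ χ x * u φ x := by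
  refine FamMOn.of_local fun z _ ↦ ?_
  by_cases hz : z.2 ∈ U
  · refine ⟨univ ×ˢ U, isOpen_univ.prod hU, ⟨mem_univ _, hz⟩, ?_⟩
    exact FamMOn.mul (isOpen_univ.prod hU) (.of_contMDiffAt (isOpen_univ.prod hU)
      fun z _ ↦ hχ z.2) hu
  · have hV : IsOpen (univ ×ˢ (tsupport χ)ᶜ : Set (P × M)) :=
      isOpen_univ.prod (isClosed_tsupport χ).isOpen_compl
    refine ⟨univ ×ˢ (tsupport χ)ᶜ, hV, ⟨mem_univ _, fun h ↦ hz (hχU h)⟩, ?_⟩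
    refine (FamMOn.of_contMDiffAt hV (u := fun _ ↦ (0 : ℝ)) fun _ _ ↦ contMDiffAt_const).congr hV
      fun w hw ↦ ?_
    rw [image_eq_zero_of_notMem_tsupport hw.2, zero_mul]

/-- A family of functions `G φ` that depends on the parameter with all derivatives, is locally
constant near the boundary, and is a primitive of the family of 1-forms `∑ A i d(K i)` wherever
a primitive exists. The radial primitives in finitely many discs are glued by a partition of unity;
the constants of integration are chosen along the classes of `primitiveSetoid`, which are open,
and along those of `levelSetoid`, which connect nearby boundary points. -/
theorem exists_primitive_family [T2Space M] [CompactSpace M] (hA : ∀ i, FamM (A i))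
    (hK : ∀ i, FamM (K i)) (h0 : ∀ φ, ∀ x ∈ HalfPlaneModel.boundary M,
      ∀ᶠ z in 𝓝 x, formSum (fun i ↦ A i φ) (fun i ↦ K i φ) z = 0) :
    ∃ G : P → M → ℝ, FamM G ∧
      (∀ φ, ∀ x ∈ HalfPlaneModel.boundary M, ∀ᶠ z in 𝓝 x, coDeriv (G φ) z = 0) ∧
      ∀ φ F, IsPrimitive A K φ F → IsPrimitive A K φ (G φ) := by
  obtain ⟨n, p, χ, hχ, hsum, hsupp⟩ := exists_smooth_partition (isOpen_chartDisc (M := M))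
    mem_chartDisc_self
  let r : M → M := fun x ↦ (Quotient.mk (primitiveSetoid A K) x).out
  let s : M → M := fun x ↦ (Quotient.mk (levelSetoid A K) x).out
  have hr : ∀ x, primitiveSetoid A K (r x) x := fun x ↦ Quotient.exact (Quotient.out_eq _)
  have hrr : ∀ {x y}, primitiveSetoid A K x y → r x = r y := fun h ↦
    congrArg Quotient.out (Quotient.sound h)
  have hs : ∀ x, levelSetoid A K (s x) x := fun x ↦ Quotient.exact (Quotient.out_eq _)
  have hss : ∀ {x y}, levelSetoid A K x y → s x = s y := fun h ↦
    congrArg Quotient.out (Quotient.sound h)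
  -- `l x φ` is the difference of the values of a primitive at `x` and at the representative `r x`.
  choose l hl hlF using hr
  set u : Fin n → P → M → ℝ := fun i φ z ↦
    radialIntegral (p i) (fun i ↦ A i φ) (fun i ↦ K i φ) z + l (s (p i)) φ with hu
  have hfam : FamM fun φ x ↦ ∑ i, χ i x * u i φ x := by
    refine FamMOn.sum isOpen_univ fun i _ ↦ FamMOn.cutoff (isOpen_chartDisc (p i)) ?_ (hχ i)
      (hsupp i)
    have hW : IsOpen (univ ×ˢ chartDisc (p i) : Set (P × M)) :=
      isOpen_univ.prod (isOpen_chartDisc _)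
    exact (famMOn_radialIntegral hA hK (p i)).add hW (.of_param hW (hl _))
  have hloc : ∀ {f : M → ℝ} {c : ℝ} {x : M}, (∀ᶠ z in 𝓝 x, f z = c) → coDeriv f x = 0 :=
    fun {f c x} h ↦ (coDeriv_congr (v := fun _ ↦ c) h).trans (coDeriv_const c x)
  refine ⟨_, hfam, fun φ x hx ↦ ?_, fun φ F hF ↦ ⟨hfam.contMDiff φ, fun x ↦ ?_⟩⟩
  -- Near a boundary point the radial integrals vanish, and the constants of the discs agree.
  · obtain ⟨c, hc⟩ : ∃ c, ∀ i, x ∈ tsupport (χ i) → l (s (p i)) φ = c := by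
      refine ⟨l (s x) φ, fun i hi ↦ ?_⟩
      rw [hss (levelSetoid_of_mem_boundary hA hK h0 (hsupp i hi) hx)]
    have h1 : ∀ᶠ z in 𝓝 x, ∀ i, χ i z * u i φ z = χ i z * c := by
      rw [eventually_all]
      intro i
      by_cases hi : x ∈ tsupport (χ i)
      · filter_upwards [radialIntegral_eventually_eq_zero (fun i ↦ (hK i).contMDiff φ) (h0 φ)
          (hsupp i hi) hx] with z hz
        simp only [hu]
        rw [hz, hc i hi, zero_add]
      · filter_upwards [(isClosed_tsupport _).isOpen_compl.mem_nhds hi] with z hz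
        rw [image_eq_zero_of_notMem_tsupport hz, zero_mul, zero_mul]
    have h2 : ∀ᶠ z in 𝓝 x, ∑ i, χ i z * u i φ z = c := by
      filter_upwards [h1] with z hz
      rw [Finset.sum_congr rfl fun i _ ↦ hz i, ← Finset.sum_mul, hsum, one_mul]
    filter_upwards [eventually_eventually_nhds.2 h2] with z hz using hloc hz
  -- If `F` is a primitive, each term of the sum is a multiple of `F - F (r x)` near `x`.
  · have h1 : ∀ᶠ z in 𝓝 x, ∑ i, χ i z * u i φ z = F z - F (r x) := by
      filter_upwards [(isOpen_chartDisc x).mem_nhds (mem_chartDisc_self x)] with z hz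
      have hrz := hrr (primitiveSetoid_of_mem_chartDisc hA hK hz)
      have h2 : ∀ i, χ i z * u i φ z = χ i z * (F z - F (r x)) := by
        intro i
        by_cases hi : χ i z = 0
        · simp [hi]
        · have hzi : z ∈ chartDisc (p i) := hsupp i (subset_tsupport _ hi)
          have h3 := hlF (s (p i)) φ F hF
          rw [(hs (p i)).2 φ F hF, hrr (hs (p i)).1,
            hrr (primitiveSetoid_of_mem_chartDisc hA hK hzi), ← hrz] at h3
          simp only [hu]
          rw [← h3, radialIntegral_eq_sub (fun i ↦ (hA i).contMDiff φ)
            (fun i ↦ (hK i).contMDiff φ) hF.1 hF.2 hzi]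
          ring
      rw [Finset.sum_congr rfl fun i _ ↦ h2 i, ← Finset.sum_mul, hsum, one_mul]
    rw [hF.2 x, coDeriv_congr h1, coDeriv_sub (hF.1 x) contMDiffAt_const, coDeriv_const, sub_zero]

end Primitive

/-! ### Moser's argument -/

section Rotation

/-- The vector of the plane that represents the covector `η ↦ wedge ξ η` on covectors. -/
def covectorRot (ξ : Plane →L[ℝ] ℝ) : Plane :=
  !₂[-ξ (EuclideanSpace.single 1 1), ξ (EuclideanSpace.single 0 1)]

theorem apply_covectorRot (ξ η : Plane →L[ℝ] ℝ) : η (covectorRot ξ) = wedge ξ η := by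
  rw [covector_apply η, wedge]
  simp only [covectorRot, PiLp.toLp_apply, Matrix.cons_val_zero, Matrix.cons_val_one]
  ring

theorem area_covectorRot (ξ : Plane →L[ℝ] ℝ) (v : Plane) :
    covectorRot ξ 0 * v 1 - covectorRot ξ 1 * v 0 = -ξ v := by
  rw [covector_apply ξ v]
  simp only [covectorRot, PiLp.toLp_apply, Matrix.cons_val_zero, Matrix.cons_val_one]
  ring

theorem wedge_sub_left (ξ ξ' η : Plane →L[ℝ] ℝ) : wedge (ξ - ξ') η = wedge ξ η - wedge ξ' η := by
  simp only [wedge, sub_apply]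
  ring

theorem wedge_smul_left (r : ℝ) (ξ η : Plane →L[ℝ] ℝ) : wedge (r • ξ) η = r * wedge ξ η := by
  simp only [wedge, smul_apply, smul_eq_mul]
  ring

theorem wedge_sum_left {ι : Type*} (s : Finset ι) (ξ : ι → Plane →L[ℝ] ℝ) (η : Plane →L[ℝ] ℝ) :
    wedge (∑ i ∈ s, ξ i) η = ∑ i ∈ s, wedge (ξ i) η := by
  simp only [wedge, sum_apply, Finset.sum_mul, Finset.sum_sub_distrib]

end Rotation

section FlowDerivative

variable {M : Type*} [TopologicalSpace M] [ChartedSpace (EuclideanHalfSpace 2) M]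
  [IsManifold HalfPlaneModel ∞ M] [T2Space M]
  {P : Type*} [TopologicalSpace P]

theorem coDeriv_const_mul {u : M → ℝ} {x : M} (hu : ContMDiffAt HalfPlaneModel 𝓘(ℝ, ℝ) ∞ u x)
    (r : ℝ) : coDeriv (fun z ↦ r * u z) x = r • coDeriv u x := by
  rw [coDeriv_mul contMDiffAt_const hu, coDeriv_const, smul_zero, add_zero]

/-- The derivative in time of the differential of a function transported by a flow. -/
theorem hasDerivWithinAt_coDeriv_flow {X : P × ℝ → M → Plane} {Ψ : P × ℝ → M → M}
    (hΨ : FamMap Ψ) (hΨ0 : ∀ p x, Ψ (p, 0) x = x)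
    (hflow : ∀ p x, IsFlowLine (fun t ↦ X (p, t)) (fun t ↦ Ψ (p, t) x)) {u : P → M → ℝ}
    (hu : ∀ p, SmoothFun (u p)) (hXu : FamM fun (q : P × ℝ) z ↦ coDeriv (u q.1) z (X q z))
    (p : P) (x : M) (v : Plane) {t : ℝ} (ht : t ∈ Icc (0 : ℝ) 1) :
    HasDerivWithinAt (fun t ↦ coDeriv (fun z ↦ u p (Ψ (p, t) z)) x v)
      (coDeriv (fun z ↦ coDeriv (u p) (Ψ (p, t) z) (X (p, t) (Ψ (p, t) z))) x v) (Icc 0 1) t := by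
  set g : P × ℝ → M → ℝ := fun q z ↦ coDeriv (u q.1) (Ψ q z) (X q (Ψ q z)) with hg
  have hgf : FamM g := hXu.comp hΨ
  have hgc : ∀ z, Continuous fun s ↦ g (p, s) z := fun z ↦
    hgf.continuous.comp (f := fun s : ℝ ↦ ((p, s), z)) (by fun_prop)
  have hkc : Continuous fun s ↦ coDeriv (g (p, s)) x v :=
    (hgf.continuous_coDeriv_apply x v).comp (f := fun s : ℝ ↦ (p, s)) (by fun_prop)
  have h1 : ∀ s ∈ Icc (0 : ℝ) 1, ∀ z, u p (Ψ (p, s) z) = u p z + ∫ r in (0 : ℝ)..s, g (p, r) z := by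
    intro s hs z
    have hsub : Icc 0 s ⊆ Icc (0 : ℝ) 1 := Icc_subset_Icc_right hs.2
    have h2 := intervalIntegral.integral_eq_sub_of_hasDerivAt_of_le hs.1
      (f := fun r ↦ u p (Ψ (p, r) z)) (f' := fun r ↦ g (p, r) z)
      (fun r hr ↦ ((hflow p z (u p) (hu p) r (hsub hr)).continuousWithinAt).mono hsub)
      (fun r hr ↦ (hflow p z (u p) (hu p) r (hsub (Ioo_subset_Icc_self hr))).hasDerivAt
        (Icc_mem_nhds hr.1 (hr.2.trans_le hs.2))) ((hgc z).intervalIntegrable _ _)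
    rw [h2]
    simp only [hΨ0]
    ring
  have h3 : ∀ s ∈ Icc (0 : ℝ) 1, coDeriv (fun z ↦ u p (Ψ (p, s) z)) x v =
      coDeriv (u p) x v + ∫ r in (0 : ℝ)..s, coDeriv (g (p, r)) x v := by
    intro s hs
    have h4 : (fun z ↦ u p (Ψ (p, s) z)) = fun z ↦ u p z + ∫ r in (0 : ℝ)..s, g (p, r) z :=
      funext (h1 s hs)
    rw [h4, coDeriv_add (hu p x) ((hgf.integral hs.1).contMDiff p x), add_apply,
      hgf.coDeriv_integral hs.1]
  have h5 := ((hkc.integral_hasStrictDerivAt 0 t).hasDerivAt.const_add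
    (coDeriv (u p) x v)).hasDerivWithinAt (s := Icc 0 1)
  exact h5.congr h3 (h3 t ht)

end FlowDerivative

section Moser

variable {M : Type*} [TopologicalSpace M] [ChartedSpace (EuclideanHalfSpace 2) M]
  [IsManifold HalfPlaneModel ∞ M] [T2Space M] [CompactSpace M]
  {P : Type*} [TopologicalSpace P] {κ : Type} [Fintype κ]

/-- Moser's argument for families of paths `λ_t = ∑ (c j + t ε j) b j d(B j)`, `0 ≤ t ≤ 1`, of
1-forms with nondegenerate differential: if near the boundary the velocity `∑ ε j b j d(B j)`
agrees with `dG`, there is a flow, fixing the points near the boundary, that pulls back `λ_1` to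
`λ_0` up to exact forms, and that is constant if the velocity is `dG` everywhere. The generating
field `X_t` is given by `dλ_t(X_t, ·) = -γ`, where `γ` is the difference of the velocity
and `dG`. -/
theorem exists_moser_flow {b B : κ → P → M → ℝ} (hb : ∀ j, FamM (b j)) (hB : ∀ j, FamM (B j))
    {c ε : κ → ℝ} {G : P → M → ℝ} (hG : FamM G)
    (hne : ∀ p x, ∀ t ∈ Icc (0 : ℝ) 1,
      areaSum (fun j z ↦ (c j + t * ε j) * b j p z) (fun j ↦ B j p) x ≠ 0)
    (hbd : ∀ p, ∀ x ∈ HalfPlaneModel.boundary M, ∀ᶠ z in 𝓝 x,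
      formSum (fun j z ↦ ε j * b j p z) (fun j ↦ B j p) z = coDeriv (G p) z) :
    ∃ Ψ : P × ℝ → Diffeo M, FamMap (fun q ↦ (Ψ q : M → M)) ∧ (∀ p x, Ψ (p, 0) x = x) ∧
      (∀ p, ∀ x, formSum (fun j z ↦ ε j * b j p z) (fun j ↦ B j p) x = coDeriv (G p) x →
        ∀ t, Ψ (p, t) x = x) ∧
      ∀ p, ∃ F, SmoothFun F ∧ ∀ x,
        formSum (fun j z ↦ (c j + ε j) * b j p (Ψ (p, 1) z)) (fun j z ↦ B j p (Ψ (p, 1) z)) x =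
          formSum (fun j z ↦ c j * b j p z) (fun j ↦ B j p) x + coDeriv F x := by
  set a : κ → P × ℝ → M → ℝ := fun j q z ↦ (c j + clamp q.2 * ε j) * b j q.1 z with ha_def
  set γ : P → M → Plane →L[ℝ] ℝ := fun p x ↦
    formSum (fun j z ↦ ε j * b j p z) (fun j ↦ B j p) x - coDeriv (G p) x with hγ_def
  have hcl := continuous_clamp
  have hB' : ∀ j, FamM fun q : P × ℝ ↦ B j q.1 := fun j ↦ (hB j).param continuous_fst
  have hb' : ∀ j, FamM fun q : P × ℝ ↦ b j q.1 := fun j ↦ (hb j).param continuous_fst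
  have hG' : FamM fun q : P × ℝ ↦ G q.1 := hG.param continuous_fst
  have hw : ∀ j, FamM fun (q : P × ℝ) (_ : M) ↦ c j + clamp q.2 * ε j := fun j ↦
    .of_param isOpen_univ (by fun_prop)
  have ha : ∀ j, FamM (a j) := fun j ↦ FamMOn.mul isOpen_univ (hw j) (hb' j)
  -- The time is clamped, because the differentials are nondegenerate on `[0, 1]` only.
  set X : P × ℝ → M → Plane := fun q x ↦
    (areaSum (fun j ↦ a j q) (fun j ↦ B j q.1) x)⁻¹ • covectorRot (γ q.1 x) with hX_def
  have hne' : ∀ (q : P × ℝ) x, areaSum (fun j ↦ a j q) (fun j ↦ B j q.1) x ≠ 0 := fun q x ↦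
    hne q.1 x _ (clamp_mem q.2)
  have hXsmooth : ∀ u : P → M → ℝ, FamM u → FamM fun (q : P × ℝ) x ↦ coDeriv (u q.1) x (X q x) := by
    intro u hu
    have hu' : FamM fun q : P × ℝ ↦ u q.1 := hu.param continuous_fst
    have h1 : FamM fun (q : P × ℝ) x ↦ (∑ j, (ε j * b j q.1 x) *
        (wedge (coDeriv (B j q.1) x) (coDeriv (u q.1) x) /
          areaSum (fun j ↦ a j q) (fun j ↦ B j q.1) x)) -
        wedge (coDeriv (G q.1) x) (coDeriv (u q.1) x) /
          areaSum (fun j ↦ a j q) (fun j ↦ B j q.1) x := by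
      refine FamMOn.sub isOpen_univ (FamMOn.sum isOpen_univ fun j _ ↦ FamMOn.mul isOpen_univ ?_ ?_)
        ?_
      · exact FamMOn.mul isOpen_univ (.of_param isOpen_univ continuous_const) (hb' j)
      · exact FamM.wedge_div (hB' j) hu' ha hB' hne'
      · exact FamM.wedge_div hG' hu' ha hB' hne'
    refine h1.congr isOpen_univ fun z _ ↦ ?_
    simp only [hX_def, hγ_def, map_smul, apply_covectorRot, wedge_sub_left, formSum,
      wedge_sum_left, wedge_smul_left, smul_eq_mul, mul_sub, Finset.mul_sum]
    refine congrArg₂ _ (Finset.sum_congr rfl fun j _ ↦ ?_) ?_ <;> ring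
  have hXzero : ∀ p x, γ p x = 0 → ∀ t, X (p, t) x = 0 := by
    intro p x h t
    have : covectorRot 0 = 0 := by
      ext i
      fin_cases i <;> simp [covectorRot]
    simp only [hX_def, h, this, smul_zero]
  have hX : IsFieldFamily X := by
    refine ⟨fun u hu ↦ hXsmooth (fun _ ↦ u) (.of_contMDiff hu), fun q x hx ↦ ?_⟩
    filter_upwards [hbd q.1 x hx] with z hz
    exact hXzero q.1 z (sub_eq_zero.2 hz) q.2
  obtain ⟨Ψ, hΨ, hΨ0, hflow, hfix⟩ := hX.exists_flow_diffeo
  refine ⟨Ψ, hΨ, hΨ0, fun p x hx ↦ hfix p x (hXzero p x (sub_eq_zero.2 hx)), fun p ↦ ?_⟩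
  set g : κ → P × ℝ → M → ℝ := fun j q z ↦ coDeriv (B j q.1) (Ψ q z) (X q (Ψ q z)) with hg_def
  have hg : ∀ j, FamM (g j) := fun j ↦ (hXsmooth _ (hB j)).comp hΨ
  have hGΨ : FamM fun (q : P × ℝ) z ↦ G q.1 (Ψ q z) := hG'.comp hΨ
  have hbΨ : ∀ j, FamM fun (q : P × ℝ) z ↦ b j q.1 (Ψ q z) := fun j ↦ (hb' j).comp hΨ
  have hBΨ : ∀ j, FamM fun (q : P × ℝ) z ↦ B j q.1 (Ψ q z) := fun j ↦ (hB' j).comp hΨ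
  -- `S` is `(G + λ_t(X_t)) ∘ Ψ_t`, whose differential is the derivative of `Ψ_t^* λ_t`.
  set S : P × ℝ → M → ℝ := fun q z ↦ G q.1 (Ψ q z) +
    ∑ j, (c j + clamp q.2 * ε j) * (b j q.1 (Ψ q z) * g j q z) with hS_def
  have hbg : ∀ j, FamM fun (q : P × ℝ) z ↦ b j q.1 (Ψ q z) * g j q z := fun j ↦
    FamMOn.mul isOpen_univ (hbΨ j) (hg j)
  have hterm : ∀ j, FamM fun (q : P × ℝ) z ↦
      (c j + clamp q.2 * ε j) * (b j q.1 (Ψ q z) * g j q z) := fun j ↦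
    FamMOn.mul isOpen_univ (hw j) (hbg j)
  have hsum : FamM fun (q : P × ℝ) z ↦
      ∑ j, (c j + clamp q.2 * ε j) * (b j q.1 (Ψ q z) * g j q z) :=
    FamMOn.sum isOpen_univ fun j _ ↦ hterm j
  have hS : FamM S := FamMOn.add isOpen_univ hGΨ hsum
  refine ⟨fun x ↦ ∫ s in (0 : ℝ)..1, S (p, s) x, (hS.integral zero_le_one).contMDiff p, fun x ↦ ?_⟩
  ext v
  rw [add_apply, hS.coDeriv_integral zero_le_one]
  -- `K t` is the value of `Ψ_t^* λ_t` on the vector `v` at `x`.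
  set K : ℝ → ℝ := fun t ↦ ∑ j, ((c j + t * ε j) * b j p (Ψ (p, t) x)) *
    coDeriv (fun z ↦ B j p (Ψ (p, t) z)) x v with hK_def
  have hK : ∀ t ∈ Icc (0 : ℝ) 1, HasDerivWithinAt K (coDeriv (S (p, t)) x v) (Icc 0 1) t := by
    intro t ht
    have h1 : ∀ j, HasDerivWithinAt (fun t ↦ (c j + t * ε j) * b j p (Ψ (p, t) x))
        (ε j * b j p (Ψ (p, t) x) + (c j + t * ε j) *
          coDeriv (b j p) (Ψ (p, t) x) (X (p, t) (Ψ (p, t) x))) (Icc 0 1) t := by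
      intro j
      have h2 : HasDerivWithinAt (fun t ↦ c j + t * ε j) (ε j) (Icc 0 1) t := by
        simpa using ((hasDerivWithinAt_id t (Icc 0 1)).mul_const (ε j)).const_add (c j)
      exact h2.mul (hflow p x (b j p) ((hb j).contMDiff p) t ht)
    have h2 : ∀ j, HasDerivWithinAt (fun t ↦ coDeriv (fun z ↦ B j p (Ψ (p, t) z)) x v)
        (coDeriv (g j (p, t)) x v) (Icc 0 1) t := fun j ↦
      hasDerivWithinAt_coDeriv_flow hΨ hΨ0 hflow (fun p ↦ (hB j).contMDiff p)
        (hXsmooth _ (hB j)) p x v ht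
    have h3 := HasDerivWithinAt.fun_sum (u := Finset.univ) fun j _ ↦ (h1 j).mul (h2 j)
    refine h3.congr_deriv ?_
    set y := Ψ (p, t) x with hy
    set v' : Plane := mfderiv HalfPlaneModel HalfPlaneModel (Ψ (p, t)) x v with hv'
    have hcomp : ∀ u : M → ℝ, SmoothFun u → coDeriv (fun z ↦ u (Ψ (p, t) z)) x v = coDeriv u y v' :=
      fun u hu ↦ coDeriv_comp ((Ψ (p, t)).contMDiff x) (hu _) v
    have h4 : coDeriv (S (p, t)) x v = coDeriv (G p) y v' + ∑ j, (c j + t * ε j) *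
        (b j p y * coDeriv (g j (p, t)) x v +
          coDeriv (B j p) y (X (p, t) y) * coDeriv (b j p) y v') := by
      simp only [hS_def]
      rw [coDeriv_add (hGΨ.contMDiff (p, t) x) (hsum.contMDiff (p, t) x), add_apply,
        hcomp _ (hG.contMDiff p), coDeriv_sum fun j _ ↦ (hterm j).contMDiff (p, t) x, sum_apply]
      refine congrArg _ (Finset.sum_congr rfl fun j _ ↦ ?_)
      rw [coDeriv_const_mul ((hbg j).contMDiff (p, t) x),
        coDeriv_mul ((hbΨ j).contMDiff (p, t) x) ((hg j).contMDiff (p, t) x), smul_apply,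
        add_apply, smul_apply, smul_apply, hcomp _ ((hb j).contMDiff p), clamp_of_mem ht]
      rfl
    -- The equation `dλ_t(X_t, ·) = -γ` that defines the field.
    have h5 : ∑ j, ((c j + t * ε j) * coDeriv (b j p) y (X (p, t) y) * coDeriv (B j p) y v' -
        (c j + t * ε j) * coDeriv (b j p) y v' * coDeriv (B j p) y (X (p, t) y)) =
        -γ p y v' := by
      have h6 := areaSum_mul (fun j ↦ a j (p, t)) (fun j ↦ B j p) y (X (p, t) y) v'
      have h7 : ∀ j, coDeriv (a j (p, t)) y = (c j + t * ε j) • coDeriv (b j p) y := by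
        intro j
        simp only [ha_def]
        rw [coDeriv_const_mul ((hb j).contMDiff p y), clamp_of_mem ht]
      simp only [h7, smul_apply, smul_eq_mul] at h6
      rw [h6]
      simp only [hX_def, PiLp.smul_apply, smul_eq_mul]
      rw [← area_covectorRot]
      field_simp [hne' (p, t) y]
    have h6 : γ p y v' = ∑ j, ε j * b j p y * coDeriv (B j p) y v' - coDeriv (G p) y v' := by
      simp only [hγ_def, sub_apply, formSum_apply]
    rw [h4, ← sub_eq_zero]
    rw [h6] at h5
    simp only [hcomp _ ((hB _).contMDiff p)]
    have h7 : ∀ j, (ε j * b j p y + (c j + t * ε j) * coDeriv (b j p) y (X (p, t) y)) *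
        coDeriv (B j p) y v' + (c j + t * ε j) * b j p y * coDeriv (g j (p, t)) x v =
        (ε j * b j p y * coDeriv (B j p) y v') +
        (((c j + t * ε j) * coDeriv (b j p) y (X (p, t) y) * coDeriv (B j p) y v' -
        (c j + t * ε j) * coDeriv (b j p) y v' * coDeriv (B j p) y (X (p, t) y))) +
        (c j + t * ε j) * (b j p y * coDeriv (g j (p, t)) x v +
          coDeriv (B j p) y (X (p, t) y) * coDeriv (b j p) y v') := fun j ↦ by ring
    simp only [h7, Finset.sum_add_distrib]
    rw [h5]
    ring
  have hSc : Continuous fun s ↦ coDeriv (S (p, s)) x v :=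
    (hS.continuous_coDeriv_apply x v).comp (f := fun s : ℝ ↦ (p, s)) (by fun_prop)
  have h1 := intervalIntegral.integral_eq_sub_of_hasDerivAt_of_le zero_le_one
    (fun s hs ↦ (hK s hs).continuousWithinAt)
    (fun s hs ↦ (hK s (Ioo_subset_Icc_self hs)).hasDerivAt (Icc_mem_nhds hs.1 hs.2))
    (hSc.intervalIntegrable _ _)
  rw [h1]
  simp only [hK_def, formSum_apply, one_mul, zero_mul, add_zero, hΨ0]
  ring

end Moser

/-! ### The deformation retraction -/

section Support

variable {M : Type*} [TopologicalSpace M] [ChartedSpace (EuclideanHalfSpace 2) M]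

theorem isCompactlySupported_iff {φ : Diffeo M} : IsCompactlySupported φ ↔
    ∀ x ∈ HalfPlaneModel.boundary M, ∀ᶠ z in 𝓝 x, φ z = z := by
  rw [IsCompactlySupported, ← compl_subset_compl, HalfPlaneModel.compl_interior]
  refine forall₂_congr fun x _ ↦ ?_
  rw [← interior_compl, mem_interior_iff_mem_nhds]
  simp only [compl_ofPred, not_not]
  rfl

end Support

section Retraction

variable {M : Type*} [TopologicalSpace M] [ChartedSpace (EuclideanHalfSpace 2) M]
  [IsManifold HalfPlaneModel ∞ M] {ι : Type} [Fintype ι] {α : OneForm M} {a h : ι → M → ℝ}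

variable (ha : ∀ i, SmoothFun (a i)) (hh : ∀ i, SmoothFun (h i))
  (hα : ∀ (x : M) (v : TangentSpace HalfPlaneModel x), α x v = formSum a h x v)

/-- The area of a combination of `∑ a i d(h i)` and `∑ a' i d(h' i)`, presented as one sum over two
copies of the index set. -/
theorem areaSum_sumElim [T2Space M] {a' h' : ι → M → ℝ} (ha : ∀ i, SmoothFun (a i))
    (ha' : ∀ i, SmoothFun (a' i)) (r r' : ℝ) (x : M) :
    areaSum (fun j z ↦ Sum.elim (fun _ : ι ↦ r) (fun _ : ι ↦ r') j * Sum.elim a a' j z)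
      (Sum.elim h h') x = r * areaSum a h x + r' * areaSum a' h' x := by
  simp only [areaSum, Fintype.sum_sum_type, Sum.elim_inl, Sum.elim_inr, Finset.mul_sum]
  refine congrArg₂ _ (Finset.sum_congr rfl fun i _ ↦ ?_) (Finset.sum_congr rfl fun i _ ↦ ?_)
  · rw [coDeriv_const_mul (ha i x), wedge_smul_left]
  · rw [coDeriv_const_mul (ha' i x), wedge_smul_left]

theorem formSum_sumElim (a h a' h' : ι → M → ℝ) (r r' : ℝ) (x : M) :
    formSum (fun j z ↦ Sum.elim (fun _ : ι ↦ r) (fun _ : ι ↦ r') j * Sum.elim a a' j z)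
      (Sum.elim h h') x = r • formSum a h x + r' • formSum a' h' x := by
  simp only [formSum, Fintype.sum_sum_type, Sum.elim_inl, Sum.elim_inr, Finset.smul_sum, mul_smul]

theorem formSum_comp_of_eventually {φ : M → M} {x : M} (hφ : ∀ᶠ z in 𝓝 x, φ z = z) :
    formSum (fun i z ↦ a i (φ z)) (fun i z ↦ h i (φ z)) x = formSum a h x := by
  refine Finset.sum_congr rfl fun i _ ↦ ?_
  exact congrArg₂ _ (congrArg (a i) hφ.self_of_nhds)
    (coDeriv_congr (hφ.mono fun z hz ↦ congrArg (h i) hz))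

include hα in
theorem isExactSymplectomorphism_iff (ha : ∀ i, SmoothFun (a i)) (hh : ∀ i, SmoothFun (h i))
    (φ : Diffeo M) : IsExactSymplectomorphism α φ ↔ ∃ F, SmoothFun F ∧ ∀ x,
      formSum (fun i z ↦ a i (φ z)) (fun i z ↦ h i (φ z)) x = formSum a h x + coDeriv F x := by
  refine exists_congr fun F ↦ and_congr_right fun hF ↦ forall_congr' fun x ↦ ?_
  rw [ContinuousLinearMap.ext_iff]
  refine forall_congr' fun v ↦ ?_
  have h1 := pullback_apply_eq ha hh hα φ x v
  have h2 := mfderiv_apply_eq_coDeriv (hF x) v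
  have h3 : pullback φ α x v - α x v = coDeriv F x v ↔
      formSum (fun i z ↦ a i (φ z)) (fun i z ↦ h i (φ z)) x v =
        formSum a h x v + coDeriv F x v := by
    rw [← h1, ← hα, sub_eq_iff_eq_add']
  exact Iff.trans (by rw [← h2]; rfl) h3

theorem FamM.continuous_areaSum {P : Type*} [TopologicalSpace P] {A K : ι → P → M → ℝ}
    (hA : ∀ i, FamM (A i)) (hK : ∀ i, FamM (K i)) (x : M) :
    Continuous fun p ↦ areaSum (fun i ↦ A i p) (fun i ↦ K i p) x := by
  simp only [areaSum, wedge]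
  refine continuous_finsetSum _ fun i _ ↦ ?_
  have h1 := fun w ↦ (hA i).continuous_coDeriv_apply x w
  have h2 := fun w ↦ (hK i).continuous_coDeriv_apply x w
  exact ((h1 _).mul (h2 _)).sub ((h1 _).mul (h2 _))

variable [T2Space M] [CompactSpace M]

include ha hh hα in
/-- The Moser isotopies of all compactly supported orientation-preserving diffeomorphisms `φ`,
for the segment from `α` to `φ^* α`. -/
theorem exists_moser_isotopy (hne : ∀ x, areaSum a h x ≠ 0) :
    ∃ Θ : diffPlusC α × ℝ → Diffeo M, Continuous Θ ∧ (∀ φ, Θ (φ, 0) = φ) ∧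
      (∀ φ, ∀ t ∈ Icc (0 : ℝ) 1, Θ (φ, t) ∈ diffPlusC α) ∧ (∀ φ, Θ (φ, 1) ∈ exactC α) ∧
      ∀ φ : diffPlusC α, (φ : Diffeo M) ∈ exactC α → ∀ t, Θ (φ, t) = φ := by
  have hφ : FamMap fun φ : diffPlusC α ↦ ((φ : Diffeo M) : M → M) :=
    famMap_diffeo.param continuous_subtype_val
  have hgerm : ∀ φ : diffPlusC α, ∀ x ∈ HalfPlaneModel.boundary M,
      ∀ᶠ z in 𝓝 x, (φ : Diffeo M) z = z := fun φ ↦ isCompactlySupported_iff.1 φ.2.1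
  have haφ : ∀ i, FamM fun (φ : diffPlusC α) z ↦ a i ((φ : Diffeo M) z) := fun i ↦ hφ _ (ha i)
  have hhφ : ∀ i, FamM fun (φ : diffPlusC α) z ↦ h i ((φ : Diffeo M) z) := fun i ↦ hφ _ (hh i)
  -- With `λ_t = ∑ (c j + t * ε j) * b j • d(B j)`, the segment runs from `α` to `φ^* α`.
  let b : ι ⊕ ι → diffPlusC α → M → ℝ := fun j φ ↦
    Sum.elim a (fun i z ↦ a i ((φ : Diffeo M) z)) j
  let B : ι ⊕ ι → diffPlusC α → M → ℝ := fun j φ ↦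
    Sum.elim h (fun i z ↦ h i ((φ : Diffeo M) z)) j
  let c : ι ⊕ ι → ℝ := Sum.elim (fun _ ↦ 1) (fun _ ↦ 0)
  let ε : ι ⊕ ι → ℝ := Sum.elim (fun _ ↦ -1) (fun _ ↦ 1)
  have hb : ∀ j, FamM (b j) := by
    rintro (i | i)
    exacts [.of_contMDiff (ha i), haφ i]
  have hB : ∀ j, FamM (B j) := by
    rintro (i | i)
    exacts [.of_contMDiff (hh i), hhφ i]
  have hcε : ∀ t j, c j + t * ε j = Sum.elim (fun _ : ι ↦ 1 - t) (fun _ : ι ↦ t) j := by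
    rintro t (i | i) <;> simp [c, ε, sub_eq_add_neg]
  have hvel : ∀ (φ : diffPlusC α) x, formSum (fun j z ↦ ε j * b j φ z) (fun j ↦ B j φ) x =
      formSum (fun i z ↦ a i ((φ : Diffeo M) z)) (fun i z ↦ h i ((φ : Diffeo M) z)) x -
        formSum a h x := by
    intro φ x
    refine (formSum_sumElim ..).trans ?_
    module
  have hvel0 : ∀ φ : diffPlusC α, ∀ x ∈ HalfPlaneModel.boundary M, ∀ᶠ z in 𝓝 x,
      formSum (fun j z ↦ ε j * b j φ z) (fun j ↦ B j φ) z = 0 := by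
    intro φ x hx
    filter_upwards [(hgerm φ x hx).eventually_nhds] with z hz
    rw [hvel, formSum_comp_of_eventually hz, sub_self]
  obtain ⟨G, hG, hG0, hGprim⟩ := exists_primitive_family
    (A := fun j φ z ↦ ε j * b j φ z) (K := B)
    (fun j ↦ FamMOn.mul isOpen_univ (.of_param isOpen_univ continuous_const) (hb j)) hB hvel0
  have hbd : ∀ φ : diffPlusC α, ∀ x ∈ HalfPlaneModel.boundary M, ∀ᶠ z in 𝓝 x,
      formSum (fun j z ↦ ε j * b j φ z) (fun j ↦ B j φ) z = coDeriv (G φ) z := by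
    intro φ x hx
    filter_upwards [hvel0 φ x hx, hG0 φ x hx] with z h1 h2
    rw [h1, h2]
  have hnet : ∀ (φ : diffPlusC α) x, ∀ t ∈ Icc (0 : ℝ) 1,
      areaSum (fun j z ↦ (c j + t * ε j) * b j φ z) (fun j ↦ B j φ) x ≠ 0 := by
    intro φ x t ht
    have h1 := (isOrientationPreserving_iff ha hh hα hne φ).1 φ.2.2 x
    simp only [hcε]
    refine ne_of_eq_of_ne (areaSum_sumElim ha (fun i ↦ (haφ i).contMDiff φ) ..) ?_
    set W := areaSum a h x with hW
    set W' := areaSum (fun i z ↦ a i ((φ : Diffeo M) z)) (fun i z ↦ h i ((φ : Diffeo M) z)) x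
    have h2 : (1 - t) * W + t * W' = W * ((1 - t) + t * (W' / W)) := by
      have : W ≠ 0 := hne x
      field_simp
    rw [h2]
    refine mul_ne_zero (hne x) (ne_of_gt ?_)
    rcases ht.1.eq_or_lt with rfl | h0
    · simp
    · exact add_pos_of_nonneg_of_pos (sub_nonneg.2 ht.2) (mul_pos h0 h1)
  obtain ⟨Ψ, hΨ, hΨ0, hfix, hend⟩ := exists_moser_flow hb hB hG hnet hbd
  have hΘ : FamMap fun q : diffPlusC α × ℝ ↦ ((Ψ q).trans (q.1 : Diffeo M) : M → M) :=
    (hφ.param continuous_fst).comp hΨ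
  have hsupp : ∀ q : diffPlusC α × ℝ, IsCompactlySupported ((Ψ q).trans (q.1 : Diffeo M)) := by
    rintro ⟨φ, t⟩
    refine isCompactlySupported_iff.2 fun x hx ↦ ?_
    filter_upwards [hbd φ x hx, hgerm φ x hx] with z h1 h2
    change (φ : Diffeo M) (Ψ (φ, t) z) = z
    rw [hfix φ z h1 t, h2]
  have hzero : ∀ φ : diffPlusC α, (Ψ (φ, 0)).trans (φ : Diffeo M) = φ := fun φ ↦
    Diffeomorph.ext fun x ↦ congrArg (φ : Diffeo M) (hΨ0 φ x)
  refine ⟨fun q ↦ (Ψ q).trans (q.1 : Diffeo M), hΘ.continuous_diffeo, hzero,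
    fun φ t ht ↦ ⟨hsupp _, ?_⟩, fun φ ↦ ⟨hsupp _, ?_⟩, fun φ hex t ↦ ?_⟩
  · rw [isOrientationPreserving_iff ha hh hα hne]
    intro x
    -- The Jacobian never vanishes along the isotopy, so it keeps its sign.
    set f : ℝ → ℝ := fun s ↦ areaSum (fun i z ↦ a i ((Ψ (φ, s)).trans (φ : Diffeo M) z))
      (fun i z ↦ h i ((Ψ (φ, s)).trans (φ : Diffeo M) z)) x / areaSum a h x with hf
    have hfc : Continuous f := ((FamM.continuous_areaSum (fun i ↦ hΘ _ (ha i))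
      (fun i ↦ hΘ _ (hh i)) x).comp (f := fun s : ℝ ↦ (φ, s)) (by fun_prop)).div_const _
    have hf0 : 0 < f 0 := by
      simp only [hf, hzero]
      exact (isOrientationPreserving_iff ha hh hα hne φ).1 φ.2.2 x
    by_contra hneg
    obtain ⟨s, -, hs⟩ := intermediate_value_Icc' ht.1 hfc.continuousOn
      (show (0 : ℝ) ∈ Icc (f t) (f 0) from ⟨not_lt.1 hneg, hf0.le⟩)
    exact div_ne_zero (areaSum_comp_ne_zero ha hh hα hne _ x) (hne x) hs
  · obtain ⟨F, hF, hFx⟩ := hend φ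
    refine (isExactSymplectomorphism_iff hα ha hh _).2 ⟨F, hF, fun x ↦ ?_⟩
    have h1 := hFx x
    have h2 : formSum (fun j z ↦ (c j + ε j) * b j φ (Ψ (φ, 1) z))
        (fun j z ↦ B j φ (Ψ (φ, 1) z)) x =
        formSum (fun i z ↦ a i ((Ψ (φ, 1)).trans (φ : Diffeo M) z))
          (fun i z ↦ h i ((Ψ (φ, 1)).trans (φ : Diffeo M) z)) x := by
      simp [formSum, Fintype.sum_sum_type, b, B, c, ε]
    have h3 : formSum (fun j z ↦ c j * b j φ z) (fun j ↦ B j φ) x = formSum a h x := by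
      simp [formSum, Fintype.sum_sum_type, b, B, c]
    rw [← h2, h1, h3]
  · obtain ⟨F, hF, hFx⟩ := (isExactSymplectomorphism_iff hα ha hh _).1 hex.2
    have hprim : IsPrimitive (fun j φ z ↦ ε j * b j φ z) B φ F :=
      ⟨hF, fun x ↦ by rw [hvel, hFx, add_sub_cancel_left]⟩
    exact Diffeomorph.ext fun x ↦
      congrArg (φ : Diffeo M) (hfix φ x ((hGprim φ F hprim).2 x) t)

include ha hh hα in
theorem isDeformationRetract_exactC (hne : ∀ x, areaSum a h x ≠ 0) :
    IsDeformationRetract {φ : diffPlusC α | (φ : Diffeo M) ∈ exactC α} := by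
  obtain ⟨Θ, hΘ, h0, hmem, h1, hfix⟩ := exists_moser_isotopy ha hh hα hne
  refine ⟨⟨fun φ ↦ ⟨⟨Θ (φ, 1), hmem φ 1 (by simp)⟩, h1 φ⟩, ?_⟩,
    ⟨⟨⟨⟨fun q ↦ ⟨Θ (q.2, q.1), hmem q.2 q.1 q.1.2⟩, ?_⟩, ?_, ?_⟩, ?_⟩⟩⟩
  · exact ((hΘ.comp (by fun_prop : Continuous fun φ : diffPlusC α ↦ (φ, (1 : ℝ)))).subtype_mk
      _).subtype_mk _
  · exact (hΘ.comp (by fun_prop : Continuous fun q : unitInterval × diffPlusC α ↦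
      (q.2, (q.1 : ℝ)))).subtype_mk _
  · exact fun φ ↦ Subtype.ext (h0 φ)
  · exact fun φ ↦ rfl
  · exact fun t φ hφ ↦ Subtype.ext (hfix φ hφ t)

end Retraction

end LiouvilleSurface

end

theorem lemma4p3 {M : Type*} [TopologicalSpace M] [T2Space M] [CompactSpace M]
    [ChartedSpace (EuclideanHalfSpace 2) M] [IsManifold LiouvilleSurface.HalfPlaneModel ∞ M]
    (α : LiouvilleSurface.OneForm M) (hα : LiouvilleSurface.IsLiouville α) :
    LiouvilleSurface.exactC α ⊆ LiouvilleSurface.diffPlusC α ∧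
      LiouvilleSurface.IsDeformationRetract
        {φ : LiouvilleSurface.diffPlusC α | (φ : LiouvilleSurface.Diffeo M) ∈
          LiouvilleSurface.exactC α} := by
  obtain ⟨ι, _, a, h, ha, hh, hform⟩ := hα.smooth.exists_formSum
  have hne := LiouvilleSurface.areaSum_ne_zero ha hh hform hα.nondegenerate
  exact ⟨LiouvilleSurface.exactC_subset_diffPlusC ha hh hform hne,
    LiouvilleSurface.isDeformationRetract_exactC ha hh hform hne⟩
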